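/- Let $D=\{x\in\mathbb R^2 : x_1\ge 0,\ x_2\ge 0\}$. For an integer $n\ge 1$ let $K_n$ be the set of functions $f\in C^n(D)$ (derivatives up to the boundary) whose support is a compact subset of $D$ and satisfies $\delta_f:=\min_{x\in\operatorname{supp} f}x_1>0$, and put $$\|f\|_{K_n}=\|f\|_{C^n(D)}+|\operatorname{supp} f|+\delta_f^{-1}$$ (with $\delta_f^{-1}=0$ if $f\equiv 0$). Consider on $D$ the hyperbolic 2D Euler equation $$\partial_t\omega+(u\cdot\nabla)\omega=0,\qquad \omega(x,0)=\omega_0(x),$$ $$u=\bigl(-x_1\,\Omega(x_1x_2,t),\ x_2\,\Omega(x_1x_2,t)\bigr),\qquad \Omega(\eta,t)=\int_{\{y\in D:\ y_1y_2\ge\eta\}}\frac{\omega(y,t)}{|y|^2}\,dy .$$ A solution (of class $K_n$) on $I=[0,T]$, $T>0$, or $I=[0,\infty)$ means a function $\omega$ satisfying these equations pointwise on $D\times I$ (with one-sided derivatives on the boundary) such that $\omega(\cdot,t)\in K_n$ for every $t\in I$, $t\mapsto\omega(\cdot,t)$ is continuous in the $C^n(D)$ norm, and $\|\omega(\cdot,t)\|_{K_n}$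 is bounded on bounded subintervals of $I$. (1) Let $n\ge 1$ and $\omega_0\in K_n$. Then there is a solution $\omega$ on $[0,\infty)$ with initial value $\omega_0$; moreover $|\operatorname{supp}\omega(\cdot,t)|$ and $\delta_{\omega(\cdot,t)}^{-1}$ are continuous in $t\ge0$. It is unique: every solution on $[0,\infty)$, or on $[0,T]$ for some $T>0$, with initial value $\omega_0$ coincides with $\omega$ on its interval of definition. (2) If in addition $\omega_0\ge 0$ on $D$, then there is a constant $C>0$, depending only on $\omega_0$ and $n$, such that $$\|\omega(\cdot,t)\|_{K_n}\le C e^{Ct}\qquad\text{for all } t\ge 0 .$$ (3) There is an initial datum $\omega_0\ge 0$, belonging to $K_n$ for every $n\ge 1$, whose global solution $\omega$ (which is of class $K_n$ for every $n\ge1$) has exponentially growing derivatives of every order: for every $l\ge 1$ there is $c>0$ such that $$\sup_{x\in D}|D^l\omega(x,t)|\ge c\,e^{ct}\qquad\text{for all } t\ge 0 .$$ -/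

import Mathlib

open Set Filter Topology MeasureTheory
open scoped ENNReal

namespace HyperbolicEuler

noncomputable section

/-- The closed first quadrant `D`. -/
def quadrant : Set (ℝ × ℝ) := {x | 0 ≤ x.1 ∧ 0 ≤ x.2}

/-- The support of `f`, regarded as a function on the quadrant. -/
def suppD (f : ℝ × ℝ → ℝ) : Set (ℝ × ℝ) := closure {x | x ∈ quadrant ∧ f x ≠ 0}

/-- `δ_f`, the least value of `x₁` on the support of `f` (it is `∞` if `f` vanishes on `D`). -/
def delta (f : ℝ × ℝ → ℝ) : ℝ≥0∞ := ⨅ x ∈ suppD f, ENNReal.ofReal x.1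

/-- The supremum over `D` of the norm of the derivative of order `k`; one-sided derivatives are
used on the boundary of `D`. -/
def derivSup (k : ℕ) (f : ℝ × ℝ → ℝ) : ℝ≥0∞ :=
  ⨆ x ∈ quadrant, ‖iteratedFDerivWithin ℝ k f quadrant x‖ₑ

/-- The `C^n(D)` norm. -/
def cNorm (n : ℕ) (f : ℝ × ℝ → ℝ) : ℝ≥0∞ := ∑ k ∈ Finset.range (n + 1), derivSup k f

/-- `‖f‖_{K_n} = ‖f‖_{C^n(D)} + |supp f| + δ_f⁻¹`. -/
def kNorm (n : ℕ) (f : ℝ × ℝ → ℝ) : ℝ≥0∞ := cNorm n f + volume (suppD f) + (delta f)⁻¹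

/-- The class `K_n`; only the values of `f` on `D` matter. -/
structure MemK (n : ℕ) (f : ℝ × ℝ → ℝ) : Prop where
  contDiffOn : ContDiffOn ℝ n f quadrant
  isCompact_supp : IsCompact (suppD f)
  delta_pos : 0 < delta f

/-- `Ω(η) = ∫_{y ∈ D, y₁ y₂ ≥ η} w(y) / |y|² dy`. -/
def bigOmega (w : ℝ × ℝ → ℝ) (η : ℝ) : ℝ :=
  ∫ y in {y : ℝ × ℝ | y ∈ quadrant ∧ η ≤ y.1 * y.2}, w y / (y.1 ^ 2 + y.2 ^ 2)

/-- The velocity `u = (-x₁ Ω(x₁ x₂), x₂ Ω(x₁ x₂))` generated by the vorticity `w`. -/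
def velocity (w : ℝ × ℝ → ℝ) (x : ℝ × ℝ) : ℝ × ℝ :=
  (-x.1 * bigOmega w (x.1 * x.2), x.2 * bigOmega w (x.1 * x.2))

/-- `ω` is a classical solution on the time interval `I` (of the form `[0, T]` or `[0, ∞)`) of
`∂ₜ ω + (u · ∇) ω = 0` with initial value `ω₀`. It takes values in `K_n`, is continuous in time
with respect to the `C^n(D)` norm, and its `K_n` norm is bounded on bounded time intervals. -/
structure IsSolutionOn (n : ℕ) (ω₀ : ℝ × ℝ → ℝ) (I : Set ℝ) (ω : ℝ → ℝ × ℝ → ℝ) : Prop where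
  memK : ∀ t ∈ I, MemK n (ω t)
  continuous_cNorm : ∀ t ∈ I, Tendsto (fun s => cNorm n (fun x => ω s x - ω t x)) (𝓝[I] t) (𝓝 0)
  bounded_kNorm : ∀ T : ℝ, (⨆ t ∈ I ∩ Iic T, kNorm n (ω t)) < ∞
  initial : ∀ x ∈ quadrant, ω 0 x = ω₀ x
  equation : ∀ t ∈ I, ∀ x ∈ quadrant,
    HasDerivWithinAt (fun s => ω s x)
      (-(fderivWithin ℝ (ω t) quadrant x (velocity (ω t) x))) I t

end

end HyperbolicEuler

open HyperbolicEuler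

namespace HyperbolicEuler

/-! ### Calculus of functions whose derivatives are bounded by powers of a weight. -/

noncomputable section

/-! The velocity is tangent to the hyperbolas x₁x₂ = h, and on each of them it is a dilation at rate
Ω(h, t). Hence x₁x₂ is conserved along trajectories. With the strain G(t, h) = ∫₀ᵗ Ω(h, s) ds, the
solution must be ω(x, t) = ω₀(x₁ e^G, x₂ e^(-G)), where G is taken at (t, x₁x₂); this is
`vorticity`. Writing the integral for Ω in the coordinates z = y₁, h = y₁y₂ and rescaling z by e^G
on each hyperbola gives Ω(η, t) = ∫_η^H F(h, G(t, h)) dh, where F is `strainDensity`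
(`Profile.bigOmega_comp_strainMap`). The Euler equation thus reduces to a closed integral equation
for a function of t and the single variable η.

Global existence rests on |F(h, g)| ≤ C / (e^(-2g) + h² e^(2g)), which is at most C e^(2g) and at
most C/h. Splitting the integral where these two bounds cross shows that the rate grows at most
linearly in sup |G| (`IsDensity.abs_integral_le`), so Gronwall excludes blow-up. Uniqueness for the
strain equation is the iterated Lipschitz estimate. An arbitrary solution is constant along its
characteristics (`IsSolutionOn.exists_strain`), so its strain solves the same equation.

For regularity, ∂G/∂η = -∫₀ᵗ F(η, G(s, η)) ds expresses the derivative through G itself, and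
smoothness is gained one order at a time (`weightSmooth_strain`). The weight calculus shows along
the way that all derivatives of ω are bounded by powers of e^(m(t)), where m bounds |G|. The area of
the support is conserved and δ shrinks by at most e^(-m).

For nonnegative data G is nonnegative and nonincreasing in η, so G(t, 0) is its maximum. The
identity ∫₀ᵗ Ω(0, s)² ds = 2 ∫₀ᴴ ∫₀^{G(t,h)} F(h, g) dg dh (`IsStrain.integral_sq_rate`) has a right
side at most linear in G(t, 0), by an arctangent bound on the inner integral. With Young's
inequality this gives G(t, 0) = O(t) (`IsStrain.le_linear`), hence exponential bounds.

For growth, the hyperbolas with h of order e^(-2G) contribute a fixed positive amount to Ω(0, t) if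
ω₀ is bounded below near part of the axis x₂ = 0 (`IsStrain.le_rate`). Then G(t, 0) ≥ ct, and on
that axis ω is a function of one variable compressed by e^(G(t,0)). -/

/-- A parametrised function that is jointly continuous on `T ×ˢ S` and bounded there by a power of
the weight `w`. -/
structure WeightBounded {P E F : Type} [TopologicalSpace P] [TopologicalSpace E]
    [NormedAddCommGroup F] (T : Set P) (S : Set E) (w : P → E → ℝ) (a : P → E → F) : Prop where
  continuousOn : ContinuousOn (Function.uncurry a) (T ×ˢ S)
  bound : ∃ N : ℕ, ∀ p ∈ T, ∀ x ∈ S, ‖a p x‖ ≤ w p x ^ N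

/-- A parametrised function whose derivatives up to order `k` in the second variable, taken within
`S`, are jointly continuous and bounded by powers of the weight `w`. -/
def WeightSmooth {P E : Type} [TopologicalSpace P] [NormedAddCommGroup E] [NormedSpace ℝ E]
    (T : Set P) (S : Set E) (w : P → E → ℝ) :
    ℕ → ∀ {F : Type} [NormedAddCommGroup F] [NormedSpace ℝ F], (P → E → F) → Prop
  | 0, _, _, _, a => WeightBounded T S w a
  | k + 1, F, _, _, a => WeightBounded T S w a ∧ ∃ b : P → E → E →L[ℝ] F,
      WeightSmooth T S w k b ∧ ∀ p ∈ T, ∀ x ∈ S, HasFDerivWithinAt (a p) (b p x) S x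

/-- Since the weight is at least 2, constants are absorbed into its powers, and the closure
properties below only have to keep track of exponents. -/
theorem exists_le_weight_pow {P E : Type} {T : Set P} {S : Set E} {w : P → E → ℝ}
    (hw : ∀ p ∈ T, ∀ x ∈ S, 2 ≤ w p x) (C : ℝ) :
    ∃ N : ℕ, ∀ p ∈ T, ∀ x ∈ S, C ≤ w p x ^ N := by
  obtain ⟨N, hN⟩ := pow_unbounded_of_one_lt C (one_lt_two)
  exact ⟨N, fun p hp x hx => hN.le.trans (pow_le_pow_left₀ (by norm_num) (hw p hp x hx) N)⟩

/-- A function that is jointly continuous on `U ×ˢ K` with `K` compact is continuous in the first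
variable, uniformly over `K`. -/
theorem eventually_forall_compact_dist_lt {X Y F : Type} [TopologicalSpace X] [TopologicalSpace Y]
    [NormedAddCommGroup F]
    {K : Set Y} (hK : IsCompact K) {U : Set X} {f : X → Y → F}
    (hf : ContinuousOn (Function.uncurry f) (U ×ˢ K)) {x₀ : X} (hx₀ : x₀ ∈ U) {ε : ℝ}
    (hε : 0 < ε) : ∀ᶠ x in 𝓝[U] x₀, ∀ y ∈ K, ‖f x y - f x₀ y‖ < ε := by
  have key : ∀ y ∈ K, ∃ u ∈ 𝓝[U] x₀, ∃ v ∈ 𝓝[K] y, ∀ x ∈ u, ∀ y' ∈ v, ‖f x y' - f x₀ y'‖ < ε := by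
    intro y hy
    have h1 : ContinuousWithinAt (fun q : X × Y => f q.1 q.2) (U ×ˢ K) (x₀, y) := hf (x₀, y) ⟨hx₀, hy⟩
    have h1' : ∀ᶠ q in 𝓝[U] x₀ ×ˢ 𝓝[K] y, ‖f q.1 q.2 - f x₀ y‖ < ε / 2 := by
      rw [ContinuousWithinAt, nhdsWithin_prod_eq, Metric.tendsto_nhds] at h1
      simpa [dist_eq_norm] using h1 (ε / 2) (by linarith)
    obtain ⟨u, hu, v, hv, huv⟩ := Filter.eventually_prod_iff.1 h1'
    refine ⟨{x | u x}, hu, {y | v y}, hv, fun x hx y' hy' => ?_⟩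
    have hu0 : u x₀ := mem_of_mem_nhdsWithin hx₀ hu
    have e1 := huv hx hy'
    have e2 := huv hu0 hy'
    calc ‖f x y' - f x₀ y'‖ = ‖(f x y' - f x₀ y) - (f x₀ y' - f x₀ y)‖ := by abel_nf
      _ ≤ ‖f x y' - f x₀ y‖ + ‖f x₀ y' - f x₀ y‖ := norm_sub_le _ _
      _ < ε := by simp only at e1 e2; linarith
  refine hK.induction_on (p := fun K' => ∀ᶠ x in 𝓝[U] x₀, ∀ y ∈ K', ‖f x y - f x₀ y‖ < ε)
    (by simp) (fun s t hst ht => ht.mono fun x hx y hy => hx y (hst hy))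
    (fun s t hs ht => (hs.and ht).mono fun x hx y hy => hy.elim (hx.1 y) (hx.2 y)) ?_
  intro y hy
  obtain ⟨u, hu, v, hv, huv⟩ := key y hy
  exact ⟨v, hv, Filter.mem_of_superset hu fun x hx y' hy' => huv x hx y' hy'⟩

section Calculus

variable {P P' E E' F G H : Type} [TopologicalSpace P] [TopologicalSpace P']
  [NormedAddCommGroup E] [NormedSpace ℝ E] [NormedAddCommGroup E'] [NormedSpace ℝ E']
  [NormedAddCommGroup F] [NormedSpace ℝ F]
  [NormedAddCommGroup G] [NormedSpace ℝ G] [NormedAddCommGroup H] [NormedSpace ℝ H]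
  {T : Set P} {T' : Set P'} {S : Set E} {S' : Set E'} {w : P → E → ℝ} {w' : P' → E' → ℝ} {k : ℕ}

namespace WeightSmooth

theorem weightBounded {a : P → E → F} (h : WeightSmooth T S w k a) : WeightBounded T S w a := by
  cases k with
  | zero => exact h
  | succ k => exact h.1

theorem of_succ {a : P → E → F} (h : WeightSmooth T S w (k + 1) a) : WeightSmooth T S w k a := by
  induction k generalizing F with
  | zero => exact h.1
  | succ k ih =>
    obtain ⟨h0, b, hb, hd⟩ := h
    exact ⟨h0, b, ih hb, hd⟩

theorem congr {a b : P → E → F} (h : WeightSmooth T S w k a)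
    (hab : ∀ p ∈ T, ∀ x ∈ S, b p x = a p x) : WeightSmooth T S w k b := by
  have h0 : WeightBounded T S w b := by
    obtain ⟨hc, N, hN⟩ := h.weightBounded
    refine ⟨hc.congr fun q hq => hab q.1 hq.1 q.2 hq.2, N, fun p hp x hx => ?_⟩
    rw [hab p hp x hx]
    exact hN p hp x hx
  cases k with
  | zero => exact h0
  | succ k =>
    obtain ⟨-, d, hd, hD⟩ := h
    exact ⟨h0, d, hd, fun p hp x hx =>
      (hD p hp x hx).congr (fun y hy => hab p hp y hy) (hab p hp x hx)⟩

theorem clm (hw : ∀ p ∈ T, ∀ x ∈ S, 2 ≤ w p x) (L : F →L[ℝ] G) {a : P → E → F}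
    (h : WeightSmooth T S w k a) : WeightSmooth T S w k (fun p x => L (a p x)) := by
  -- Order zero is settled for all target spaces at once, because the induction passes from F to E
  -- →L[ℝ] F.
  have h0 : ∀ {F G : Type} [NormedAddCommGroup F] [NormedSpace ℝ F] [NormedAddCommGroup G]
      [NormedSpace ℝ G] (L : F →L[ℝ] G) {a : P → E → F}, WeightBounded T S w a →
      WeightBounded T S w (fun p x => L (a p x)) := by
    intro F G _ _ _ _ L a ⟨hc, N, hN⟩
    obtain ⟨M, hM⟩ := exists_le_weight_pow hw ‖L‖
    refine ⟨L.continuous.comp_continuousOn hc, M + N, fun p hp x hx => ?_⟩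
    rw [pow_add]
    exact (L.le_opNorm _).trans (mul_le_mul (hM p hp x hx) (hN p hp x hx) (norm_nonneg _)
      (pow_nonneg (by linarith [hw p hp x hx]) _))
  induction k generalizing F G with
  | zero => exact h0 L h
  | succ k ih =>
    obtain ⟨ha, b, hb, hd⟩ := h
    exact ⟨h0 L ha, fun p x => L.comp (b p x), ih (ContinuousLinearMap.compL ℝ E F G L) hb,
      fun p hp x hx => L.hasFDerivAt.comp_hasFDerivWithinAt x (hd p hp x hx)⟩

theorem add (hw : ∀ p ∈ T, ∀ x ∈ S, 2 ≤ w p x) {a b : P → E → F}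
    (ha : WeightSmooth T S w k a) (hb : WeightSmooth T S w k b) :
    WeightSmooth T S w k (fun p x => a p x + b p x) := by
  have h0 : ∀ {F : Type} [NormedAddCommGroup F] [NormedSpace ℝ F] {a b : P → E → F},
      WeightBounded T S w a → WeightBounded T S w b →
      WeightBounded T S w (fun p x => a p x + b p x) := by
    intro F _ _ a b ⟨hc, N, hN⟩ ⟨hc', N', hN'⟩
    refine ⟨hc.add hc', max N N' + 1, fun p hp x hx => ?_⟩
    have h2 := hw p hp x hx
    have e1 : w p x ^ N ≤ w p x ^ max N N' := pow_le_pow_right₀ (by linarith) (le_max_left _ _)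
    have e2 : w p x ^ N' ≤ w p x ^ max N N' := pow_le_pow_right₀ (by linarith) (le_max_right _ _)
    have e3 : 0 ≤ w p x ^ max N N' := pow_nonneg (by linarith) _
    calc ‖a p x + b p x‖ ≤ ‖a p x‖ + ‖b p x‖ := norm_add_le _ _
      _ ≤ w p x ^ max N N' + w p x ^ max N N' :=
        add_le_add ((hN p hp x hx).trans e1) ((hN' p hp x hx).trans e2)
      _ ≤ w p x ^ (max N N' + 1) := by rw [pow_succ]; nlinarith
  induction k generalizing F with
  | zero => exact h0 ha hb
  | succ k ih =>
    obtain ⟨ha, a', ha', hda⟩ := ha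
    obtain ⟨hb, b', hb', hdb⟩ := hb
    exact ⟨h0 ha hb, _, ih ha' hb', fun p hp x hx => (hda p hp x hx).add (hdb p hp x hx)⟩

/-- The derivative of B(a, b) is a sum of two bilinear expressions, in (a, b') and in (a', b), so
the induction closes when it runs over all bilinear maps. Products, scalar multiples and
compositions of linear maps are all instances. -/
theorem bilin (hw : ∀ p ∈ T, ∀ x ∈ S, 2 ≤ w p x) (B : F →L[ℝ] G →L[ℝ] H) {a : P → E → F}
    {b : P → E → G} (ha : WeightSmooth T S w k a) (hb : WeightSmooth T S w k b) :
    WeightSmooth T S w k (fun p x => B (a p x) (b p x)) := by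
  have h0 : ∀ {F G H : Type} [NormedAddCommGroup F] [NormedSpace ℝ F] [NormedAddCommGroup G]
      [NormedSpace ℝ G] [NormedAddCommGroup H] [NormedSpace ℝ H] (B : F →L[ℝ] G →L[ℝ] H)
      {a : P → E → F} {b : P → E → G}, WeightBounded T S w a → WeightBounded T S w b →
      WeightBounded T S w (fun p x => B (a p x) (b p x)) := by
    intro F G H _ _ _ _ _ _ B a b ⟨hc, N, hN⟩ ⟨hc', N', hN'⟩
    obtain ⟨M, hM⟩ := exists_le_weight_pow hw ‖B‖
    refine ⟨(B.continuous.comp_continuousOn hc).clm_apply hc', M + N + N', fun p hp x hx => ?_⟩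
    have hpos : 0 ≤ w p x := by linarith [hw p hp x hx]
    rw [pow_add, pow_add]
    refine (B.le_opNorm₂ _ _).trans ?_
    gcongr
    exacts [hM p hp x hx, hN p hp x hx, hN' p hp x hx]
  induction k generalizing F G H with
  | zero => exact h0 B ha hb
  | succ k ih =>
    have ha1 := ha.of_succ
    have hb1 := hb.of_succ
    obtain ⟨ha, a', ha', hda⟩ := ha
    obtain ⟨hb, b', hb', hdb⟩ := hb
    exact ⟨h0 B ha hb, fun p x => B.precompR E (a p x) (b' p x) + B.precompL E (a' p x) (b p x),
      add hw (ih (B.precompR E) ha1 hb') (ih (B.precompL E) ha' hb1),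
      fun p hp x hx => B.hasFDerivWithinAt_of_bilinear (hda p hp x hx) (hdb p hp x hx)⟩

theorem mul (hw : ∀ p ∈ T, ∀ x ∈ S, 2 ≤ w p x) {a b : P → E → ℝ}
    (ha : WeightSmooth T S w k a) (hb : WeightSmooth T S w k b) :
    WeightSmooth T S w k (fun p x => a p x * b p x) :=
  bilin hw (ContinuousLinearMap.mul ℝ ℝ) ha hb

theorem neg (hw : ∀ p ∈ T, ∀ x ∈ S, 2 ≤ w p x) {a : P → E → F}
    (ha : WeightSmooth T S w k a) : WeightSmooth T S w k (fun p x => -a p x) :=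
  clm hw (-ContinuousLinearMap.id ℝ F) ha

theorem param {c : P → F} (hc : ContinuousOn c T)
    (hb : ∃ N : ℕ, ∀ p ∈ T, ∀ x ∈ S, ‖c p‖ ≤ w p x ^ N) :
    WeightSmooth T S w k (fun p _ => c p) := by
  have h0 : WeightBounded T S w (fun p (_ : E) => c p) :=
    ⟨hc.comp continuousOn_fst fun q hq => hq.1, hb⟩
  induction k generalizing F with
  | zero => exact h0
  | succ k ih =>
    have hz : WeightBounded T S w (fun (_ : P) (_ : E) => (0 : E →L[ℝ] F)) :=
      ⟨continuousOn_const, 0, fun p hp x hx => by simp⟩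
    exact ⟨h0, fun _ _ => 0, ih (c := fun _ => 0) continuousOn_const hz.bound hz,
      fun p hp x hx => hasFDerivWithinAt_const _ _ _⟩

theorem const (hw : ∀ p ∈ T, ∀ x ∈ S, 2 ≤ w p x) (c : F) :
    WeightSmooth T S w k (fun (_ : P) (_ : E) => c) :=
  param continuousOn_const (exists_le_weight_pow hw ‖c‖)

theorem linear (hw : ∀ p ∈ T, ∀ x ∈ S, 2 ≤ w p x) (hx : ∀ p ∈ T, ∀ x ∈ S, ‖x‖ ≤ w p x)
    (L : E →L[ℝ] F) : WeightSmooth T S w k (fun (_ : P) (x : E) => L x) := by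
  have h1 : WeightSmooth T S w k (fun (_ : P) (x : E) => x) := by
    have h0 : WeightBounded T S w (fun (_ : P) (x : E) => x) :=
      ⟨continuousOn_snd, 1, by simpa using hx⟩
    cases k with
    | zero => exact h0
    | succ k => exact ⟨h0, fun _ _ => ContinuousLinearMap.id ℝ E, const hw _,
        fun p hp x hx => hasFDerivWithinAt_id _ _⟩
  exact clm hw L h1

/-- By the chain rule the derivative is bilinear in g' along f and in f', both of one order less.
The hypothesis `hww` converts powers of the outer weight into powers of the inner one. -/
theorem comp {g : P' → E' → F} {f : P → E → E'} {φ : P → P'} (hg : WeightSmooth T' S' w' k g)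
    (hf : WeightSmooth T S w k f) (hw : ∀ p ∈ T, ∀ x ∈ S, 2 ≤ w p x)
    (hw' : ∀ p ∈ T', ∀ x ∈ S', 2 ≤ w' p x)
    (hφ : ContinuousOn φ T) (hφT : MapsTo φ T T') (hfS : ∀ p ∈ T, MapsTo (f p) S S')
    (hww : ∃ N : ℕ, ∀ p ∈ T, ∀ x ∈ S, w' (φ p) (f p x) ≤ w p x ^ N) :
    WeightSmooth T S w k (fun p x => g (φ p) (f p x)) := by
  have h0 : ∀ {F : Type} [NormedAddCommGroup F] [NormedSpace ℝ F] {g : P' → E' → F},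
      WeightBounded T' S' w' g → WeightBounded T S w (fun p x => g (φ p) (f p x)) := by
    intro F _ _ g ⟨hc, N, hN⟩
    obtain ⟨M, hM⟩ := hww
    refine ⟨hc.comp (t := T' ×ˢ S') (f := fun q : P × E => (φ q.1, f q.1 q.2))
      ((hφ.comp continuousOn_fst fun q hq => hq.1).prodMk hf.weightBounded.continuousOn)
      fun q hq => ⟨hφT hq.1, hfS q.1 hq.1 hq.2⟩, M * N, fun p hp x hx => ?_⟩
    rw [pow_mul]
    refine (hN _ (hφT hp) _ (hfS p hp hx)).trans (pow_le_pow_left₀ ?_ (hM p hp x hx) N)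
    linarith [hw' _ (hφT hp) _ (hfS p hp hx)]
  induction k generalizing F with
  | zero => exact h0 hg
  | succ k ih =>
    have hf' := hf.of_succ
    obtain ⟨hg, g', hg', hdg⟩ := hg
    obtain ⟨hf0, f', hf1, hdf⟩ := hf
    refine ⟨h0 hg, fun p x => (g' (φ p) (f p x)).comp (f' p x),
      bilin hw (ContinuousLinearMap.compL ℝ E E' F) (ih hg' hf' ) hf1, fun p hp x hx => ?_⟩
    exact (hdg _ (hφT hp) _ (hfS p hp hx)).comp x (hdf p hp x hx) (hfS p hp)

/-- The derivative is exp(a) a', so only exp(a) itself needs a bound; it is a hypothesis because a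
power bound on a does not give one on exp(a). -/
theorem exp (hw : ∀ p ∈ T, ∀ x ∈ S, 2 ≤ w p x) {a : P → E → ℝ} (ha : WeightSmooth T S w k a)
    (hb : ∃ N : ℕ, ∀ p ∈ T, ∀ x ∈ S, Real.exp (a p x) ≤ w p x ^ N) :
    WeightSmooth T S w k (fun p x => Real.exp (a p x)) := by
  have h0 : WeightBounded T S w (fun p x => Real.exp (a p x)) := by
    refine ⟨Real.continuous_exp.comp_continuousOn ha.weightBounded.continuousOn, ?_⟩
    simpa using hb
  induction k with
  | zero => exact h0
  | succ k ih =>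
    have hk := ih ha.of_succ
    obtain ⟨-, a', ha', hd⟩ := ha
    exact ⟨h0, fun p x => Real.exp (a p x) • a' p x,
      bilin hw (ContinuousLinearMap.lsmul ℝ ℝ) hk ha', fun p hp x hx => (hd p hp x hx).exp⟩

theorem inv (hw : ∀ p ∈ T, ∀ x ∈ S, 2 ≤ w p x) {a : P → E → ℝ} (ha : WeightSmooth T S w k a)
    (h0 : ∀ p ∈ T, ∀ x ∈ S, a p x ≠ 0)
    (hb : ∃ N : ℕ, ∀ p ∈ T, ∀ x ∈ S, |(a p x)⁻¹| ≤ w p x ^ N) :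
    WeightSmooth T S w k (fun p x => (a p x)⁻¹) := by
  have hB : WeightBounded T S w (fun p x => (a p x)⁻¹) :=
    ⟨ha.weightBounded.continuousOn.inv₀ fun q hq => h0 q.1 hq.1 q.2 hq.2, hb⟩
  induction k with
  | zero => exact hB
  | succ k ih =>
    have hk := ih ha.of_succ
    obtain ⟨-, a', ha', hd⟩ := ha
    refine ⟨hB, fun p x => (-((a p x)⁻¹ * (a p x)⁻¹)) • a' p x,
      bilin hw (ContinuousLinearMap.lsmul ℝ ℝ) (neg hw (mul hw hk hk)) ha', fun p hp x hx => ?_⟩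
    have := (hasDerivAt_inv (h0 p hp x hx)).comp_hasFDerivWithinAt x (hd p hp x hx)
    rw [pow_two, mul_inv] at this
    exact this

end WeightSmooth

/-- Compactness of the interval makes b(z, ·) close to b(z, x₀) uniformly in z. The mean value
inequality on the convex set ball ∩ S then bounds the remainder uniformly in z. No interior point is
needed, so boundary points of S are covered. -/
theorem hasFDerivWithinAt_intervalIntegral [CompleteSpace F] {α β : ℝ} (hαβ : α ≤ β)
    (hS : Convex ℝ S) {a : ℝ → E → F} {b : ℝ → E → E →L[ℝ] F}
    (ha : ContinuousOn (Function.uncurry a) (Icc α β ×ˢ S))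
    (hb : ContinuousOn (Function.uncurry b) (Icc α β ×ˢ S))
    (hd : ∀ z ∈ Icc α β, ∀ x ∈ S, HasFDerivWithinAt (a z) (b z x) S x) {x₀ : E} (hx₀ : x₀ ∈ S) :
    HasFDerivWithinAt (fun x => ∫ z in α..β, a z x) (∫ z in α..β, b z x₀) S x₀ := by
  have slice : ∀ {F : Type} [NormedAddCommGroup F] {c : ℝ → E → F},
      ContinuousOn (Function.uncurry c) (Icc α β ×ˢ S) → ∀ x ∈ S,
      ContinuousOn (fun z => c z x) (Icc α β) := by
    intro F _ c hc x hx
    exact hc.comp (f := fun z => (z, x)) (by fun_prop) fun z hz => ⟨hz, hx⟩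
  have ii : ∀ {F : Type} [NormedAddCommGroup F] {c : ℝ → E → F},
      ContinuousOn (Function.uncurry c) (Icc α β ×ˢ S) → ∀ x ∈ S,
      IntervalIntegrable (fun z => c z x) volume α β := by
    intro F _ c hc x hx
    exact ContinuousOn.intervalIntegrable (by rw [uIcc_of_le hαβ]; exact slice hc x hx)
  rw [hasFDerivWithinAt_iff_isLittleO, Asymptotics.isLittleO_iff]
  intro c hc
  -- The summand 1 keeps the denominator positive when α = β.
  set c' := c / (β - α + 1) with hc'
  have hpos : 0 < β - α + 1 := by linarith
  have hc'0 : 0 < c' := div_pos hc hpos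
  have hb' : ContinuousOn (Function.uncurry fun x z => b z x) (S ×ˢ Icc α β) :=
    hb.comp (f := Prod.swap) continuous_swap.continuousOn fun q hq => ⟨hq.2, hq.1⟩
  have hev := eventually_forall_compact_dist_lt isCompact_Icc hb' hx₀ hc'0
  obtain ⟨r, hr, hball⟩ := Metric.mem_nhdsWithin_iff.1 hev
  have hmem : Metric.ball x₀ r ∩ S ∈ 𝓝[S] x₀ :=
    inter_mem (mem_nhdsWithin_of_mem_nhds (Metric.ball_mem_nhds _ hr)) self_mem_nhdsWithin
  filter_upwards [hmem] with x hx
  have hconv : Convex ℝ (Metric.ball x₀ r ∩ S) := (convex_ball _ _).inter hS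
  have pt : ∀ z ∈ Icc α β, ‖a z x - a z x₀ - b z x₀ (x - x₀)‖ ≤ c' * ‖x - x₀‖ := by
    intro z hz
    refine hconv.norm_image_sub_le_of_norm_hasFDerivWithin_le' (f := a z) (f' := b z)
      (fun y hy => (hd z hz y hy.2).mono inter_subset_right) (fun y hy => ?_)
      ⟨Metric.mem_ball_self hr, hx₀⟩ hx
    exact (hball hy z hz).le
  have e : (∫ z in α..β, a z x) - (∫ z in α..β, a z x₀) - (∫ z in α..β, b z x₀) (x - x₀)
      = ∫ z in α..β, (a z x - a z x₀ - b z x₀ (x - x₀)) := by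
    rw [intervalIntegral.integral_sub ((ii ha x hx.2).sub (ii ha x₀ hx₀)),
      intervalIntegral.integral_sub (ii ha x hx.2) (ii ha x₀ hx₀),
      ContinuousLinearMap.intervalIntegral_apply (ii hb x₀ hx₀)]
    exact ContinuousOn.intervalIntegrable (by
      rw [uIcc_of_le hαβ]; exact (slice hb x₀ hx₀).clm_apply continuousOn_const)
  rw [e]
  refine (intervalIntegral.norm_integral_le_of_norm_le_const (C := c' * ‖x - x₀‖) fun z hz => ?_).trans ?_
  · rw [uIoc_of_le hαβ] at hz
    exact pt z ⟨hz.1.le, hz.2⟩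
  · rw [abs_of_nonneg (by linarith)]
    have : c' * (β - α) ≤ c := by
      rw [hc', div_mul_eq_mul_div, div_le_iff₀ hpos]; nlinarith
    nlinarith [norm_nonneg (x - x₀)]

theorem WeightSmooth.intervalIntegral [CompleteSpace F] {α β : ℝ} (hαβ : α ≤ β)
    (hS : Convex ℝ S) (hw : ∀ p ∈ T, ∀ x ∈ S, 2 ≤ w p x) {a : P × ℝ → E → F}
    (ha : WeightSmooth (T ×ˢ Icc α β) S (fun p x => w p.1 x) k a) :
    WeightSmooth T S w k (fun p x => ∫ z in α..β, a (p, z) x) := by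
  have h0 : ∀ {F : Type} [NormedAddCommGroup F] [NormedSpace ℝ F] [CompleteSpace F]
      {a : P × ℝ → E → F}, WeightBounded (T ×ˢ Icc α β) S (fun p x => w p.1 x) a →
      WeightBounded T S w (fun p x => ∫ z in α..β, a (p, z) x) := by
    intro F _ _ _ a ⟨hc, N, hN⟩
    constructor
    · have hc' : ContinuousOn (Function.uncurry fun (q : P × E) (z : ℝ) => a (q.1, z) q.2)
          ((T ×ˢ S) ×ˢ Icc α β) :=
        hc.comp (f := fun r : (P × E) × ℝ => ((r.1.1, r.2), r.1.2)) (by fun_prop)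
          fun r hr => ⟨⟨hr.1.1, hr.2⟩, hr.1.2⟩
      have ii : ∀ q ∈ T ×ˢ S, IntervalIntegrable (fun z => a (q.1, z) q.2) volume α β := by
        intro q hq
        refine ContinuousOn.intervalIntegrable ?_
        rw [uIcc_of_le hαβ]
        exact hc'.comp (f := fun z => (q, z)) (by fun_prop) fun z hz => ⟨hq, hz⟩
      intro q hq
      rw [ContinuousWithinAt, Metric.tendsto_nhds]
      intro ε hε
      have hpos : 0 < β - α + 1 := by linarith
      filter_upwards [eventually_forall_compact_dist_lt isCompact_Icc hc' hq
        (div_pos hε hpos), self_mem_nhdsWithin] with q' h1 hq'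
      rw [dist_eq_norm]
      simp only [Function.uncurry]
      rw [← intervalIntegral.integral_sub (ii q' hq') (ii q hq)]
      refine (intervalIntegral.norm_integral_le_of_norm_le_const
        (C := ε / (β - α + 1)) fun z hz => ?_).trans_lt ?_
      · rw [uIoc_of_le hαβ] at hz
        exact (h1 z ⟨hz.1.le, hz.2⟩).le
      · rw [abs_of_nonneg (by linarith), div_mul_eq_mul_div, div_lt_iff₀ hpos]
        nlinarith
    · obtain ⟨M, hM⟩ := exists_le_weight_pow hw |β - α|
      refine ⟨N + M, fun p hp x hx => ?_⟩
      rw [pow_add]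
      refine (intervalIntegral.norm_integral_le_of_norm_le_const
        (C := w p x ^ N) fun z hz => ?_).trans ?_
      · rw [uIoc_of_le hαβ] at hz
        exact hN (p, z) ⟨hp, hz.1.le, hz.2⟩ x hx
      · exact mul_le_mul_of_nonneg_left (hM p hp x hx) (pow_nonneg (by linarith [hw p hp x hx]) _)
  induction k generalizing F with
  | zero => exact h0 ha
  | succ k ih =>
    obtain ⟨ha, b, hb, hd⟩ := ha
    refine ⟨h0 ha, _, ih hb, fun p hp x hx => ?_⟩
    have slice : ∀ {F : Type} [NormedAddCommGroup F] {c : P × ℝ → E → F},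
        ContinuousOn (Function.uncurry c) ((T ×ˢ Icc α β) ×ˢ S) →
        ContinuousOn (Function.uncurry fun z x => c (p, z) x) (Icc α β ×ˢ S) := by
      intro F _ c hc
      exact hc.comp (f := fun r : ℝ × E => ((p, r.1), r.2)) (by fun_prop)
        fun r hr => ⟨⟨hp, hr.1⟩, hr.2⟩
    exact hasFDerivWithinAt_intervalIntegral hαβ hS (slice ha.continuousOn)
      (slice hb.weightBounded.continuousOn) (fun z hz x hx => hd (p, z) ⟨hp, hz⟩ x hx) hx

theorem WeightSmooth.contDiffOn (hS : UniqueDiffOn ℝ S) {a : P → E → F}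
    (ha : WeightSmooth T S w k a) {p : P} (hp : p ∈ T) : ContDiffOn ℝ k (a p) S := by
  induction k generalizing F with
  | zero =>
    rw [Nat.cast_zero, contDiffOn_zero]
    exact ha.continuousOn.comp (f := fun x => (p, x)) (by fun_prop) fun x hx => ⟨hp, hx⟩
  | succ k ih =>
    obtain ⟨-, b, hb, hd⟩ := ha
    rw [Nat.cast_succ, contDiffOn_succ_iff_fderivWithin hS]
    refine ⟨fun x hx => (hd p hp x hx).differentiableWithinAt, by simp, (ih hb).congr fun x hx => ?_⟩
    exact (hd p hp x hx).fderivWithin (hS x hx)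

/-- Peeling off the first derivative and currying is an isometry, so bounds and continuity pass from
b to the iterated derivatives of a. -/
theorem WeightSmooth.weightBounded_iteratedFDerivWithin (hS : UniqueDiffOn ℝ S) {a : P → E → F}
    (ha : WeightSmooth T S w k a) {j : ℕ} (hj : j ≤ k) :
    WeightBounded T S w (fun p x => iteratedFDerivWithin ℝ j (a p) S x) := by
  induction j generalizing k F with
  | zero =>
    obtain ⟨hc, N, hN⟩ := ha.weightBounded
    refine ⟨?_, N, fun p hp x hx => by rw [norm_iteratedFDerivWithin_zero]; exact hN p hp x hx⟩
    simp only [iteratedFDerivWithin_zero_eq_comp]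
    exact (continuousMultilinearCurryFin0 ℝ E F).symm.continuous.comp_continuousOn hc
  | succ j ih =>
    obtain ⟨k, rfl⟩ : ∃ k', k = k' + 1 := ⟨k - 1, by omega⟩
    obtain ⟨-, b, hb, hd⟩ := ha
    have e : ∀ p ∈ T, ∀ x ∈ S, iteratedFDerivWithin ℝ (j + 1) (a p) S x =
        (continuousMultilinearCurryRightEquiv' ℝ j E F).symm
          (iteratedFDerivWithin ℝ j (b p) S x) := by
      intro p hp x hx
      rw [iteratedFDerivWithin_succ_eq_comp_right hS hx, Function.comp_apply,
        iteratedFDerivWithin_congr (fun y hy => (hd p hp y hy).fderivWithin (hS y hy)) hx]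
    obtain ⟨hc, N, hN⟩ := ih hb (by omega)
    refine ⟨(((continuousMultilinearCurryRightEquiv' ℝ j E F).symm.continuous.comp_continuousOn
      hc).congr fun q hq => e q.1 hq.1 q.2 hq.2), N, fun p hp x hx => ?_⟩
    rw [e p hp x hx, LinearIsometryEquiv.norm_map]
    exact hN p hp x hx

end Calculus

end

/-! ### The strain density and its bounds. -/

noncomputable section

/-- The restriction to the quadrant of `f` is supported in `(δ, R] × [0, R]`. -/
structure Profile (f : ℝ × ℝ → ℝ) (δ R B : ℝ) : Prop where
  continuous : Continuous f
  delta_pos : 0 < δ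
  delta_le_one : δ ≤ 1
  one_le_radius : 1 ≤ R
  bound : ∀ x, |f x| ≤ B
  supp : ∀ x ∈ quadrant, f x ≠ 0 → δ < x.1 ∧ x.1 ≤ R ∧ x.2 ≤ R

/-- The integrand of the strain density at the point of the hyperbola `x₁ x₂ = h` with `x₁ = z`. -/
def kernel (f : ℝ × ℝ → ℝ) (z h g : ℝ) : ℝ :=
  f (z, h / z) * (z * (z ^ 4 * Real.exp (-(2 * g)) + h ^ 2 * Real.exp (2 * g))⁻¹)

/-- The contribution to `Ω` of the hyperbola `x₁ x₂ = h` after it has been strained by `e ^ g`. -/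
def strainDensity (f : ℝ × ℝ → ℝ) (δ R h g : ℝ) : ℝ := ∫ z in δ..R, kernel f z h g

/-- The properties of the strain density on which the equation for the strain depends. -/
structure IsDensity (F : ℝ → ℝ → ℝ) (C H : ℝ) : Prop where
  continuous : Continuous (Function.uncurry F)
  C_pos : 0 < C
  H_pos : 0 < H
  bound : ∀ h g, |F h g| ≤ C * (Real.exp (-(2 * g)) + h ^ 2 * Real.exp (2 * g))⁻¹
  lipschitz : ∀ M h g g', |g| ≤ M → |g'| ≤ M →
    |F h g - F h g'| ≤ 2 * C * Real.exp (2 * M) * |g - g'|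
  vanish : ∀ h g, H ≤ h → F h g = 0

namespace Profile

variable {f : ℝ × ℝ → ℝ} {δ R B : ℝ}

theorem bound_nonneg (hf : Profile f δ R B) : 0 ≤ B := (abs_nonneg _).trans (hf.bound 0)

theorem delta_le_radius (hf : Profile f δ R B) : δ ≤ R := hf.delta_le_one.trans hf.one_le_radius

/-- The normalisation δ ≤ 1 lets δ⁴ be taken out of both terms, which leaves a quantity independent
of z and of the profile. -/
theorem denom_lower (hf : Profile f δ R B) {z : ℝ} (hz : δ ≤ z) (h g : ℝ) :
    δ ^ 4 * (Real.exp (-(2 * g)) + h ^ 2 * Real.exp (2 * g)) ≤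
      z ^ 4 * Real.exp (-(2 * g)) + h ^ 2 * Real.exp (2 * g) := by
  have h1 : δ ^ 4 ≤ z ^ 4 := pow_le_pow_left₀ hf.delta_pos.le hz 4
  have h2 : δ ^ 4 ≤ 1 := pow_le_one₀ hf.delta_pos.le hf.delta_le_one
  have e1 := mul_le_mul_of_nonneg_right h1 (Real.exp_pos (-(2 * g))).le
  have e2 := mul_le_mul_of_nonneg_right h2 (mul_nonneg (sq_nonneg h) (Real.exp_pos (2 * g)).le)
  linarith

theorem denom_pos {z : ℝ} (hz : 0 < z) (h g : ℝ) :
    0 < z ^ 4 * Real.exp (-(2 * g)) + h ^ 2 * Real.exp (2 * g) := by positivity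

/-- Replacing z by max z δ removes the singularity at z = 0 and changes nothing on the interval of
integration. -/
theorem continuous_kernel (hf : Profile f δ R B) :
    Continuous (fun q : (ℝ × ℝ) × ℝ => kernel f (max q.2 δ) q.1.1 q.1.2) := by
  have hpos : ∀ q : (ℝ × ℝ) × ℝ, 0 < max q.2 δ := fun q => lt_max_of_lt_right hf.delta_pos
  unfold kernel
  refine (hf.continuous.comp ?_).mul (Continuous.mul (by fun_prop) (Continuous.inv₀ (by fun_prop)
    fun q => (denom_pos (hpos q) _ _).ne'))
  exact (by fun_prop : Continuous fun q : (ℝ × ℝ) × ℝ => max q.2 δ).prodMk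
    (Continuous.div (by fun_prop) (by fun_prop) fun q => (hpos q).ne')

theorem strainDensity_eq (hf : Profile f δ R B) (h g : ℝ) :
    strainDensity f δ R h g = ∫ z in δ..R, kernel f (max z δ) h g := by
  refine intervalIntegral.integral_congr fun z hz => ?_
  rw [uIcc_of_le hf.delta_le_radius] at hz
  simp only [max_eq_left hz.1]

theorem continuous_strainDensity (hf : Profile f δ R B) :
    Continuous (Function.uncurry (strainDensity f δ R)) := by
  have : Function.uncurry (strainDensity f δ R) =
      fun q : ℝ × ℝ => ∫ z in δ..R, kernel f (max z δ) q.1 q.2 := by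
    ext q
    exact hf.strainDensity_eq q.1 q.2
  rw [this]
  exact intervalIntegral.continuous_parametric_intervalIntegral_of_continuous' hf.continuous_kernel _ _

theorem intervalIntegrable_kernel (hf : Profile f δ R B) (h g : ℝ) :
    IntervalIntegrable (fun z => kernel f (max z δ) h g) volume δ R :=
  (hf.continuous_kernel.comp (by fun_prop : Continuous fun z : ℝ => ((h, g), z))).intervalIntegrable _ _

theorem abs_weighted_integral_le (hf : Profile f δ R B) {u : ℝ → ℝ} {K : ℝ} (hK : 0 ≤ K)
    (hu : ∀ z ∈ Icc δ R, |u z| ≤ B * (z * (K / δ ^ 4))) :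
    |∫ z in δ..R, u z| ≤ (B * R ^ 2 / δ ^ 4 + 1) * K := by
  have hδ := hf.delta_pos
  have hB := hf.bound_nonneg
  have hR := hf.one_le_radius
  have := intervalIntegral.norm_integral_le_of_norm_le_const (f := u) (a := δ) (b := R)
    (C := B * (R * (K / δ ^ 4))) (fun z hz => by
      rw [uIoc_of_le hf.delta_le_radius] at hz
      refine (hu z ⟨hz.1.le, hz.2⟩).trans ?_
      gcongr
      exact hz.2)
  rw [Real.norm_eq_abs, abs_of_nonneg (by linarith [hf.delta_le_radius] : 0 ≤ R - δ)] at this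
  refine this.trans ?_
  calc B * (R * (K / δ ^ 4)) * (R - δ) ≤ B * (R * (K / δ ^ 4)) * R := by
        gcongr; linarith
    _ = (B * R ^ 2 / δ ^ 4) * K := by ring
    _ ≤ _ := by nlinarith

/-- One constant serves the size and Lipschitz bounds; its summand 1 keeps it positive when B = 0.
-/
theorem isDensity (hf : Profile f δ R B) :
    IsDensity (strainDensity f δ R) (B * R ^ 2 / δ ^ 4 + 1) (R ^ 2 + 1) where
  continuous := hf.continuous_strainDensity
  C_pos := by have := hf.bound_nonneg; have := hf.delta_pos; positivity
  H_pos := by positivity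
  bound h g := by
    have hδ := hf.delta_pos
    have hd : 0 < Real.exp (-(2 * g)) + h ^ 2 * Real.exp (2 * g) := by positivity
    refine hf.abs_weighted_integral_le (inv_nonneg.2 hd.le) fun z hz => ?_
    have hz0 : 0 < z := hδ.trans_le hz.1
    have := hf.denom_lower hz.1 h g
    rw [kernel, abs_mul, abs_mul, abs_of_pos hz0, abs_of_pos (inv_pos.2 (denom_pos hz0 h g))]
    refine mul_le_mul (hf.bound _) (mul_le_mul_of_nonneg_left ?_ hz0.le)
      (mul_nonneg hz0.le (inv_nonneg.2 (denom_pos hz0 h g).le)) hf.bound_nonneg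
    rw [inv_le_comm₀ (denom_pos hz0 h g) (by positivity)]
    refine le_trans (le_of_eq ?_) this
    field_simp
  lipschitz M h g g' hg hg' := by
    have hδ := hf.delta_pos
    rw [hf.strainDensity_eq, hf.strainDensity_eq,
      ← intervalIntegral.integral_sub (hf.intervalIntegrable_kernel _ _)
        (hf.intervalIntegrable_kernel _ _)]
    refine (hf.abs_weighted_integral_le (K := 2 * Real.exp (2 * M) * |g - g'|) (by positivity)
      fun z hz => ?_).trans (le_of_eq (by ring))
    have hz0 : 0 < z := hδ.trans_le hz.1
    rw [max_eq_left hz.1]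
    set D : ℝ → ℝ := fun s => z ^ 4 * Real.exp (-(2 * s)) + h ^ 2 * Real.exp (2 * s) with hD
    have hDpos : ∀ s, 0 < D s := fun s => denom_pos hz0 h s
    have hder : ∀ s, HasDerivAt (fun s => (D s)⁻¹)
        (-(z ^ 4 * (Real.exp (-(2 * s)) * (-2)) + h ^ 2 * (Real.exp (2 * s) * 2)) / D s ^ 2) s := by
      intro s
      have h2 : HasDerivAt (fun s : ℝ => 2 * s) 2 s := by
        simpa using (hasDerivAt_id s).const_mul 2
      have h1 : HasDerivAt (fun s : ℝ => -(2 * s)) (-2) s := h2.neg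
      exact ((h1.exp.const_mul (z ^ 4)).add (h2.exp.const_mul (h ^ 2))).inv (hDpos s).ne'
    -- Mean value inequality in g: |D'| ≤ 2D bounds the derivative of 1/D by 2/D, and D ≥ δ⁴ e^(-2M)
    -- when |g| ≤ M.
    have key : |(D g)⁻¹ - (D g')⁻¹| ≤ (2 * Real.exp (2 * M) / δ ^ 4) * |g - g'| := by
      refine (convex_Icc (-M) M).norm_image_sub_le_of_norm_hasDerivWithin_le
        (f := fun s => (D s)⁻¹) (fun s _ => (hder s).hasDerivWithinAt) (fun s hs => ?_)
        (abs_le.1 hg') (abs_le.1 hg)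
      have hlow : δ ^ 4 * Real.exp (-(2 * M)) ≤ D s := by
        refine le_trans ?_ (hf.denom_lower hz.1 h s)
        have e1 : Real.exp (-(2 * M)) ≤ Real.exp (-(2 * s)) :=
          Real.exp_le_exp.2 (by linarith [hs.2])
        have e2 : 0 ≤ h ^ 2 * Real.exp (2 * s) := by positivity
        gcongr
        linarith
      have hnum : |-(z ^ 4 * (Real.exp (-(2 * s)) * (-2)) + h ^ 2 * (Real.exp (2 * s) * 2))|
          ≤ 2 * D s := by
        have e1 : 0 ≤ z ^ 4 * Real.exp (-(2 * s)) := by positivity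
        have e2 : 0 ≤ h ^ 2 * Real.exp (2 * s) := by positivity
        simp only [hD]
        rw [abs_le]
        constructor <;> nlinarith
      rw [Real.norm_eq_abs, abs_div, abs_of_pos (pow_pos (hDpos s) 2), div_le_iff₀ (pow_pos (hDpos s) 2)]
      refine hnum.trans ?_
      have e3 : 1 ≤ Real.exp (2 * M) / δ ^ 4 * D s := by
        calc (1 : ℝ) = Real.exp (2 * M) / δ ^ 4 * (δ ^ 4 * Real.exp (-(2 * M))) := by
              rw [Real.exp_neg]; field_simp
          _ ≤ _ := by gcongr
      calc 2 * D s = 2 * D s * 1 := by ring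
        _ ≤ 2 * D s * (Real.exp (2 * M) / δ ^ 4 * D s) :=
          mul_le_mul_of_nonneg_left e3 (by linarith [hDpos s])
        _ = 2 * Real.exp (2 * M) / δ ^ 4 * D s ^ 2 := by ring
    have e : kernel f z h g - kernel f z h g' = f (z, h / z) * (z * ((D g)⁻¹ - (D g')⁻¹)) := by
      simp only [kernel, hD]; ring
    rw [e, abs_mul, abs_mul, abs_of_pos hz0]
    refine mul_le_mul (hf.bound _) (mul_le_mul_of_nonneg_left (key.trans (le_of_eq (by ring))) hz0.le)
      (by positivity) hf.bound_nonneg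
  vanish h g hh := by
    have hδ := hf.delta_pos
    have hR := hf.one_le_radius
    rw [strainDensity, intervalIntegral.integral_congr (g := fun _ => (0 : ℝ)),
      intervalIntegral.integral_zero]
    intro z hz
    rw [uIcc_of_le hf.delta_le_radius] at hz
    have hz0 : 0 < z := hδ.trans_le hz.1
    have hh0 : 0 < h := by nlinarith
    -- The support condition x₂ ≤ R is not strict, so h has to exceed R², whence the height R² + 1.
    have : f (z, h / z) = 0 := by
      by_contra hne
      have h1 := (hf.supp (z, h / z) ⟨hz0.le, by positivity⟩ hne).2.2
      rw [div_le_iff₀ hz0] at h1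
      nlinarith [hz.2]
    simp [kernel, this]

theorem strainDensity_nonneg (hf : Profile f δ R B) (hpos : ∀ x ∈ quadrant, 0 ≤ f x) {h : ℝ}
    (hh : 0 ≤ h) (g : ℝ) : 0 ≤ strainDensity f δ R h g := by
  refine intervalIntegral.integral_nonneg hf.delta_le_radius fun z hz => ?_
  have hz0 : 0 < z := hf.delta_pos.trans_le hz.1
  exact mul_nonneg (hpos _ ⟨hz0.le, by positivity⟩)
    (mul_nonneg hz0.le (inv_nonneg.2 (denom_pos hz0 h g).le))

end Profile

namespace IsDensity

variable {F : ℝ → ℝ → ℝ} {C H : ℝ}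

theorem abs_le_exp (hF : IsDensity F C H) (h g : ℝ) : |F h g| ≤ C * Real.exp (2 * g) := by
  refine (hF.bound h g).trans (mul_le_mul_of_nonneg_left ?_ hF.C_pos.le)
  rw [inv_le_comm₀ (by positivity) (by positivity), ← Real.exp_neg]
  exact le_add_of_nonneg_right (by positivity)

/-- The two terms of the denominator have product h², so their sum dominates h for every g. -/
theorem abs_mul_le (hF : IsDensity F C H) {h : ℝ} (hh : 0 ≤ h) (g : ℝ) : |F h g| * h ≤ C := by
  have h1 : Real.exp (-(2 * g)) * Real.exp (2 * g) = 1 := by rw [← Real.exp_add]; simp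
  have hd : 0 < Real.exp (-(2 * g)) + h ^ 2 * Real.exp (2 * g) := by positivity
  have h2 : h ≤ Real.exp (-(2 * g)) + h ^ 2 * Real.exp (2 * g) := by
    have e1 := Real.exp_pos (-(2 * g))
    have e2 := Real.exp_pos (2 * g)
    nlinarith [sq_nonneg (Real.exp (-(2 * g)) - h), sq_nonneg (1 - h * Real.exp (2 * g)),
      mul_nonneg e1.le (sq_nonneg (1 - h * Real.exp (2 * g)))]
  refine (mul_le_mul_of_nonneg_right (hF.bound h g) hh).trans ?_
  rw [mul_assoc]
  refine mul_le_of_le_one_right hF.C_pos.le ?_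
  rw [inv_mul_le_iff₀ hd]
  linarith

/-- The bounds `φ ≤ C e^{2a}` and `φ ≤ C / h` together give an integral that is linear in `a`. -/
theorem integral_abs_le (hC : 0 < C) (hH : 0 < H) {φ : ℝ → ℝ} (hφ : Continuous φ) {a : ℝ}
    (ha : 0 ≤ a) (h1 : ∀ h ∈ Icc 0 H, |φ h| ≤ C * Real.exp (2 * a))
    (h2 : ∀ h ∈ Icc 0 H, |φ h| * h ≤ C) {η : ℝ} (hη : η ∈ Icc 0 H) :
    |∫ h in η..H, φ h| ≤ C * H + 2 * C * a := by
  have hc : Continuous fun h => |φ h| := hφ.abs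
  -- The crossover height: below it C e^(2a) integrates to C H, and above it C/h integrates to C
  -- log(H/ε) = 2Ca.
  set ε := H * Real.exp (-(2 * a)) with hε
  have hε0 : 0 < ε := by positivity
  have hεH : ε ≤ H := mul_le_of_le_one_right hH.le (Real.exp_le_one_iff.2 (by linarith))
  have s1 : |∫ h in η..H, φ h| ≤ ∫ h in η..H, |φ h| :=
    intervalIntegral.abs_integral_le_integral_abs hη.2
  have s2 : ∫ h in η..H, |φ h| ≤ ∫ h in (0 : ℝ)..H, |φ h| := by
    rw [← intervalIntegral.integral_add_adjacent_intervals (hc.intervalIntegrable 0 η)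
      (hc.intervalIntegrable η H)]
    exact le_add_of_nonneg_left (intervalIntegral.integral_nonneg hη.1 fun _ _ => abs_nonneg _)
  have s3 : ∫ h in (0 : ℝ)..ε, |φ h| ≤ C * H := by
    calc ∫ h in (0 : ℝ)..ε, |φ h| ≤ ∫ h in (0 : ℝ)..ε, C * Real.exp (2 * a) :=
          intervalIntegral.integral_mono_on hε0.le (hc.intervalIntegrable _ _)
            (by simp) fun h hh => h1 h ⟨hh.1, hh.2.trans hεH⟩
      _ = C * H := by
          rw [intervalIntegral.integral_const, hε, smul_eq_mul, Real.exp_neg]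
          field_simp
          ring
  have s4 : ∫ h in ε..H, |φ h| ≤ 2 * C * a := by
    have hi : IntervalIntegrable (fun h : ℝ => C * h⁻¹) volume ε H := by
      refine ContinuousOn.intervalIntegrable (continuousOn_const.mul
        (continuousOn_inv₀.mono fun x hx => ?_))
      rw [uIcc_of_le hεH] at hx
      exact (hε0.trans_le hx.1).ne'
    calc ∫ h in ε..H, |φ h| ≤ ∫ h in ε..H, C * h⁻¹ := by
          refine intervalIntegral.integral_mono_on hεH (hc.intervalIntegrable _ _) hi fun h hh => ?_
          have hh0 : 0 < h := hε0.trans_le hh.1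
          rw [← div_eq_mul_inv, le_div_iff₀ hh0]
          exact h2 h ⟨hh0.le, hh.2⟩
      _ = 2 * C * a := by
          rw [intervalIntegral.integral_const_mul, integral_inv_of_pos hε0 hH, hε]
          rw [Real.exp_neg, div_mul_eq_div_div, div_self hH.ne', one_div, inv_inv, Real.log_exp]
          ring
  rw [← intervalIntegral.integral_add_adjacent_intervals (hc.intervalIntegrable 0 ε)
      (hc.intervalIntegrable ε H)] at s2
  linarith

/-- Although F grows exponentially in the strain, its integral over the hyperbolas grows only
linearly. This is what prevents blow-up for data of either sign. -/
theorem abs_integral_le (hF : IsDensity F C H) {γ : ℝ → ℝ} (hγ : Continuous γ) {a : ℝ}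
    (ha : ∀ h ∈ Icc 0 H, |γ h| ≤ a) {η : ℝ} (hη : η ∈ Icc 0 H) :
    |∫ h in η..H, F h (γ h)| ≤ C * H + 2 * C * a := by
  have ha0 : 0 ≤ a := (abs_nonneg _).trans (ha η hη)
  refine integral_abs_le hF.C_pos hF.H_pos (hF.continuous.comp (continuous_id.prodMk hγ)) ha0
    (fun h hh => (hF.abs_le_exp h _).trans ?_) (fun h hh => hF.abs_mul_le hh.1 _) hη
  have := (le_abs_self _).trans (ha h hh)
  have := hF.C_pos
  gcongr

end IsDensity

end

/-! ### The strain equation: uniqueness and global existence. -/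

noncomputable section

/-- `G t η` is the time integral of the strain rate `Ω(η, ·)` up to time `t`; it satisfies a closed
integral equation in terms of the strain density `F`. -/
structure IsStrainOn (F : ℝ → ℝ → ℝ) (H T : ℝ) (G : ℝ → ℝ → ℝ) : Prop where
  continuous : Continuous (Function.uncurry G)
  equation : ∀ t ∈ Icc 0 T, ∀ η ∈ Icc 0 H, G t η = ∫ s in (0 : ℝ)..t, ∫ h in η..H, F h (G s h)

namespace IsDensity

variable {F : ℝ → ℝ → ℝ} {C H : ℝ}

theorem continuous_rate (hF : IsDensity F C H) {G : ℝ → ℝ → ℝ}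
    (hG : Continuous (Function.uncurry G)) :
    Continuous (fun q : ℝ × ℝ => ∫ h in q.2..H, F h (G q.1 h)) := by
  have h1 : Continuous (Function.uncurry fun (t h : ℝ) => F h (G t h)) :=
    hF.continuous.comp (continuous_snd.prodMk hG)
  have h2 := intervalIntegral.continuous_parametric_primitive_of_continuous (a₀ := H)
    (μ := volume) h1
  simp_rw [intervalIntegral.integral_symm H]
  exact h2.neg

theorem continuous_rate_time (hF : IsDensity F C H) {G : ℝ → ℝ → ℝ}
    (hG : Continuous (Function.uncurry G)) (η : ℝ) :
    Continuous (fun t : ℝ => ∫ h in η..H, F h (G t h)) :=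
  (hF.continuous_rate hG).comp (by fun_prop : Continuous fun t : ℝ => (t, η))

theorem continuous_section (hF : IsDensity F C H) {G : ℝ → ℝ → ℝ}
    (hG : Continuous (Function.uncurry G)) (t : ℝ) : Continuous (fun h : ℝ => F h (G t h)) :=
  hF.continuous.comp (continuous_id.prodMk (hG.comp (by fun_prop : Continuous fun h : ℝ => (t, h))))

/-- Both strains are bounded on the compact rectangle, so F is Lipschitz along them with one
constant L. Iterating the integral equation k times gives the factor (LHt)^k / k!, which tends to 0.
-/
theorem isStrainOn_unique (hF : IsDensity F C H) {T : ℝ} {G G' : ℝ → ℝ → ℝ}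
    (hG : IsStrainOn F H T G) (hG' : IsStrainOn F H T G') :
    ∀ t ∈ Icc 0 T, ∀ η ∈ Icc 0 H, G t η = G' t η := by
  have hC := hF.C_pos
  have hH := hF.H_pos
  obtain ⟨M, hM⟩ : ∃ M, ∀ q ∈ Icc (0 : ℝ) T ×ˢ Icc (0 : ℝ) H, |G q.1 q.2| + |G' q.1 q.2| ≤ M := by
    have hK : IsCompact (Icc (0 : ℝ) T ×ˢ Icc (0 : ℝ) H) := isCompact_Icc.prod isCompact_Icc
    have hc : Continuous fun q : ℝ × ℝ => |G q.1 q.2| + |G' q.1 q.2| :=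
      hG.continuous.abs.add hG'.continuous.abs
    obtain ⟨M, hM⟩ := hK.bddAbove_image hc.continuousOn
    exact ⟨M, fun q hq => hM (mem_image_of_mem _ hq)⟩
  set L := 2 * C * Real.exp (2 * M) with hL
  have hL0 : 0 < L := by positivity
  have key : ∀ k : ℕ, ∀ t ∈ Icc 0 T, ∀ η ∈ Icc 0 H,
      |G t η - G' t η| ≤ M * ((L * H * t) ^ k / k.factorial) := by
    intro k
    induction k with
    | zero =>
      intro t ht η hη
      have := hM (t, η) ⟨ht, hη⟩
      simp only [pow_zero, Nat.factorial_zero, Nat.cast_one, div_one, mul_one]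
      exact (abs_sub _ _).trans this
    | succ k ih =>
      intro t ht η hη
      have hM0 : 0 ≤ M := (add_nonneg (abs_nonneg _) (abs_nonneg _)).trans (hM (t, η) ⟨ht, hη⟩)
      rw [hG.equation t ht η hη, hG'.equation t ht η hη, ← intervalIntegral.integral_sub
        ((hF.continuous_rate_time hG.continuous η).intervalIntegrable _ _)
        ((hF.continuous_rate_time hG'.continuous η).intervalIntegrable _ _)]
      have inner : ∀ s ∈ Icc 0 T, |(∫ h in η..H, F h (G s h)) - ∫ h in η..H, F h (G' s h)| ≤
          L * H * (M * ((L * H * s) ^ k / k.factorial)) := by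
        intro s hs
        rw [← intervalIntegral.integral_sub
          ((hF.continuous_section hG.continuous s).intervalIntegrable _ _)
          ((hF.continuous_section hG'.continuous s).intervalIntegrable _ _)]
        have hs0 : 0 ≤ (L * H * s) ^ k := pow_nonneg (mul_nonneg (by positivity) hs.1) k
        rw [← Real.norm_eq_abs]
        refine (intervalIntegral.norm_integral_le_of_norm_le_const
          (C := L * (M * ((L * H * s) ^ k / k.factorial))) fun h hh => ?_).trans ?_
        · rw [uIoc_of_le hη.2] at hh
          have hh' : h ∈ Icc 0 H := ⟨hη.1.trans hh.1.le, hh.2⟩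
          have hb := hM (s, h) ⟨hs, hh'⟩
          refine (hF.lipschitz M h _ _ ?_ ?_).trans (mul_le_mul_of_nonneg_left (ih s hs h hh') hL0.le)
          · exact (le_add_of_nonneg_right (abs_nonneg _)).trans hb
          · exact (le_add_of_nonneg_left (abs_nonneg _)).trans hb
        · rw [abs_of_nonneg (by linarith [hη.2])]
          have : H - η ≤ H := by linarith [hη.1]
          calc L * (M * ((L * H * s) ^ k / k.factorial)) * (H - η)
              ≤ L * (M * ((L * H * s) ^ k / k.factorial)) * H := by gcongr
            _ = _ := by ring
      have hcont : Continuous fun s : ℝ => L * H * (M * ((L * H * s) ^ k / k.factorial)) := by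
        fun_prop
      rw [← Real.norm_eq_abs]
      refine (intervalIntegral.norm_integral_le_of_norm_le ht.1 (Eventually.of_forall fun s hs =>
        inner s ⟨hs.1.le, hs.2.trans ht.2⟩) (hcont.intervalIntegrable _ _)).trans (le_of_eq ?_)
      have e : ∀ s : ℝ, L * H * (M * ((L * H * s) ^ k / k.factorial)) =
          (L * H * M * (L * H) ^ k / k.factorial) * s ^ k := by
        intro s; rw [mul_pow]; ring
      simp_rw [e]
      rw [intervalIntegral.integral_const_mul, integral_pow, Nat.factorial_succ]
      push_cast
      field_simp
      simp only [zero_pow (Nat.succ_ne_zero k), sub_zero]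
      ring
  intro t ht η hη
  have hlim : Tendsto (fun k : ℕ => M * ((L * H * t) ^ k / k.factorial)) atTop (𝓝 (M * 0)) :=
    (FloorSemiring.tendsto_pow_div_factorial_atTop (L * H * t)).const_mul M
  rw [mul_zero] at hlim
  have := ge_of_tendsto' hlim fun k => key k t ht η hη
  exact sub_eq_zero.1 (abs_nonpos_iff.1 this)

/-- Gronwall from zero data gives (H/2)(e^(2Ct) - 1). Only linear growth of N enters, so the bound
does not depend on the height at which the rate is truncated. -/
theorem isStrainOn_bound (hF : IsDensity F C H) {α : ℝ → C(Icc (0 : ℝ) H, ℝ)} {T : ℝ}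
    {N : C(Icc (0 : ℝ) H, ℝ) → C(Icc (0 : ℝ) H, ℝ)} (h0 : α 0 = 0)
    (hα : ∀ t ∈ Icc 0 T, HasDerivWithinAt α (N (α t)) (Icc 0 T) t)
    (hN : ∀ γ, ‖N γ‖ ≤ 2 * C * ‖γ‖ + C * H) :
    ∀ t ∈ Icc 0 T, ‖α t‖ ≤ H * Real.exp (2 * C * t) := by
  intro t ht
  have hC := hF.C_pos
  have h := norm_le_gronwallBound_of_norm_deriv_right_le (f := α) (f' := fun t => N (α t)) (δ := 0)
    (K := 2 * C) (ε := C * H) (a := 0) (b := T)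
    (fun t ht => (hα t ht).continuousWithinAt)
    (fun t ht => (hα t ⟨ht.1, ht.2.le⟩).mono_of_mem_nhdsWithin
      (Icc_mem_nhdsGE_of_mem ht))
    (by simp [h0]) (fun t _ => hN _) t ht
  rw [gronwallBound_of_K_ne_0 (by positivity)] at h
  refine h.trans ?_
  have hH := hF.H_pos
  have e : C * H / (2 * C) = H / 2 := by field_simp
  rw [e]
  have := Real.exp_pos (2 * C * (t - 0))
  rw [sub_zero] at *
  nlinarith

/-- The rate operator for strains truncated at height `M`, on continuous functions on `[0, H]`. -/
def truncatedRate (F : ℝ → ℝ → ℝ) (hF : Continuous (Function.uncurry F)) {H M : ℝ} (hH : 0 ≤ H)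
    (hM : -M ≤ M) (γ : C(Icc (0 : ℝ) H, ℝ)) : C(Icc (0 : ℝ) H, ℝ) where
  toFun η := ∫ h in (η : ℝ)..H, F h (projIcc (-M) M hM (γ (projIcc 0 H hH h)))
  continuous_toFun := by
    have h1 : Continuous fun h : ℝ => F h (projIcc (-M) M hM (γ (projIcc 0 H hH h))) :=
      hF.comp (continuous_id.prodMk (continuous_subtype_val.comp
        ((continuous_projIcc (h := hM)).comp (γ.continuous.comp continuous_projIcc))))
    simp_rw [intervalIntegral.integral_symm H]
    exact ((intervalIntegral.continuous_primitive
      (fun a b => h1.intervalIntegrable a b) H).comp continuous_subtype_val).neg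

/-- Truncating the strain makes the rate bounded and globally Lipschitz on C([0, H]), so
Picard–Lindelöf covers all of [0, T] in one step, and the a priori bound shows that the truncation
is never active. The last two clauses fix the values outside [0, T] × [0, H], which is used when the
solutions for different T are glued. -/
theorem exists_isStrainOn_Icc (hF : IsDensity F C H) {T : ℝ} (hT : 0 ≤ T) :
    ∃ G, IsStrainOn F H T G ∧ (∀ t η, |G t η| ≤ H * Real.exp (2 * C * max t 0)) ∧
      (∀ t ≤ 0, ∀ η, G t η = G 0 η) ∧ ∀ t η, G t η = G t (projIcc 0 H hF.H_pos.le η) := by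
  have hC := hF.C_pos
  have hH := hF.H_pos
  -- The truncation height is the Gronwall bound at the final time.
  set M := H * Real.exp (2 * C * T) with hMdef
  have hM0 : 0 < M := by positivity
  have hM : -M ≤ M := by linarith
  set N := truncatedRate F hF.continuous hH.le hM with hNdef
  have hcont : ∀ γ : C(Icc (0 : ℝ) H, ℝ),
      Continuous fun h : ℝ => F h (projIcc (-M) M hM (γ (projIcc 0 H hH.le h))) := fun γ =>
    hF.continuous.comp (continuous_id.prodMk (continuous_subtype_val.comp
        ((continuous_projIcc (h := hM)).comp (γ.continuous.comp continuous_projIcc))))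
  have hcl : ∀ x : ℝ, |(projIcc (-M) M hM x : ℝ)| ≤ M := fun x => abs_le.2 (projIcc (-M) M hM x).2
  have hcl' : ∀ x : ℝ, |(projIcc (-M) M hM x : ℝ)| ≤ |x| := by
    intro x
    rw [coe_projIcc]
    rcases abs_cases x with ⟨h1, h2⟩ | ⟨h1, h2⟩ <;> rw [h1] <;> rw [abs_le] <;> constructor <;>
      simp only [le_max_iff, max_le_iff, le_min_iff, min_le_iff] <;> grind
  have hNgrow : ∀ γ, ‖N γ‖ ≤ 2 * C * ‖γ‖ + C * H := by
    intro γ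
    rw [ContinuousMap.norm_le _ (by positivity)]
    intro η
    have := hF.abs_integral_le (γ := fun h => (projIcc (-M) M hM (γ (projIcc 0 H hH.le h)) : ℝ))
      (continuous_subtype_val.comp ((continuous_projIcc (h := hM)).comp (γ.continuous.comp continuous_projIcc)))
      (a := ‖γ‖) (fun h _ => (hcl' _).trans (γ.norm_coe_le_norm _)) η.2
    exact this.trans (by linarith)
  have hNbound : ∀ γ, ‖N γ‖ ≤ 2 * C * M + C * H := by
    intro γ
    rw [ContinuousMap.norm_le _ (by positivity)]
    intro η
    have := hF.abs_integral_le (γ := fun h => (projIcc (-M) M hM (γ (projIcc 0 H hH.le h)) : ℝ))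
      (continuous_subtype_val.comp ((continuous_projIcc (h := hM)).comp (γ.continuous.comp continuous_projIcc)))
      (a := M) (fun h _ => hcl _) η.2
    exact this.trans (by linarith)
  have hNlip : ∀ γ γ', ‖N γ - N γ'‖ ≤ 2 * C * Real.exp (2 * M) * H * ‖γ - γ'‖ := by
    intro γ γ'
    rw [ContinuousMap.norm_le _ (by positivity)]
    intro η
    have e : (N γ - N γ') η = ∫ h in (η : ℝ)..H,
        (F h (projIcc (-M) M hM (γ (projIcc 0 H hH.le h))) -
          F h (projIcc (-M) M hM (γ' (projIcc 0 H hH.le h)))) :=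
      (intervalIntegral.integral_sub ((hcont γ).intervalIntegrable _ _)
        ((hcont γ').intervalIntegrable _ _)).symm
    rw [e]
    refine (intervalIntegral.norm_integral_le_of_norm_le_const
      (C := 2 * C * Real.exp (2 * M) * ‖γ - γ'‖) fun h _ => ?_).trans ?_
    · refine (hF.lipschitz M h _ _ (hcl _) (hcl _)).trans ?_
      gcongr
      refine ((LipschitzWith.projIcc hM).dist_le_mul _ _).trans ?_
      rw [NNReal.coe_one, one_mul, Real.dist_eq, ← Real.norm_eq_abs]
      exact (γ - γ').norm_coe_le_norm _
    · rw [abs_of_nonneg (by linarith [η.2.2])]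
      have : H - η ≤ H := by linarith [η.2.1]
      calc 2 * C * Real.exp (2 * M) * ‖γ - γ'‖ * (H - η)
          ≤ 2 * C * Real.exp (2 * M) * ‖γ - γ'‖ * H := by gcongr
        _ = _ := by ring
  have hNcont : Continuous N := by
    have : LipschitzWith (Real.toNNReal (2 * C * Real.exp (2 * M) * H)) N :=
      LipschitzWith.of_dist_le_mul fun γ γ' => by
        rw [Real.coe_toNNReal _ (by positivity), dist_eq_norm, dist_eq_norm]
        exact hNlip γ γ'
    exact this.continuous
  -- The radius is the bound on the rate times T, so the ball imposes no restriction on time.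
  have hPL : IsPicardLindelof (fun _ => N) (tmin := 0) (tmax := T) ⟨0, le_rfl, hT⟩
      (0 : C(Icc (0 : ℝ) H, ℝ)) (Real.toNNReal ((2 * C * M + C * H) * T)) 0
      (Real.toNNReal (2 * C * M + C * H)) (Real.toNNReal (2 * C * Real.exp (2 * M) * H)) :=
    { lipschitzOnWith := fun t _ => by
        refine LipschitzOnWith.of_dist_le_mul fun γ _ γ' _ => ?_
        rw [Real.coe_toNNReal _ (by positivity), dist_eq_norm, dist_eq_norm]
        exact hNlip γ γ'
      continuousOn := fun _ _ => continuousOn_const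
      norm_le := fun t _ γ _ => by
        rw [Real.coe_toNNReal _ (by positivity)]
        exact hNbound γ
      mul_max_le := by
        rw [Real.coe_toNNReal _ (by positivity), Real.coe_toNNReal _ (by positivity)]
        simp [hT] }
  obtain ⟨α, hα0, hα⟩ := hPL.exists_eq_forall_mem_Icc_hasDerivWithinAt₀
  have hαb := hF.isStrainOn_bound hα0 hα hNgrow
  have hαc : Continuous fun t : ℝ => α (projIcc 0 T hT t) := by
    have : ContinuousOn α (Icc 0 T) := fun t ht => (hα t ht).continuousWithinAt
    exact (continuousOn_iff_continuous_domRestrict.1 this).comp continuous_projIcc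
  refine ⟨fun t η => α (projIcc 0 T hT t) (projIcc 0 H hH.le η), ⟨?_, ?_⟩, ?_, ?_, ?_⟩
  · exact (hαc.comp continuous_fst).eval (continuous_projIcc.comp continuous_snd)
  · intro t ht η hη
    have hval : ∀ s ∈ Icc 0 T, ∀ h : ℝ,
        (projIcc (-M) M hM (α s (projIcc 0 H hH.le h)) : ℝ) = α s (projIcc 0 H hH.le h) := by
      intro s hs h
      have h1 : |α s (projIcc 0 H hH.le h)| ≤ M := by
        refine ((α s).norm_coe_le_norm _).trans ((hαb s hs).trans ?_)
        have := hs.2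
        rw [hMdef]
        gcongr
      rw [projIcc_of_mem hM (abs_le.1 h1)]
    have hrate : ∀ s ∈ Icc 0 T, N (α s) ⟨η, hη⟩ = ∫ h in η..H,
        F h (α (projIcc 0 T hT s) (projIcc 0 H hH.le h)) := by
      intro s hs
      change ∫ h in η..H, F h (projIcc (-M) M hM (α s (projIcc 0 H hH.le h))) = _
      simp_rw [hval s hs]
      rw [projIcc_of_mem hT hs]
    have hsub : Icc 0 t ⊆ Icc 0 T := Icc_subset_Icc_right ht.2
    let ev : C(Icc (0 : ℝ) H, ℝ) →L[ℝ] ℝ := ContinuousMap.evalCLM ℝ ⟨η, hη⟩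
    have hd : ∀ s ∈ Icc 0 T, HasDerivWithinAt (fun s => α s ⟨η, hη⟩) (N (α s) ⟨η, hη⟩) (Icc 0 T) s :=
      fun s hs => (ev.hasFDerivAt (x := α s)).comp_hasDerivWithinAt s (hα s hs)
    have hi : ContinuousOn (fun s => N (α s) ⟨η, hη⟩) (Icc 0 t) := by
      have : ContinuousOn α (Icc 0 t) := fun s hs =>
        ((hα s (hsub hs)).continuousWithinAt).mono hsub
      exact ev.continuous.comp_continuousOn (hNcont.comp_continuousOn this)
    have hFTC := intervalIntegral.integral_eq_sub_of_hasDerivAt_of_le ht.1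
      (fun s hs => ((hd s (hsub hs)).continuousWithinAt).mono hsub)
      (fun s hs => (hd s (hsub ⟨hs.1.le, hs.2.le⟩)).hasDerivAt
        (Icc_mem_nhds hs.1 (hs.2.trans_le ht.2)))
      (ContinuousOn.intervalIntegrable (by rw [uIcc_of_le ht.1]; exact hi))
    simp only [hα0, ContinuousMap.zero_apply, sub_zero] at hFTC
    rw [projIcc_of_mem hT ht, projIcc_of_mem hH.le hη, ← hFTC]
    refine intervalIntegral.integral_congr fun s hs => ?_
    rw [uIcc_of_le ht.1] at hs
    exact hrate s (hsub hs)
  · intro t η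
    refine ((α _).norm_coe_le_norm _).trans ((hαb _ (projIcc 0 T hT t).2).trans ?_)
    have : (projIcc 0 T hT t : ℝ) ≤ max t 0 := by
      rw [coe_projIcc, max_comm t 0]
      exact max_le_max le_rfl (min_le_right _ _)
    gcongr
  · intro t ht η
    simp only [projIcc_of_le_left hT ht, projIcc_of_le_left hT le_rfl]
  · intro t η
    simp only [projIcc_val]

theorem exists_isStrainOn (hF : IsDensity F C H) :
    ∃ G : ℝ → ℝ → ℝ, (∀ T, IsStrainOn F H T G) ∧
      (∀ t η, |G t η| ≤ H * Real.exp (2 * C * max t 0)) ∧ ∀ t η, H ≤ η → G t η = 0 := by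
  have hH := hF.H_pos
  -- Time t uses the solution on [0, ⌈t⌉ + 1]. The extra unit leaves room beyond t, so near t the
  -- glued function is given by a single solution and is continuous.
  choose g hg hb hneg hp using fun N : ℕ => hF.exists_isStrainOn_Icc (T := (N : ℝ) + 1) (by positivity)
  have agree : ∀ N K : ℕ, ∀ t : ℝ, t ≤ N + 1 → t ≤ K + 1 → ∀ η, g N t η = g K t η := by
    intro N K
    have hmain : ∀ t : ℝ, 0 ≤ t → t ≤ N + 1 → t ≤ K + 1 → ∀ η, g N t η = g K t η := by
      intro t ht0 hN hK η
      rw [hp N, hp K]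
      exact hF.isStrainOn_unique (T := min ((N : ℝ) + 1) (K + 1))
        ⟨(hg N).continuous, fun s hs => (hg N).equation s ⟨hs.1, hs.2.trans (min_le_left _ _)⟩⟩
        ⟨(hg K).continuous, fun s hs => (hg K).equation s ⟨hs.1, hs.2.trans (min_le_right _ _)⟩⟩
        t ⟨ht0, le_min hN hK⟩ _ (projIcc 0 H hF.H_pos.le η).2
    intro t hN hK η
    rcases le_total 0 t with ht | ht
    · exact hmain t ht hN hK η
    · rw [hneg N t ht, hneg K t ht]
      exact hmain 0 le_rfl (by positivity) (by positivity) η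
  have hloc : ∀ N : ℕ, ∀ t : ℝ, t ≤ N + 1 → ∀ η, g ⌈t⌉₊ t η = g N t η := fun N t ht η =>
    agree _ _ t ((Nat.le_ceil t).trans (by linarith)) ht η
  refine ⟨fun t η => g ⌈t⌉₊ t η, fun T => ⟨?_, ?_⟩, fun t η => hb _ t η, ?_⟩
  · rw [continuous_iff_continuousAt]
    rintro ⟨t, η⟩
    refine ((hg ⌈t⌉₊).continuous.continuousAt (x := (t, η))).congr ?_
    have : ∀ᶠ q : ℝ × ℝ in 𝓝 (t, η), q.1 < ⌈t⌉₊ + 1 :=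
      continuous_fst.continuousAt.eventually_lt continuousAt_const
        (by have := Nat.le_ceil t; simp only; linarith)
    filter_upwards [this] with q hq
    exact (hloc _ q.1 hq.le q.2).symm
  · intro t ht η hη
    have htN : t ≤ (⌈t⌉₊ : ℝ) + 1 := (Nat.le_ceil t).trans (by linarith)
    rw [(hg ⌈t⌉₊).equation t ⟨ht.1, htN⟩ η hη]
    refine intervalIntegral.integral_congr fun s hs => ?_
    rw [uIcc_of_le ht.1] at hs
    simp only [hloc ⌈t⌉₊ s (hs.2.trans htN)]
  · intro t η hη
    simp only
    rw [hp, projIcc_of_right_le hH.le hη]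
    rcases le_total 0 t with ht | ht
    · rw [(hg _).equation t ⟨ht, (Nat.le_ceil t).trans (by linarith)⟩ H ⟨hH.le, le_rfl⟩]
      simp
    · rw [hneg _ t ht, (hg _).equation 0 ⟨le_rfl, by positivity⟩ H ⟨hH.le, le_rfl⟩]
      simp

end IsDensity

/-- A strain on `[0, ∞)`, which vanishes on the hyperbolas beyond the support of the vorticity. -/
structure IsStrain (F : ℝ → ℝ → ℝ) (H : ℝ) (G : ℝ → ℝ → ℝ) : Prop where
  isStrainOn : ∀ T, IsStrainOn F H T G
  eq_zero : ∀ t η, H ≤ η → G t η = 0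

namespace IsStrain

variable {F G : ℝ → ℝ → ℝ} {C H : ℝ}

theorem continuous (hG : IsStrain F H G) : Continuous (Function.uncurry G) :=
  (hG.isStrainOn 0).continuous

theorem rate_eq_zero (hF : IsDensity F C H) {η : ℝ} (hη : H ≤ η) (γ : ℝ → ℝ) :
    ∫ h in η..H, F h (γ h) = 0 := by
  rw [intervalIntegral.integral_congr (g := fun _ => (0 : ℝ)), intervalIntegral.integral_zero]
  intro h hh
  rw [uIcc_of_ge hη] at hh
  exact hF.vanish _ _ hh.1

theorem equation (hF : IsDensity F C H) (hG : IsStrain F H G) {t η : ℝ} (ht : 0 ≤ t) (hη : 0 ≤ η) :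
    G t η = ∫ s in (0 : ℝ)..t, ∫ h in η..H, F h (G s h) := by
  rcases le_total η H with h | h
  · exact (hG.isStrainOn t).equation t ⟨ht, le_rfl⟩ η ⟨hη, h⟩
  · simp_rw [hG.eq_zero t η h, rate_eq_zero hF h]
    simp

theorem hasDerivWithinAt (hF : IsDensity F C H) (hG : IsStrain F H G) {t η : ℝ} (ht : 0 ≤ t)
    (hη : 0 ≤ η) :
    HasDerivWithinAt (fun s => G s η) (∫ h in η..H, F h (G t h)) (Ici 0) t := by
  have hc := hF.continuous_rate_time hG.continuous η
  have := (intervalIntegral.integral_hasDerivAt_right (hc.intervalIntegrable 0 t)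
    hc.aestronglyMeasurable.stronglyMeasurableAtFilter hc.continuousAt).hasDerivWithinAt
    (s := Ici 0)
  exact this.congr (fun s hs => hG.equation hF hs hη) (hG.equation hF ht hη)

end IsStrain

theorem IsDensity.exists_isStrain {F : ℝ → ℝ → ℝ} {C H : ℝ} (hF : IsDensity F C H) :
    ∃ G : ℝ → ℝ → ℝ, IsStrain F H G ∧ ∀ t η, 0 ≤ t → |G t η| ≤ H * Real.exp (2 * C * t) := by
  obtain ⟨G, h1, h2, h3⟩ := hF.exists_isStrainOn
  refine ⟨G, ⟨h1, h3⟩, fun t η ht => ?_⟩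
  have := h2 t η
  rwa [max_eq_left ht] at this

end

/-! ### Strain maps and integration along hyperbolas. -/

noncomputable section

/-- The map that strains each hyperbola `x₁ x₂ = h` by the factor `e ^ γ(h)`. -/
def strainMap (γ : ℝ → ℝ) (x : ℝ × ℝ) : ℝ × ℝ :=
  (x.1 * Real.exp (γ (x.1 * x.2)), x.2 * Real.exp (-γ (x.1 * x.2)))

theorem strainMap_mul (γ : ℝ → ℝ) (x : ℝ × ℝ) :
    (strainMap γ x).1 * (strainMap γ x).2 = x.1 * x.2 := by
  have : Real.exp (γ (x.1 * x.2)) * Real.exp (-γ (x.1 * x.2)) = 1 := by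
    rw [← Real.exp_add]; simp
  calc _ = x.1 * x.2 * (Real.exp (γ (x.1 * x.2)) * Real.exp (-γ (x.1 * x.2))) := by
        simp only [strainMap]; ring
    _ = _ := by rw [this, mul_one]

theorem strainMap_mem {γ : ℝ → ℝ} {x : ℝ × ℝ} : strainMap γ x ∈ quadrant ↔ x ∈ quadrant := by
  simp only [quadrant, strainMap, mem_ofPred_eq]
  rw [mul_nonneg_iff_of_pos_right (Real.exp_pos _), mul_nonneg_iff_of_pos_right (Real.exp_pos _)]

/-- Since x₁x₂ is conserved, γ is evaluated at the same height both times and the two exponents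
cancel. -/
theorem strainMap_neg_strainMap (γ : ℝ → ℝ) (x : ℝ × ℝ) :
    strainMap (fun h => -γ h) (strainMap γ x) = x := by
  have h1 : ∀ g : ℝ, Real.exp g * Real.exp (-g) = 1 := fun g => by rw [← Real.exp_add]; simp
  have h2 : ∀ g : ℝ, Real.exp (-g) * Real.exp g = 1 := fun g => by rw [← Real.exp_add]; simp
  conv_lhs => rw [strainMap, strainMap_mul]
  simp only [strainMap, mul_assoc, neg_neg, h1, h2, mul_one]

/-- The strain map of a continuous strain, as a homeomorphism of the plane. -/
def strainHomeo (γ : ℝ → ℝ) (hγ : Continuous γ) : ℝ × ℝ ≃ₜ ℝ × ℝ where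
  toFun := strainMap γ
  invFun := strainMap fun h => -γ h
  left_inv := strainMap_neg_strainMap γ
  right_inv x := by simpa using strainMap_neg_strainMap (fun h => -γ h) x
  continuous_toFun := by unfold strainMap; fun_prop
  continuous_invFun := by unfold strainMap; fun_prop

theorem suppD_comp_strainMap {γ : ℝ → ℝ} (hγ : Continuous γ) (f : ℝ × ℝ → ℝ) :
    suppD (fun x => f (strainMap γ x)) = strainMap γ ⁻¹' suppD f := by
  have := (strainHomeo γ hγ).preimage_closure {x | x ∈ quadrant ∧ f x ≠ 0}
  change strainMap γ ⁻¹' suppD f = _ at this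
  rw [this, suppD]
  congr 1
  ext x
  change _ ↔ strainMap γ x ∈ quadrant ∧ f (strainMap γ x) ≠ 0
  rw [strainMap_mem]
  rfl

section Volume

theorem lintegral_comp_mul_left_pos {u : ℝ → ℝ≥0∞} (hu : Measurable u) {c : ℝ} (hc : 0 < c) :
    ∫⁻ x, u (c * x) = ENNReal.ofReal c⁻¹ * ∫⁻ x, u x := by
  rw [← lintegral_map (g := fun x => c * x) hu (by fun_prop)]
  change ∫⁻ x, u x ∂(Measure.map (c * ·) volume) = _
  rw [Real.map_volume_mul_left hc.ne', lintegral_smul_measure, abs_of_pos (inv_pos.2 hc)]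
  rfl

/-- Tonelli together with the scaling x₂ = h / z for fixed z = x₁, whose Jacobian is 1/z. -/
theorem volume_eq_lintegral_hyperbola {A : Set (ℝ × ℝ)} (hA : MeasurableSet A)
    (hpos : ∀ x ∈ A, 0 < x.1) :
    volume A = ∫⁻ h, ∫⁻ z in Ioi (0 : ℝ), A.indicator 1 (z, h / z) * ENNReal.ofReal z⁻¹ := by
  have hm : Measurable (A.indicator (1 : ℝ × ℝ → ℝ≥0∞)) := measurable_one.indicator hA
  have hm2 : Measurable (Function.uncurry fun (h z : ℝ) =>
      A.indicator (1 : ℝ × ℝ → ℝ≥0∞) (z, h / z) * ENNReal.ofReal z⁻¹) := by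
    refine Measurable.mul (hm.comp ?_) ?_ <;> fun_prop
  rw [lintegral_lintegral_swap hm2.aemeasurable, ← lintegral_indicator_one hA, Measure.volume_eq_prod,
    lintegral_prod _ hm.aemeasurable, ← lintegral_indicator measurableSet_Ioi]
  refine lintegral_congr fun z => ?_
  by_cases hz : 0 < z
  · rw [indicator_of_mem (by exact hz)]
    have hmz : Measurable fun y => A.indicator (1 : ℝ × ℝ → ℝ≥0∞) (z, y) :=
      hm.comp (by fun_prop)
    have hmz' : Measurable fun h => A.indicator (1 : ℝ × ℝ → ℝ≥0∞) (z, h / z) :=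
      hm.comp (by fun_prop)
    rw [lintegral_mul_const _ hmz']
    have := lintegral_comp_mul_left_pos hmz (inv_pos.2 hz)
    simp_rw [div_eq_inv_mul]
    rw [this, inv_inv, mul_comm, ← mul_assoc, ← ENNReal.ofReal_mul (inv_nonneg.2 hz.le),
      inv_mul_cancel₀ hz.ne', ENNReal.ofReal_one, one_mul]
  · rw [indicator_of_notMem (by exact hz)]
    have : ∀ y, A.indicator (1 : ℝ × ℝ → ℝ≥0∞) (z, y) = 0 := fun y =>
      indicator_of_notMem (fun h => hz (hpos _ h)) _
    simp [this]

theorem lintegral_Ioi_inv_comp_mul {v : ℝ → ℝ≥0∞} (hv : Measurable v) {c : ℝ} (hc : 0 < c) :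
    ∫⁻ z in Ioi (0 : ℝ), v (z * c) * ENNReal.ofReal z⁻¹ =
      ∫⁻ z in Ioi (0 : ℝ), v z * ENNReal.ofReal z⁻¹ := by
  rw [← lintegral_indicator measurableSet_Ioi, ← lintegral_indicator measurableSet_Ioi]
  set W : ℝ → ℝ≥0∞ := (Ioi (0 : ℝ)).indicator fun z => v z * ENNReal.ofReal z⁻¹ with hW
  have hWm : Measurable W := Measurable.indicator (by fun_prop) measurableSet_Ioi
  have e : ∀ z, (Ioi (0 : ℝ)).indicator (fun z => v (z * c) * ENNReal.ofReal z⁻¹) z =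
      W (c * z) * ENNReal.ofReal c := by
    intro z
    by_cases hz : 0 < z
    · rw [indicator_of_mem (by exact hz), hW, indicator_of_mem (by exact mul_pos hc hz), mul_assoc,
        ← ENNReal.ofReal_mul (inv_nonneg.2 (mul_pos hc hz).le), mul_comm z c]
      congr 2
      field_simp
    · rw [indicator_of_notMem (by exact hz), hW, indicator_of_notMem, zero_mul]
      exact fun h => hz (pos_of_mul_pos_right h hc.le)
  simp_rw [e]
  have hWm' : Measurable fun z => W (c * z) := hWm.comp (by fun_prop)
  rw [lintegral_mul_const _ hWm', lintegral_comp_mul_left_pos hWm hc, mul_comm,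
    ← mul_assoc, ← ENNReal.ofReal_mul hc.le, mul_inv_cancel₀ hc.ne', ENNReal.ofReal_one, one_mul]

/-- On the hyperbola of height h the map is the dilation of z by e^(γ(h)), which preserves dz/z.
This avoids a Jacobian and needs no differentiability of γ. -/
theorem volume_preimage_strainMap {γ : ℝ → ℝ} (hγ : Continuous γ) {A : Set (ℝ × ℝ)}
    (hA : MeasurableSet A) (hpos : ∀ x ∈ A, 0 < x.1) : volume (strainMap γ ⁻¹' A) = volume A := by
  have hm : Measurable (A.indicator (1 : ℝ × ℝ → ℝ≥0∞)) := measurable_one.indicator hA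
  have hpre : MeasurableSet (strainMap γ ⁻¹' A) := (strainHomeo γ hγ).continuous.measurable hA
  rw [volume_eq_lintegral_hyperbola hpre,
    volume_eq_lintegral_hyperbola hA hpos]
  · refine lintegral_congr fun h => ?_
    rw [← lintegral_Ioi_inv_comp_mul (v := fun z => A.indicator 1 (z, h / z))
      (hm.comp (by fun_prop)) (Real.exp_pos (γ h))]
    refine setLIntegral_congr_fun measurableSet_Ioi fun z (hz : 0 < z) => ?_
    have e : strainMap γ (z, h / z) = (z * Real.exp (γ h), h / (z * Real.exp (γ h))) := by
      simp only [strainMap, mul_div_cancel₀ h hz.ne', Real.exp_neg]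
      congr 1
      field_simp
    change A.indicator 1 (strainMap γ (z, h / z)) * _ = _
    rw [e]
  · intro x hx
    exact pos_of_mul_pos_left (hpos _ hx) (Real.exp_pos _).le

end Volume

namespace Profile

variable {f : ℝ × ℝ → ℝ} {δ R B : ℝ}

theorem kernel_eq_zero (hf : Profile f δ R B) {z h : ℝ} (hz : 0 < z) (hh : 0 ≤ h)
    (hzR : z ∉ Ioc δ R) (g : ℝ) : kernel f z h g = 0 := by
  have : f (z, h / z) = 0 := by
    by_contra hne
    have h1 := hf.supp (z, h / z) ⟨hz.le, div_nonneg hh hz.le⟩ hne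
    exact hzR ⟨h1.1, h1.2.1⟩
  simp [kernel, this]

theorem strainDensity_eq_of_le (hf : Profile f δ R B) {a b h : ℝ} (ha : 0 < a) (haδ : a ≤ δ)
    (hRb : R ≤ b) (hh : 0 ≤ h) (g : ℝ) : ∫ z in a..b, kernel f z h g = strainDensity f δ R h g := by
  have hδR := hf.delta_le_radius
  rw [strainDensity, intervalIntegral.integral_of_le (by linarith), intervalIntegral.integral_of_le hδR]
  refine setIntegral_eq_of_subset_of_forall_sdiff_eq_zero measurableSet_Ioc
    (Ioc_subset_Ioc haδ hRb) fun z hz => hf.kernel_eq_zero (ha.trans hz.1.1) hh hz.2 g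

theorem eq_zero_of_lt (hf : Profile f δ R B) {x : ℝ × ℝ} (hx : x ∈ quadrant)
    (hR : R ^ 2 < x.1 * x.2) : f x = 0 := by
  by_contra hne
  have h1 := hf.supp x hx hne
  have := hf.one_le_radius
  nlinarith [mul_le_mul h1.2.1 h1.2.2 hx.2 (by linarith)]

theorem strainDensity_eq_zero {f : ℝ × ℝ → ℝ} {a b c h : ℝ} (ha : 0 < a) (hab : a ≤ b)
    (hch : c ^ 2 < h) (hf : ∀ x ∈ quadrant, c ^ 2 < x.1 * x.2 → f x = 0) (g : ℝ) :
    strainDensity f a b h g = 0 := by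
  rw [strainDensity, intervalIntegral.integral_congr (g := fun _ => (0 : ℝ)),
    intervalIntegral.integral_zero]
  intro z hz
  rw [uIcc_of_le hab] at hz
  have hz0 : 0 < z := ha.trans_le hz.1
  have : f (z, h / z) = 0 :=
    hf _ ⟨hz0.le, div_nonneg ((sq_nonneg c).trans hch.le) hz0.le⟩ (by
      simpa only [mul_div_cancel₀ h hz0.ne'] using hch)
  simp [kernel, this]

/-- Substituting y₂ = h/z for fixed y₁ = z turns dy/|y|² into z (z⁴ + h²)⁻¹ dz dh, the kernel at
strain 0; Fubini then collects each hyperbola. Integrability holds because the integrand is bounded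
and supported in a box away from y₁ = 0. -/
theorem bigOmega_eq (hf : Profile f δ R B) {η K : ℝ} (hη : 0 ≤ η) (hηK : η ≤ K) (hK : R ^ 2 ≤ K) :
    bigOmega f η = ∫ h in η..K, strainDensity f δ R h 0 := by
  have hδ := hf.delta_pos
  have hR := hf.one_le_radius
  have hB := hf.bound_nonneg
  set A : Set (ℝ × ℝ) := {y | y ∈ quadrant ∧ η ≤ y.1 * y.2} with hAdef
  have hA : MeasurableSet A := by
    refine IsClosed.measurableSet ?_
    have h1 : IsClosed {y : ℝ × ℝ | 0 ≤ y.1} := isClosed_le continuous_const continuous_fst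
    have h2 : IsClosed {y : ℝ × ℝ | 0 ≤ y.2} := isClosed_le continuous_const continuous_snd
    have h3 : IsClosed {y : ℝ × ℝ | η ≤ y.1 * y.2} :=
      isClosed_le continuous_const (continuous_fst.mul continuous_snd)
    exact (h1.inter h2).inter h3
  set u : ℝ × ℝ → ℝ := A.indicator fun y => f y / (y.1 ^ 2 + y.2 ^ 2) with hu
  have hum : Measurable u := by
    refine Measurable.indicator ?_ hA
    exact hf.continuous.measurable.div (by fun_prop)
  set box : Set (ℝ × ℝ) := Icc δ R ×ˢ Icc 0 R with hbox
  have hout : ∀ y, y ∉ box → u y = 0 := by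
    intro y hy
    by_cases hyA : y ∈ A
    · rw [hu, indicator_of_mem hyA]
      have : f y = 0 := by
        by_contra hne
        have h1 := hf.supp y hyA.1 hne
        exact hy ⟨⟨h1.1.le, h1.2.1⟩, hyA.1.2, h1.2.2⟩
      simp [this]
    · rw [hu, indicator_of_notMem hyA]
  have hui : Integrable u := by
    have hbi : Integrable (box.indicator fun _ => B / δ ^ 2) (volume : Measure (ℝ × ℝ)) := by
      rw [integrable_indicator_iff (measurableSet_Icc.prod measurableSet_Icc)]
      refine integrableOn_const ?_
      exact (isCompact_Icc.prod isCompact_Icc).measure_lt_top.ne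
    refine hbi.mono' hum.aestronglyMeasurable (Eventually.of_forall fun y => ?_)
    by_cases hy : y ∈ box
    · rw [indicator_of_mem hy, hu]
      refine (norm_indicator_le_norm_self _ _).trans ?_
      have : δ ^ 2 ≤ y.1 ^ 2 + y.2 ^ 2 := by nlinarith [hy.1.1, sq_nonneg y.2]
      rw [Real.norm_eq_abs, abs_div, abs_of_nonneg (by positivity : 0 ≤ y.1 ^ 2 + y.2 ^ 2)]
      exact div_le_div₀ hB (hf.bound y) (by positivity) this
    · rw [indicator_of_notMem hy, hout y hy, norm_zero]
  have hinner : ∀ z ∈ Ioc δ R, ∫ y, u (z, y) = ∫ h in η..K, kernel f z h 0 := by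
    intro z hz
    have hz0 : 0 < z := hδ.trans hz.1
    have h1 : ∫ y, u (z, y) = ∫ h, z⁻¹ * u (z, h / z) := by
      rw [integral_const_mul, Measure.integral_comp_div (fun y => u (z, y)) z, abs_of_pos hz0,
        smul_eq_mul, inv_mul_cancel_left₀ hz0.ne']
    rw [h1, intervalIntegral.integral_of_le hηK, ← integral_Icc_eq_integral_Ioc,
      ← integral_indicator measurableSet_Icc]
    congr 1
    ext h
    by_cases hh : h ∈ Icc η K
    · have hmem : ((z, h / z) : ℝ × ℝ) ∈ A := by
        refine ⟨⟨hz0.le, div_nonneg (hη.trans hh.1) hz0.le⟩, ?_⟩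
        simp only [mul_div_cancel₀ h hz0.ne']
        exact hh.1
      rw [indicator_of_mem hh, hu, indicator_of_mem hmem, kernel]
      simp only [mul_zero, neg_zero, Real.exp_zero, mul_one]
      have : 0 < z ^ 4 + h ^ 2 := by positivity
      field_simp
    · rw [indicator_of_notMem hh]
      have : u (z, h / z) = 0 := by
        rw [mem_Icc, not_and_or, not_le, not_le] at hh
        rcases hh with hh | hh
        · rw [hu, indicator_of_notMem]
          intro hc
          have := hc.2
          simp only [mul_div_cancel₀ h hz0.ne'] at this
          linarith
        · refine hout _ fun hc => ?_
          have h2 := hc.2.2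
          simp only at h2
          rw [div_le_iff₀ hz0] at h2
          nlinarith [hz.2]
      rw [this, mul_zero]
  have hzero : ∀ z, z ∉ Ioc δ R → ∫ y, u (z, y) = 0 := by
    intro z hz
    have : ∀ y, u (z, y) = 0 := by
      intro y
      by_cases hyA : (z, y) ∈ A
      · rw [hu, indicator_of_mem hyA]
        have : f (z, y) = 0 := by
          by_contra hne
          have h1 := hf.supp (z, y) hyA.1 hne
          exact hz ⟨h1.1, h1.2.1⟩
        simp [this]
      · rw [hu, indicator_of_notMem hyA]
    simp [this]
  have e1 : bigOmega f η = ∫ z in δ..R, ∫ h in η..K, kernel f (max z δ) h 0 := by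
    calc bigOmega f η = ∫ y, u y := (integral_indicator hA).symm
      _ = ∫ z, ∫ y, u (z, y) := by
        rw [Measure.volume_eq_prod] at hui ⊢
        exact integral_prod u hui
      _ = ∫ z in Ioc δ R, ∫ y, u (z, y) :=
        (setIntegral_eq_integral_of_forall_compl_eq_zero hzero).symm
      _ = ∫ z in Ioc δ R, ∫ h in η..K, kernel f (max z δ) h 0 :=
        setIntegral_congr_fun measurableSet_Ioc fun z hz => by
          simp only [max_eq_left hz.1.le]
          exact hinner z hz
      _ = _ := (intervalIntegral.integral_of_le hf.delta_le_radius).symm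
  rw [e1, intervalIntegral_intervalIntegral_swap]
  · exact intervalIntegral.integral_congr fun h _ => (hf.strainDensity_eq h 0).symm
  · have hc : Continuous (Function.uncurry fun z h => kernel f (max z δ) h 0) :=
      hf.continuous_kernel.comp (by fun_prop : Continuous fun q : ℝ × ℝ => ((q.2, (0 : ℝ)), q.1))
    have hK : IsCompact (uIcc δ R ×ˢ uIcc η K) := isCompact_uIcc.prod isCompact_uIcc
    exact (hc.continuousOn.integrableOn_compact hK).mono_set
      (prod_mono uIoc_subset_uIcc uIoc_subset_uIcc)

theorem comp_strainMap (hf : Profile f δ R B) {γ : ℝ → ℝ} (hγ : Continuous γ) {M : ℝ} (hM0 : 0 ≤ M)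
    (hM : ∀ h ∈ Icc 0 (R ^ 2), |γ h| ≤ M) :
    Profile (fun x => f (strainMap γ x)) (δ * Real.exp (-M)) (R * Real.exp M) B where
  continuous := hf.continuous.comp (strainHomeo γ hγ).continuous
  delta_pos := mul_pos hf.delta_pos (Real.exp_pos _)
  delta_le_one := mul_le_one₀ hf.delta_le_one (Real.exp_pos _).le (Real.exp_le_one_iff.2 (by linarith))
  one_le_radius := by
    have := hf.one_le_radius
    have := Real.one_le_exp hM0
    nlinarith
  bound x := hf.bound _
  supp x hx hne := by
    have hq := (strainMap_mem (γ := γ)).2 hx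
    have h1 := hf.supp _ hq hne
    have hR := hf.one_le_radius
    have hprod : x.1 * x.2 ∈ Icc 0 (R ^ 2) := by
      refine ⟨mul_nonneg hx.1 hx.2, ?_⟩
      rw [← strainMap_mul γ x, pow_two]
      exact mul_le_mul h1.2.1 h1.2.2 hq.2 (by linarith)
    have hg := abs_le.1 (hM _ hprod)
    simp only [strainMap] at h1
    set g := γ (x.1 * x.2) with hgdef
    have ex1 : x.1 = x.1 * Real.exp g * Real.exp (-g) := by
      rw [mul_assoc, ← Real.exp_add]; simp
    have ex2 : x.2 = x.2 * Real.exp (-g) * Real.exp g := by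
      rw [mul_assoc, ← Real.exp_add]; simp
    have hx1 : 0 ≤ x.1 * Real.exp g := mul_nonneg hx.1 (Real.exp_pos _).le
    have hx2 : 0 ≤ x.2 * Real.exp (-g) := mul_nonneg hx.2 (Real.exp_pos _).le
    refine ⟨?_, ?_, ?_⟩
    · rw [ex1]
      exact mul_lt_mul h1.1 (Real.exp_le_exp.2 (by linarith [hg.2])) (Real.exp_pos _) hx1
    · rw [ex1]
      exact mul_le_mul h1.2.1 (Real.exp_le_exp.2 (by linarith [hg.1])) (Real.exp_pos _).le (by linarith)
    · rw [ex2]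
      exact mul_le_mul h1.2.2 (Real.exp_le_exp.2 hg.2) (Real.exp_pos _).le (by linarith)

/-- On a fixed hyperbola γ is a constant g, and the substitution z ↦ z e^g moves the strain from the
profile into the denominator. This explains the factors e^(±2g) in `kernel`. -/
theorem strainDensity_comp_strainMap (hf : Profile f δ R B) {γ : ℝ → ℝ} {M : ℝ} (hM0 : 0 ≤ M)
    (hM : ∀ h ∈ Icc 0 (R ^ 2), |γ h| ≤ M) {h : ℝ} (hh : h ∈ Icc 0 (R ^ 2)) :
    strainDensity (fun x => f (strainMap γ x)) (δ * Real.exp (-M)) (R * Real.exp M) h 0 =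
      strainDensity f δ R h (γ h) := by
  have hδ := hf.delta_pos
  have hR := hf.one_le_radius
  have hg := abs_le.1 (hM _ hh)
  set g := γ h with hgdef
  have hle : δ * Real.exp (-M) ≤ R * Real.exp M :=
    mul_le_mul hf.delta_le_radius (Real.exp_le_exp.2 (by linarith)) (Real.exp_pos _).le (by linarith)
  have hcongr : ∀ z ∈ uIcc (δ * Real.exp (-M)) (R * Real.exp M),
      kernel (fun x => f (strainMap γ x)) z h 0 =
        (fun y => Real.exp g * kernel f y h g) (z * Real.exp g) := by
    intro z hz
    rw [uIcc_of_le hle] at hz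
    have hz0 : 0 < z := lt_of_lt_of_le (by positivity) hz.1
    have e : strainMap γ (z, h / z) = (z * Real.exp g, h / (z * Real.exp g)) := by
      simp only [strainMap, mul_div_cancel₀ h hz0.ne', ← hgdef, Real.exp_neg]
      congr 1
      field_simp
    simp only [kernel, e, mul_zero, neg_zero, Real.exp_zero, mul_one]
    have e1 : Real.exp (-(2 * g)) = (Real.exp g)⁻¹ ^ 2 := by
      rw [← Real.exp_neg, ← Real.exp_nat_mul]; congr 1; push_cast; ring
    have e2 : Real.exp (2 * g) = Real.exp g ^ 2 := by
      rw [← Real.exp_nat_mul]; push_cast; rfl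
    rw [e1, e2]
    have hE := Real.exp_pos g
    set E := Real.exp g
    have e3 : (z * E) ^ 4 * E⁻¹ ^ 2 + h ^ 2 * E ^ 2 = E ^ 2 * (z ^ 4 + h ^ 2) := by
      field_simp
    rw [e3, mul_inv]
    field_simp
  rw [strainDensity, intervalIntegral.integral_congr hcongr,
    intervalIntegral.integral_comp_mul_right (fun y => Real.exp g * kernel f y h g)
      (Real.exp_pos g).ne',
    intervalIntegral.integral_const_mul, smul_eq_mul, inv_mul_cancel_left₀ (Real.exp_pos g).ne']
  refine hf.strainDensity_eq_of_le (by positivity) ?_ ?_ hh.1 g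
  · rw [mul_assoc, ← Real.exp_add]
    exact mul_le_of_le_one_right hδ.le (Real.exp_le_one_iff.2 (by linarith))
  · rw [mul_assoc, ← Real.exp_add]
    exact le_mul_of_one_le_right (by linarith) (Real.one_le_exp (by linarith))

/-- This closes the system: Ω of a transported profile depends on the profile only through its
density and on the flow only through the strain. -/
theorem bigOmega_comp_strainMap (hf : Profile f δ R B) {γ : ℝ → ℝ} (hγ : Continuous γ) {η : ℝ}
    (hη : 0 ≤ η) :
    bigOmega (fun x => f (strainMap γ x)) η = ∫ h in η..(R ^ 2 + 1), strainDensity f δ R h (γ h) := by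
  have hD := hf.isDensity
  set H := R ^ 2 + 1 with hH
  obtain ⟨M, hM0, hM⟩ : ∃ M, 0 ≤ M ∧ ∀ h ∈ Icc 0 (R ^ 2), |γ h| ≤ M := by
    obtain ⟨M, hM⟩ := isCompact_Icc.bddAbove_image (f := fun h => |γ h|) (K := Icc 0 (R ^ 2))
      hγ.abs.continuousOn
    exact ⟨max M 0, le_max_right _ _, fun h hh =>
      (hM (mem_image_of_mem _ hh)).trans (le_max_left _ _)⟩
  have hP := hf.comp_strainMap hγ hM0 hM
  -- A height above η, above H and above the support of the strained profile; η may itself exceed H.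
  set K := max η (max H ((R * Real.exp M) ^ 2 + 1)) with hK
  have hP' := hP.isDensity
  rw [hP.bigOmega_eq (K := K) hη (le_max_left _ _) (by
    rw [hK]
    exact (by linarith : (R * Real.exp M) ^ 2 ≤ (R * Real.exp M) ^ 2 + 1).trans
      ((le_max_right _ _).trans (le_max_right _ _)))]
  have hc : Continuous fun h => strainDensity f δ R h (γ h) :=
    hD.continuous.comp (continuous_id.prodMk hγ)
  have hHK : H ≤ K := (le_max_left _ _).trans (le_max_right _ _)
  have htail : ∫ h in H..K, strainDensity f δ R h (γ h) = 0 := by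
    rw [intervalIntegral.integral_symm, IsStrain.rate_eq_zero hD hHK, neg_zero]
  have hext : ∫ h in η..H, strainDensity f δ R h (γ h) = ∫ h in η..K, strainDensity f δ R h (γ h) := by
    rw [← intervalIntegral.integral_add_adjacent_intervals (hc.intervalIntegrable η H)
      (hc.intervalIntegrable H K), htail, add_zero]
  rw [hext]
  refine intervalIntegral.integral_congr fun h hh => ?_
  rw [uIcc_of_le (le_max_left _ _)] at hh
  have hh0 : 0 ≤ h := hη.trans hh.1
  rcases le_or_gt h (R ^ 2) with hle | hlt
  · exact hf.strainDensity_comp_strainMap hM0 hM ⟨hh0, hle⟩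
  · rw [strainDensity_eq_zero hf.delta_pos hf.delta_le_radius hlt
      (fun x hx hR => hf.eq_zero_of_lt hx hR), strainDensity_eq_zero hP.delta_pos hP.delta_le_radius hlt
      fun x hx hR => hf.eq_zero_of_lt (strainMap_mem.2 hx) (by rwa [strainMap_mul])]

end Profile

end

/-! ### Regularity of the strain and of the transported vorticity. -/

noncomputable section

theorem uniqueDiffOn_quadrant : UniqueDiffOn ℝ quadrant :=
  (uniqueDiffOn_Ici 0).prod (uniqueDiffOn_Ici 0)

theorem isClosed_quadrant : IsClosed quadrant := isClosed_Ici.prod isClosed_Ici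

theorem convex_quadrant : Convex ℝ quadrant := (convex_Ici 0).prod (convex_Ici 0)

theorem eventuallyEq_zero_of_notMem {E F : Type} [TopologicalSpace E] [Zero F] {S K : Set E}
    (hK : IsClosed K) {f : E → F} (hf : ∀ x ∈ S, x ∉ K → f x = 0) {x : E} (hx : x ∉ K) :
    f =ᶠ[𝓝[S] x] fun _ => 0 := by
  filter_upwards [mem_nhdsWithin_of_mem_nhds (hK.isOpen_compl.mem_nhds hx), self_mem_nhdsWithin]
    with y hy hyS
  exact hf y hyS hy

theorem weightSmooth_of_contDiffOn {E F : Type} [NormedAddCommGroup E] [NormedSpace ℝ E]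
    [NormedAddCommGroup F] [NormedSpace ℝ F] {S K : Set E} (hS : UniqueDiffOn ℝ S)
    (hSc : IsClosed S) (hK : IsCompact K) {n : ℕ} {f : E → F} (hf : ContDiffOn ℝ n f S)
    (hfK : ∀ x ∈ S, x ∉ K → f x = 0) :
    WeightSmooth (univ : Set Unit) S (fun _ _ => 2) n (fun _ => f) := by
  have h0 : ∀ {F : Type} [NormedAddCommGroup F] {f : E → F}, ContinuousOn f S →
      (∀ x ∈ S, x ∉ K → f x = 0) →
      WeightBounded (univ : Set Unit) S (fun _ _ => 2) (fun _ => f) := by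
    intro F _ f hf hfK
    refine ⟨hf.comp continuousOn_snd fun q hq => hq.2, ?_⟩
    obtain ⟨C, hC⟩ := (hK.inter_left hSc).exists_bound_of_continuousOn (hf.mono inter_subset_left)
    obtain ⟨N, hN⟩ := pow_unbounded_of_one_lt C one_lt_two
    refine ⟨N, fun _ _ x hx => ?_⟩
    by_cases hxK : x ∈ K
    · exact (hC x ⟨hx, hxK⟩).trans hN.le
    · rw [hfK x hx hxK, norm_zero]
      positivity
  induction n generalizing F with
  | zero => exact h0 hf.continuousOn hfK
  | succ n ih =>
    have hf' := hf
    rw [Nat.cast_succ, contDiffOn_succ_iff_fderivWithin hS] at hf'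
    refine ⟨h0 hf.continuousOn hfK, fun _ => fderivWithin ℝ f S, ih hf'.2.2 fun x hx hxK => ?_,
      fun _ _ x hx => (hf'.1 x hx).hasFDerivWithinAt⟩
    have hev := eventuallyEq_zero_of_notMem hK.isClosed hfK hxK
    rw [hev.fderivWithin_eq (hfK x hx hxK)]
    simp

/-- `m` is a nondecreasing bound for the strain `G`. -/
structure StrainBound (G : ℝ → ℝ → ℝ) (m : ℝ → ℝ) : Prop where
  mono : MonotoneOn m (Ici 0)
  le_self : ∀ t, 0 ≤ t → t ≤ m t
  abs_le : ∀ t η, 0 ≤ t → 0 ≤ η → |G t η| ≤ m t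

/-- The weight `e ^ m(t) (2 + |x|)`. -/
def weight {E : Type} [NormedAddCommGroup E] (m : ℝ → ℝ) (t : ℝ) (x : E) : ℝ :=
  Real.exp (m t) * (2 + ‖x‖)

namespace StrainBound

variable {G : ℝ → ℝ → ℝ} {m : ℝ → ℝ} {E : Type} [NormedAddCommGroup E]

theorem nonneg (hm : StrainBound G m) {t : ℝ} (ht : 0 ≤ t) : 0 ≤ m t := ht.trans (hm.le_self t ht)

theorem exp_le_weight (t : ℝ) (x : E) : Real.exp (m t) ≤ weight m t x :=
  le_mul_of_one_le_right (Real.exp_pos _).le (by linarith [norm_nonneg x])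

theorem two_le_weight (hm : StrainBound G m) {t : ℝ} (ht : 0 ≤ t) (x : E) : 2 ≤ weight m t x := by
  have := Real.one_le_exp (hm.nonneg ht)
  unfold weight
  nlinarith [norm_nonneg x]

theorem norm_le_weight (hm : StrainBound G m) {t : ℝ} (ht : 0 ≤ t) (x : E) : ‖x‖ ≤ weight m t x := by
  have := Real.one_le_exp (hm.nonneg ht)
  unfold weight
  nlinarith [norm_nonneg x]

theorem exp_mul_le_weight_pow {t : ℝ} (x : E) {g : ℝ} (k : ℕ)
    (hg : g ≤ k * m t) : Real.exp g ≤ weight m t x ^ k := by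
  refine (Real.exp_le_exp.2 hg).trans ?_
  rw [Real.exp_nat_mul]
  exact pow_le_pow_left₀ (Real.exp_pos _).le (exp_le_weight t x) k

end StrainBound

section Strain

variable {f : ℝ × ℝ → ℝ} {δ R B : ℝ} {G : ℝ → ℝ → ℝ} {m : ℝ → ℝ}

theorem Profile.weightSmooth (hf : Profile f δ R B) {n : ℕ} (hfn : ContDiffOn ℝ n f quadrant) :
    WeightSmooth (univ : Set Unit) quadrant (fun _ _ => 2) n (fun _ => f) := by
  have hK : IsCompact (Icc δ R ×ˢ Icc 0 R) := isCompact_Icc.prod isCompact_Icc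
  refine weightSmooth_of_contDiffOn uniqueDiffOn_quadrant isClosed_quadrant hK hfn
    fun x hx hxK => ?_
  by_contra hne
  have h := hf.supp x hx hne
  exact hxK ⟨⟨h.1.le, h.2.1⟩, hx.2, h.2.2⟩

/-- The parameters are (t, z) with z in [δ, R], where 1/z is bounded. The exponentials e^(±2G) and
the reciprocal of the denominator are bounded by powers of e^m, so the integrand belongs to the
calculus and integrating in z preserves this. -/
theorem weightSmooth_strainDensity (hf : Profile f δ R B) (hm : StrainBound G m) {k : ℕ}
    (hfk : ContDiffOn ℝ k f quadrant)
    (hG : WeightSmooth (Ici (0 : ℝ)) (Ici (0 : ℝ)) (weight m) k G) :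
    WeightSmooth (Ici (0 : ℝ)) (Ici (0 : ℝ)) (weight m) k
      (fun t h => strainDensity f δ R h (G t h)) := by
  have hδ := hf.delta_pos
  set T : Set (ℝ × ℝ) := Ici (0 : ℝ) ×ˢ Icc δ R with hT
  set w : ℝ × ℝ → ℝ → ℝ := fun p h => weight m p.1 h with hw
  have hw0 : ∀ t ∈ Ici (0 : ℝ), ∀ h ∈ Ici (0 : ℝ), 2 ≤ weight m t h := fun t ht h _ =>
    hm.two_le_weight ht h
  have hw2 : ∀ p ∈ T, ∀ h ∈ Ici (0 : ℝ), 2 ≤ w p h := fun p hp h _ => hm.two_le_weight hp.1 h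
  have hid : WeightSmooth T (Ici 0) w k (fun _ h => h) :=
    WeightSmooth.linear hw2 (fun p hp h _ => hm.norm_le_weight hp.1 h) (ContinuousLinearMap.id ℝ ℝ)
  have hz : WeightSmooth T (Ici 0) w k (fun p _ => p.2) := by
    refine WeightSmooth.param continuousOn_snd ?_
    obtain ⟨N, hN⟩ := exists_le_weight_pow hw2 R
    refine ⟨N, fun p hp h hh => le_trans ?_ (hN p hp h hh)⟩
    rw [Real.norm_eq_abs, abs_of_pos (hδ.trans_le hp.2.1)]
    exact hp.2.2
  have hzi : WeightSmooth T (Ici 0) w k (fun p _ => p.2⁻¹) := by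
    refine WeightSmooth.param (continuousOn_snd.inv₀ fun p hp => (hδ.trans_le hp.2.1).ne') ?_
    obtain ⟨N, hN⟩ := exists_le_weight_pow hw2 δ⁻¹
    refine ⟨N, fun p hp h hh => le_trans ?_ (hN p hp h hh)⟩
    have hp2 : 0 < p.2 := hδ.trans_le hp.2.1
    rw [Real.norm_eq_abs, abs_of_pos (inv_pos.2 hp2)]
    exact inv_anti₀ hδ hp.2.1
  have hGp : WeightSmooth T (Ici 0) w k (fun p h => G p.1 h) :=
    WeightSmooth.comp (φ := Prod.fst) hG hid hw2 hw0 continuousOn_fst (fun p hp => hp.1)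
      (fun p hp h hh => hh) ⟨1, fun p hp h hh => by rw [pow_one]⟩
  have hinner : WeightSmooth T (Ici 0) w k (fun p h => ((p.2, h / p.2) : ℝ × ℝ)) :=
    ((hz.clm hw2 (ContinuousLinearMap.inl ℝ ℝ ℝ)).add hw2
      ((hid.mul hw2 hzi).clm hw2 (ContinuousLinearMap.inr ℝ ℝ ℝ))).congr fun p hp h hh => by
        simp [div_eq_mul_inv]
  have hf1 : WeightSmooth T (Ici 0) w k (fun p h => f (p.2, h / p.2)) :=
    WeightSmooth.comp (φ := fun _ => ()) (hf.weightSmooth hfk) hinner hw2 (fun _ _ _ _ => le_rfl)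
      continuousOn_const (fun _ _ => mem_univ _)
      (fun p hp h hh => ⟨(hδ.trans_le hp.2.1).le, div_nonneg hh (hδ.trans_le hp.2.1).le⟩)
      ⟨1, fun p hp h hh => by rw [pow_one]; exact hw2 p hp h hh⟩
  have hGb : ∀ p ∈ T, ∀ h ∈ Ici (0 : ℝ), |G p.1 h| ≤ m p.1 := fun p hp h hh => hm.abs_le _ _ hp.1 hh
  have h2G : WeightSmooth T (Ici 0) w k (fun p h => 2 * G p.1 h) :=
    (WeightSmooth.const hw2 (2 : ℝ)).mul hw2 hGp
  have he1 : WeightSmooth T (Ici 0) w k (fun p h => Real.exp (-(2 * G p.1 h))) := by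
    refine (h2G.neg hw2).exp hw2 ⟨2, fun p hp h hh => StrainBound.exp_mul_le_weight_pow h 2 ?_⟩
    have := (abs_le.1 (hGb p hp h hh)).1
    push_cast
    linarith
  have he2 : WeightSmooth T (Ici 0) w k (fun p h => Real.exp (2 * G p.1 h)) := by
    refine h2G.exp hw2 ⟨2, fun p hp h hh => StrainBound.exp_mul_le_weight_pow h 2 ?_⟩
    have := (abs_le.1 (hGb p hp h hh)).2
    push_cast
    linarith
  have hden : WeightSmooth T (Ici 0) w k
      (fun p h => p.2 ^ 4 * Real.exp (-(2 * G p.1 h)) + h ^ 2 * Real.exp (2 * G p.1 h)) := by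
    refine ((((hz.mul hw2 hz).mul hw2 (hz.mul hw2 hz)).mul hw2 he1).add hw2
      ((hid.mul hw2 hid).mul hw2 he2)).congr fun p hp h hh => by ring
  have hinv := hden.inv hw2 (fun p hp h hh =>
    (Profile.denom_pos (hδ.trans_le hp.2.1) h (G p.1 h)).ne') (by
      obtain ⟨N, hN⟩ := exists_le_weight_pow hw2 (δ ^ 4)⁻¹
      refine ⟨N + 2, fun p hp h hh => ?_⟩
      have hpos := Profile.denom_pos (hδ.trans_le hp.2.1) h (G p.1 h)
      have hlow := hf.denom_lower hp.2.1 h (G p.1 h)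
      have hex : Real.exp (2 * G p.1 h) ≤ w p h ^ 2 :=
        StrainBound.exp_mul_le_weight_pow h 2 (by
          have := (abs_le.1 (hGb p hp h hh)).2
          push_cast
          linarith)
      rw [abs_of_pos (inv_pos.2 hpos), pow_add]
      calc (p.2 ^ 4 * Real.exp (-(2 * G p.1 h)) + h ^ 2 * Real.exp (2 * G p.1 h))⁻¹
          ≤ (δ ^ 4 * Real.exp (-(2 * G p.1 h)))⁻¹ := by
            refine inv_anti₀ (by positivity) (le_trans ?_ hlow)
            exact mul_le_mul_of_nonneg_left (le_add_of_nonneg_right (by positivity)) (by positivity)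
        _ = (δ ^ 4)⁻¹ * Real.exp (2 * G p.1 h) := by rw [mul_inv, ← Real.exp_neg, neg_neg]
        _ ≤ w p h ^ N * w p h ^ 2 :=
            mul_le_mul (hN p hp h hh) hex (Real.exp_pos _).le
              (pow_nonneg (by linarith [hw2 p hp h hh]) _))
  have hker := hf1.mul hw2 (hz.mul hw2 hinv)
  exact WeightSmooth.intervalIntegral (a := fun p h => kernel f p.2 h (G p.1 h))
    hf.delta_le_radius (convex_Ici 0) hw0 hker

/-- Rescaling time to s = tz with z in [0, 1] gives a fixed interval of integration. Monotonicity of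
m makes earlier weights no larger than the one at t, and t ≤ m(t) absorbs the factor t. -/
theorem weightSmooth_time_integral (hm : StrainBound G m) {k : ℕ} {b : ℝ → ℝ → ℝ}
    (hb : WeightSmooth (Ici (0 : ℝ)) (Ici (0 : ℝ)) (weight m) k b) :
    WeightSmooth (Ici (0 : ℝ)) (Ici (0 : ℝ)) (weight m) k (fun t η => ∫ s in (0 : ℝ)..t, b s η) := by
  have hw0 : ∀ t ∈ Ici (0 : ℝ), ∀ h ∈ Ici (0 : ℝ), 2 ≤ weight m t h := fun t ht h _ =>
    hm.two_le_weight ht h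
  set T : Set (ℝ × ℝ) := Ici (0 : ℝ) ×ˢ Icc 0 1 with hT
  set w : ℝ × ℝ → ℝ → ℝ := fun p h => weight m p.1 h with hw
  have hw2 : ∀ p ∈ T, ∀ h ∈ Ici (0 : ℝ), 2 ≤ w p h := fun p hp h _ => hm.two_le_weight hp.1 h
  have hid : WeightSmooth T (Ici 0) w k (fun _ h => h) :=
    WeightSmooth.linear hw2 (fun p hp h _ => hm.norm_le_weight hp.1 h) (ContinuousLinearMap.id ℝ ℝ)
  have hb' : WeightSmooth T (Ici 0) w k (fun p h => b (p.1 * p.2) h) := by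
    refine WeightSmooth.comp (φ := fun p => p.1 * p.2) hb hid hw2 hw0 (by fun_prop)
      (fun p hp => mul_nonneg hp.1 hp.2.1) (fun p hp h hh => hh) ⟨1, fun p hp h hh => ?_⟩
    rw [pow_one]
    have : m (p.1 * p.2) ≤ m p.1 := hm.mono (mul_nonneg hp.1 hp.2.1 : (0 : ℝ) ≤ p.1 * p.2) hp.1
      (mul_le_of_le_one_right hp.1 hp.2.2)
    simp only [hw, weight]
    gcongr
  have ht : WeightSmooth (Ici (0 : ℝ)) (Ici (0 : ℝ)) (weight m) k (fun t _ => t) := by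
    refine WeightSmooth.param continuousOn_id ⟨1, fun t ht h hh => ?_⟩
    change |t| ≤ _
    rw [pow_one, abs_of_nonneg ht]
    refine le_trans ?_ (StrainBound.exp_le_weight t h)
    linarith [hm.le_self t ht, Real.add_one_le_exp (m t)]
  refine (ht.mul hw0 (hb'.intervalIntegral zero_le_one (convex_Ici 0) hw0)).congr fun t ht η hη => ?_
  have := intervalIntegral.smul_integral_comp_mul_left (a := 0) (b := 1) (fun s => b s η) t
  simpa using this.symm

/-- The variable η enters the strain equation only as a lower limit, so the derivative is a boundary
term and involves no derivative of G. -/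
theorem hasDerivWithinAt_strain (hf : Profile f δ R B)
    (hG : IsStrain (strainDensity f δ R) (R ^ 2 + 1) G) {t η : ℝ} (ht : 0 ≤ t) (hη : 0 ≤ η) :
    HasDerivWithinAt (G t) (-∫ s in (0 : ℝ)..t, strainDensity f δ R η (G s η)) (Ici 0) η := by
  have hF := hf.isDensity
  have hc : ∀ s, Continuous fun h => strainDensity f δ R h (G s h) := hF.continuous_section hG.continuous
  have hc2 : Continuous (Function.uncurry fun s h => strainDensity f δ R h (G s h)) :=
    hF.continuous.comp (continuous_snd.prodMk hG.continuous)
  have hd : ∀ s η, HasDerivAt (fun η => ∫ h in η..(R ^ 2 + 1), strainDensity f δ R h (G s h))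
      (-strainDensity f δ R η (G s η)) η := fun s η =>
    intervalIntegral.integral_hasDerivAt_left ((hc s).intervalIntegrable _ _)
      (hc s).aestronglyMeasurable.stronglyMeasurableAtFilter (hc s).continuousAt
  have hcs : Continuous fun s => strainDensity f δ R η (G s η) :=
    hc2.comp (by fun_prop : Continuous fun s : ℝ => (s, η))
  have hcb : Continuous (Function.uncurry fun s η =>
      ContinuousLinearMap.toSpanSingleton ℝ (-strainDensity f δ R η (G s η))) :=
    (ContinuousLinearMap.toSpanSingletonCLE (𝕜 := ℝ) (E := ℝ)).continuous.comp hc2.neg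
  have key := hasFDerivWithinAt_intervalIntegral (S := Ici (0 : ℝ)) ht (convex_Ici 0)
    (a := fun s η => ∫ h in η..(R ^ 2 + 1), strainDensity f δ R h (G s h))
    (hF.continuous_rate hG.continuous).continuousOn hcb.continuousOn
    (fun s _ η _ => (hd s η).hasFDerivAt.hasFDerivWithinAt) hη
  have e : (∫ s in (0 : ℝ)..t,
      ContinuousLinearMap.toSpanSingleton ℝ (-strainDensity f δ R η (G s η))) 1 =
      -∫ s in (0 : ℝ)..t, strainDensity f δ R η (G s η) := by
    rw [ContinuousLinearMap.intervalIntegral_apply]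
    · simp
    · exact (hcb.comp (by fun_prop : Continuous fun s : ℝ => (s, η))).intervalIntegrable _ _
  have key' := key.hasDerivWithinAt
  rw [e] at key'
  exact key'.congr (fun η hη => hG.equation hF ht hη) (hG.equation hF ht hη)

/-- Bootstrap: order k for G gives order k for ∂G/∂η, hence order k + 1 for G, as long as f has k
derivatives. -/
theorem weightSmooth_strain (hf : Profile f δ R B)
    (hG : IsStrain (strainDensity f δ R) (R ^ 2 + 1) G) (hm : StrainBound G m) {n : ℕ}
    (hfn : ContDiffOn ℝ n f quadrant) :
    WeightSmooth (Ici (0 : ℝ)) (Ici (0 : ℝ)) (weight m) n G := by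
  have hw0 : ∀ t ∈ Ici (0 : ℝ), ∀ h ∈ Ici (0 : ℝ), 2 ≤ weight m t h := fun t ht h _ =>
    hm.two_le_weight ht h
  have h0 : WeightBounded (Ici (0 : ℝ)) (Ici (0 : ℝ)) (weight m) G := by
    refine ⟨hG.continuous.continuousOn, 1, fun t ht η hη => ?_⟩
    rw [pow_one]
    refine (hm.abs_le t η ht hη).trans (le_trans ?_ (StrainBound.exp_le_weight t η))
    linarith [Real.add_one_le_exp (m t)]
  have key : ∀ k ≤ n, WeightSmooth (Ici (0 : ℝ)) (Ici (0 : ℝ)) (weight m) k G := by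
    intro k
    induction k with
    | zero => exact fun _ => h0
    | succ k ih =>
      intro hk
      have h1 := weightSmooth_time_integral hm (weightSmooth_strainDensity hf hm
        (hfn.of_le (by exact_mod_cast (Nat.le_succ k).trans hk)) (ih (by omega)))
      exact ⟨h0, _, (h1.neg hw0).clm hw0
        (ContinuousLinearMap.toSpanSingletonCLE (𝕜 := ℝ) (E := ℝ)).toContinuousLinearMap,
        fun t ht η hη => (hasDerivWithinAt_strain hf hG ht hη).hasFDerivWithinAt⟩
  exact key n le_rfl

theorem weightSmooth_vorticity (hf : Profile f δ R B)
    (hG : IsStrain (strainDensity f δ R) (R ^ 2 + 1) G) (hm : StrainBound G m) {n : ℕ}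
    (hfn : ContDiffOn ℝ n f quadrant) :
    WeightSmooth (Ici (0 : ℝ)) quadrant (weight m) n (fun t x => f (strainMap (G t) x)) := by
  have hw : ∀ t ∈ Ici (0 : ℝ), ∀ h ∈ Ici (0 : ℝ), 2 ≤ weight m t h := fun t ht h _ =>
    hm.two_le_weight ht h
  have hw2 : ∀ t ∈ Ici (0 : ℝ), ∀ x ∈ quadrant, 2 ≤ weight m t x := fun t ht x _ =>
    hm.two_le_weight ht x
  have hx : ∀ t ∈ Ici (0 : ℝ), ∀ x ∈ quadrant, ‖x‖ ≤ weight m t x := fun t ht x _ =>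
    hm.norm_le_weight ht x
  have h1 : WeightSmooth (Ici (0 : ℝ)) quadrant (weight m) n (fun _ x => x.1) :=
    WeightSmooth.linear hw2 hx (ContinuousLinearMap.fst ℝ ℝ ℝ)
  have h2 : WeightSmooth (Ici (0 : ℝ)) quadrant (weight m) n (fun _ x => x.2) :=
    WeightSmooth.linear hw2 hx (ContinuousLinearMap.snd ℝ ℝ ℝ)
  have hGx : WeightSmooth (Ici (0 : ℝ)) quadrant (weight m) n (fun t x => G t (x.1 * x.2)) := by
    refine WeightSmooth.comp (φ := id) (weightSmooth_strain hf hG hm hfn) (h1.mul hw2 h2) hw2 hw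
      continuousOn_id (fun t ht => ht) (fun t ht x hx => mul_nonneg hx.1 hx.2)
      ⟨2, fun t ht x hx => ?_⟩
    have e0 := Real.one_le_exp (hm.nonneg ht)
    have e1 : ‖x.1 * x.2‖ ≤ ‖x‖ ^ 2 := by
      rw [norm_mul, pow_two]
      exact mul_le_mul (norm_fst_le x) (norm_snd_le x) (norm_nonneg _) (norm_nonneg _)
    have e2 : 2 + ‖x.1 * x.2‖ ≤ (2 + ‖x‖) ^ 2 := by nlinarith [norm_nonneg x]
    simp only [weight, id, mul_pow]
    refine mul_le_mul ?_ e2 (by positivity) (by positivity)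
    rw [pow_two]
    exact le_mul_of_one_le_left (Real.exp_pos _).le e0
  have hb : ∀ t ∈ Ici (0 : ℝ), ∀ x ∈ quadrant, |G t (x.1 * x.2)| ≤ m t := fun t ht x hx =>
    hm.abs_le _ _ ht (mul_nonneg hx.1 hx.2)
  have e1 := hGx.exp hw2 ⟨1, fun t ht x hx => StrainBound.exp_mul_le_weight_pow x 1 (by
    have := (abs_le.1 (hb t ht x hx)).2
    push_cast
    linarith)⟩
  have e2 := (hGx.neg hw2).exp hw2 ⟨1, fun t ht x hx => StrainBound.exp_mul_le_weight_pow x 1 (by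
    have := (abs_le.1 (hb t ht x hx)).1
    push_cast
    linarith)⟩
  have hψ : WeightSmooth (Ici (0 : ℝ)) quadrant (weight m) n (fun t x => strainMap (G t) x) :=
    (((h1.mul hw2 e1).clm hw2 (ContinuousLinearMap.inl ℝ ℝ ℝ)).add hw2
      ((h2.mul hw2 e2).clm hw2 (ContinuousLinearMap.inr ℝ ℝ ℝ))).congr fun t ht x hx => by
        simp [strainMap]
  exact WeightSmooth.comp (φ := fun _ => ()) (hf.weightSmooth hfn) hψ hw2 (fun _ _ _ _ => le_rfl)
    continuousOn_const (fun _ _ => mem_univ _) (fun t ht x hx => strainMap_mem.2 hx)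
    ⟨1, fun t ht x hx => by rw [pow_one]; exact hw2 t ht x hx⟩

end Strain

end

/-! ### The transported vorticity is a solution. -/

noncomputable section

/-- The initial vorticity `f` transported by the strain `G`. -/
def vorticity (f : ℝ × ℝ → ℝ) (G : ℝ → ℝ → ℝ) (t : ℝ) (x : ℝ × ℝ) : ℝ := f (strainMap (G t) x)

namespace Profile

variable {f : ℝ × ℝ → ℝ} {δ R B : ℝ}

theorem suppD_subset (hf : Profile f δ R B) : suppD f ⊆ Icc δ R ×ˢ Icc 0 R := by
  refine closure_minimal (fun x hx => ?_) (isClosed_Icc.prod isClosed_Icc)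
  have h := hf.supp x hx.1 hx.2
  exact ⟨⟨h.1.le, h.2.1⟩, hx.1.2, h.2.2⟩

theorem isCompact_suppD (hf : Profile f δ R B) : IsCompact (suppD f) :=
  (isCompact_Icc.prod isCompact_Icc).of_isClosed_subset isClosed_closure hf.suppD_subset

theorem le_delta (hf : Profile f δ R B) : ENNReal.ofReal δ ≤ delta f :=
  le_iInf₂ fun _ hx => ENNReal.ofReal_le_ofReal (hf.suppD_subset hx).1.1

theorem delta_inv_le (hf : Profile f δ R B) : (delta f)⁻¹ ≤ ENNReal.ofReal δ⁻¹ := by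
  rw [ENNReal.ofReal_inv_of_pos hf.delta_pos]
  exact ENNReal.inv_le_inv.2 hf.le_delta

theorem memK (hf : Profile f δ R B) {n : ℕ} (hfn : ContDiffOn ℝ n f quadrant) : MemK n f where
  contDiffOn := hfn
  isCompact_supp := hf.isCompact_suppD
  delta_pos := (ENNReal.ofReal_pos.2 hf.delta_pos).trans_le hf.le_delta

end Profile

theorem derivSup_le {k : ℕ} {g : ℝ × ℝ → ℝ} {C : ℝ}
    (h : ∀ x ∈ quadrant, ‖iteratedFDerivWithin ℝ k g quadrant x‖ ≤ C) :
    derivSup k g ≤ ENNReal.ofReal C := by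
  refine iSup₂_le fun x hx => ?_
  rw [← ofReal_norm]
  exact ENNReal.ofReal_le_ofReal (h x hx)

theorem iteratedFDerivWithin_eq_zero {E F : Type} [NormedAddCommGroup E] [NormedSpace ℝ E]
    [NormedAddCommGroup F] [NormedSpace ℝ F] {S K : Set E} (hK : IsClosed K) {f : E → F}
    (hf : ∀ x ∈ S, x ∉ K → f x = 0) {x : E} (hxS : x ∈ S) (hx : x ∉ K) (k : ℕ) :
    iteratedFDerivWithin ℝ k f S x = 0 := by
  have h := eventuallyEq_zero_of_notMem hK hf hx
  rw [h.iteratedFDerivWithin_eq (hf x hxS hx) k]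
  rw [iteratedFDerivWithin_fun_zero]
  rfl

/-- The bounds `C e ^ (C m(t))` for `t ≥ 0`. -/
def ExpBounded (m : ℝ → ℝ) (φ : ℝ → ℝ≥0∞) : Prop :=
  ∃ C : ℝ, 0 ≤ C ∧ ∀ t, 0 ≤ t → φ t ≤ ENNReal.ofReal (C * Real.exp (C * m t))

theorem ExpBounded.add {m : ℝ → ℝ} (hm : ∀ t, 0 ≤ t → 0 ≤ m t) {φ ψ : ℝ → ℝ≥0∞}
    (hφ : ExpBounded m φ) (hψ : ExpBounded m ψ) : ExpBounded m fun t => φ t + ψ t := by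
  obtain ⟨C, hC, hC'⟩ := hφ
  obtain ⟨D, hD, hD'⟩ := hψ
  refine ⟨C + D, add_nonneg hC hD, fun t ht => (add_le_add (hC' t ht) (hD' t ht)).trans ?_⟩
  rw [← ENNReal.ofReal_add (by positivity) (by positivity)]
  refine ENNReal.ofReal_le_ofReal ?_
  have hmt := hm t ht
  have e1 : Real.exp (C * m t) ≤ Real.exp ((C + D) * m t) := Real.exp_le_exp.2 (by nlinarith)
  have e2 : Real.exp (D * m t) ≤ Real.exp ((C + D) * m t) := Real.exp_le_exp.2 (by nlinarith)
  nlinarith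

theorem ExpBounded.sum {m : ℝ → ℝ} (hm : ∀ t, 0 ≤ t → 0 ≤ m t) {φ : ℕ → ℝ → ℝ≥0∞}
    {s : Finset ℕ} (h : ∀ k ∈ s, ExpBounded m (φ k)) : ExpBounded m fun t => ∑ k ∈ s, φ k t := by
  classical
  induction s using Finset.induction_on with
  | empty => exact ⟨0, le_rfl, fun t _ => by simp⟩
  | insert a s ha ih =>
    simp_rw [Finset.sum_insert ha]
    exact (h a (Finset.mem_insert_self a s)).add hm
      (ih fun k hk => h k (Finset.mem_insert_of_mem hk))

section Solution

variable {f : ℝ × ℝ → ℝ} {δ R B : ℝ} {G : ℝ → ℝ → ℝ} {m : ℝ → ℝ}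

theorem IsStrain.continuous_slice {F : ℝ → ℝ → ℝ} {H : ℝ} (hG : IsStrain F H G) (t : ℝ) :
    Continuous (G t) :=
  hG.continuous.comp (by fun_prop : Continuous fun h : ℝ => (t, h))

theorem profile_vorticity (hf : Profile f δ R B)
    (hG : IsStrain (strainDensity f δ R) (R ^ 2 + 1) G) (hm : StrainBound G m) {t : ℝ}
    (ht : 0 ≤ t) :
    Profile (vorticity f G t) (δ * Real.exp (-m t)) (R * Real.exp (m t)) B :=
  hf.comp_strainMap (hG.continuous_slice t) (hm.nonneg ht) fun h hh => hm.abs_le t h ht hh.1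

/-- A square containing the support of the vorticity up to time `T`. -/
def supportBox (R : ℝ) (m : ℝ → ℝ) (T : ℝ) : Set (ℝ × ℝ) :=
  Icc 0 (R * Real.exp (m T)) ×ˢ Icc 0 (R * Real.exp (m T))

theorem isCompact_supportBox (R : ℝ) (m : ℝ → ℝ) (T : ℝ) : IsCompact (supportBox R m T) :=
  isCompact_Icc.prod isCompact_Icc

theorem supportBox_subset (R : ℝ) (m : ℝ → ℝ) (T : ℝ) : supportBox R m T ⊆ quadrant :=
  fun _ hx => ⟨hx.1.1, hx.2.1⟩

theorem vorticity_eq_zero (hf : Profile f δ R B)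
    (hG : IsStrain (strainDensity f δ R) (R ^ 2 + 1) G) (hm : StrainBound G m) {t T : ℝ}
    (ht : 0 ≤ t) (htT : t ≤ T) (x : ℝ × ℝ) (hx : x ∈ quadrant) (hxb : x ∉ supportBox R m T) :
    vorticity f G t x = 0 := by
  by_contra hne
  have h := (profile_vorticity hf hG hm ht).supp x hx hne
  have hR := hf.one_le_radius
  have : R * Real.exp (m t) ≤ R * Real.exp (m T) := by
    have := hm.mono ht (ht.trans htT) htT
    gcongr
  exact hxb ⟨⟨hx.1, h.2.1.trans this⟩, hx.2, h.2.2.trans this⟩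

theorem contDiffOn_vorticity (hf : Profile f δ R B)
    (hG : IsStrain (strainDensity f δ R) (R ^ 2 + 1) G) (hm : StrainBound G m) {n : ℕ}
    (hfn : ContDiffOn ℝ n f quadrant) {t : ℝ} (ht : 0 ≤ t) :
    ContDiffOn ℝ n (vorticity f G t) quadrant :=
  (weightSmooth_vorticity hf hG hm hfn).contDiffOn uniqueDiffOn_quadrant ht

theorem suppD_vorticity {F : ℝ → ℝ → ℝ} {H : ℝ} (hG : IsStrain F H G) (f : ℝ × ℝ → ℝ) (t : ℝ) :
    suppD (vorticity f G t) = strainMap (G t) ⁻¹' suppD f :=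
  suppD_comp_strainMap (hG.continuous_slice t) f

theorem volume_suppD_vorticity (hf : Profile f δ R B) {F : ℝ → ℝ → ℝ} {H : ℝ}
    (hG : IsStrain F H G) (t : ℝ) : volume (suppD (vorticity f G t)) = volume (suppD f) := by
  rw [suppD_vorticity hG]
  exact volume_preimage_strainMap (hG.continuous_slice t) isClosed_closure.measurableSet
    fun x hx => hf.delta_pos.trans_le (hf.suppD_subset hx).1.1

/-- The support at time t is the image of the initial support under the inverse strain map. So δ is
an infimum over a fixed compact set of a jointly continuous function, and such an infimum is
continuous in the parameter. -/
theorem continuous_delta_vorticity (hf : Profile f δ R B) {F : ℝ → ℝ → ℝ} {H : ℝ}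
    (hG : IsStrain F H G) : Continuous fun t => (delta (vorticity f G t))⁻¹ := by
  have hGc := hG.continuous
  set φ : ℝ → ℝ × ℝ → ℝ≥0∞ := fun t y => ENNReal.ofReal (strainMap (fun h => -G t h) y).1 with hφ
  have hc : Continuous (Function.uncurry φ) := by
    refine ENNReal.continuous_ofReal.comp ?_
    have : Continuous fun q : ℝ × ℝ × ℝ => G q.1 (q.2.1 * q.2.2) :=
      hGc.comp (by fun_prop : Continuous fun q : ℝ × ℝ × ℝ => (q.1, q.2.1 * q.2.2))
    simp only [strainMap]
    fun_prop
  have he : (fun t => (delta (vorticity f G t))) = fun t => sInf (φ t '' suppD f) := by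
    ext t
    rw [sInf_image, delta, suppD_vorticity hG]
    apply le_antisymm
    · refine le_iInf₂ fun y hy => ?_
      have hy' : strainMap (fun h => -G t h) y ∈ strainMap (G t) ⁻¹' suppD f := by
        have := (strainHomeo (G t) (hG.continuous_slice t)).apply_symm_apply y
        change strainMap (G t) (strainMap (fun h => -G t h) y) ∈ suppD f
        rwa [show strainMap (G t) (strainMap (fun h => -G t h) y) = y from this]
      exact iInf₂_le (strainMap (fun h => -G t h) y) hy'
    · refine le_iInf₂ fun x hx => ?_
      refine (iInf₂_le (strainMap (G t) x) hx).trans (le_of_eq ?_)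
      simp only [hφ, strainMap_neg_strainMap]
  have h1 : Continuous fun t => delta (vorticity f G t) := by
    rw [he]
    exact hf.isCompact_suppD.continuous_sInf hc
  exact h1.inv

/-- On the support |x| ≤ R e^m, so there the weight is at most (2 + R) e^(2m), and a power of it is
exponential in m. -/
theorem expBounded_derivSup (hf : Profile f δ R B)
    (hG : IsStrain (strainDensity f δ R) (R ^ 2 + 1) G) (hm : StrainBound G m) {n k : ℕ}
    (hfn : ContDiffOn ℝ n f quadrant) (hk : k ≤ n) :
    ExpBounded m fun t => derivSup k (vorticity f G t) := by
  have hR := hf.one_le_radius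
  obtain ⟨N, hN⟩ := ((weightSmooth_vorticity hf hG hm hfn).weightBounded_iteratedFDerivWithin
    uniqueDiffOn_quadrant hk).bound
  refine ⟨(2 + R) ^ N + 2 * N, by positivity, fun t ht => derivSup_le fun x hx => ?_⟩
  have hmt := hm.nonneg ht
  have hpos : 0 ≤ ((2 + R) ^ N + 2 * N) * Real.exp (((2 + R) ^ N + 2 * N) * m t) := by positivity
  by_cases hxb : x ∈ supportBox R m t
  · refine (hN t ht x hx).trans ?_
    have e1 : ‖x‖ ≤ R * Real.exp (m t) := by
      rw [Prod.norm_def, Real.norm_eq_abs, Real.norm_eq_abs, abs_of_nonneg hx.1, abs_of_nonneg hx.2]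
      exact max_le hxb.1.2 hxb.2.2
    have e2 : weight m t x ≤ (2 + R) * Real.exp (2 * m t) := by
      have h1 := Real.one_le_exp hmt
      rw [two_mul, Real.exp_add]
      unfold weight
      nlinarith [Real.exp_pos (m t)]
    have e3 : Real.exp (2 * m t) ^ N = Real.exp (2 * N * m t) := by
      rw [← Real.exp_nat_mul]; congr 1; ring
    have e4 : (0 : ℝ) ≤ (2 + R) ^ N := by positivity
    calc weight m t x ^ N ≤ ((2 + R) * Real.exp (2 * m t)) ^ N :=
          pow_le_pow_left₀ (by linarith [hm.two_le_weight ht x]) e2 N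
      _ = (2 + R) ^ N * Real.exp (2 * N * m t) := by rw [mul_pow, e3]
      _ ≤ _ := by
          refine mul_le_mul (le_add_of_nonneg_right (by positivity)) (Real.exp_le_exp.2 ?_)
            (Real.exp_pos _).le (by positivity)
          exact mul_le_mul_of_nonneg_right (le_add_of_nonneg_left e4) hmt
  · rw [iteratedFDerivWithin_eq_zero (isCompact_supportBox R m t).isClosed
      (vorticity_eq_zero hf hG hm ht le_rfl) hx hxb, norm_zero]
    exact hpos

theorem expBounded_kNorm (hf : Profile f δ R B)
    (hG : IsStrain (strainDensity f δ R) (R ^ 2 + 1) G) (hm : StrainBound G m) {n : ℕ}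
    (hfn : ContDiffOn ℝ n f quadrant) : ExpBounded m fun t => kNorm n (vorticity f G t) := by
  have hm0 : ∀ t, 0 ≤ t → 0 ≤ m t := fun t ht => hm.nonneg ht
  have hδ := hf.delta_pos
  have hvol : volume (suppD f) ≠ ∞ := hf.isCompact_suppD.measure_lt_top.ne
  refine ((ExpBounded.sum hm0 fun k hk => expBounded_derivSup hf hG hm hfn
    (Nat.lt_succ_iff.1 (Finset.mem_range.1 hk))).add hm0 ?_).add hm0 ?_
  · refine ⟨(volume (suppD f)).toReal, ENNReal.toReal_nonneg, fun t ht => ?_⟩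
    beta_reduce
    rw [volume_suppD_vorticity hf hG]
    refine ENNReal.le_ofReal_iff_toReal_le hvol (by positivity) |>.2 ?_
    exact le_mul_of_one_le_right ENNReal.toReal_nonneg
      (Real.one_le_exp (mul_nonneg ENNReal.toReal_nonneg (hm0 t ht)))
  · refine ⟨δ⁻¹, by positivity, fun t ht => (profile_vorticity hf hG hm ht).delta_inv_le.trans
      (ENNReal.ofReal_le_ofReal ?_)⟩
    rw [mul_inv, ← Real.exp_neg, neg_neg]
    have : m t ≤ δ⁻¹ * m t := le_mul_of_one_le_left (hm0 t ht) (one_le_inv₀ hδ |>.2 hf.delta_le_one)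
    gcongr

/-- The derivatives are jointly continuous, and all supports up to time t + 1 lie in one compact
box, so convergence is uniform in x. -/
theorem tendsto_cNorm_vorticity (hf : Profile f δ R B)
    (hG : IsStrain (strainDensity f δ R) (R ^ 2 + 1) G) (hm : StrainBound G m) {n : ℕ}
    (hfn : ContDiffOn ℝ n f quadrant) {t : ℝ} (ht : 0 ≤ t) :
    Tendsto (fun s => cNorm n (fun x => vorticity f G s x - vorticity f G t x)) (𝓝[Ici 0] t)
      (𝓝 0) := by
  have key : ∀ k ∈ Finset.range (n + 1), Tendsto (fun s => derivSup k
      (fun x => vorticity f G s x - vorticity f G t x)) (𝓝[Ici 0] t) (𝓝 0) := by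
    intro k hk
    have hkn : k ≤ n := Nat.lt_succ_iff.1 (Finset.mem_range.1 hk)
    have hfk : ContDiffOn ℝ k f quadrant := hfn.of_le (by exact_mod_cast hkn)
    have hA := ((weightSmooth_vorticity hf hG hm hfn).weightBounded_iteratedFDerivWithin
      uniqueDiffOn_quadrant hkn).continuousOn
    rw [ENNReal.tendsto_nhds_zero]
    intro ε hε
    obtain ⟨r, hr0, hr⟩ := ENNReal.lt_iff_exists_nnreal_btwn.1 hε
    have hr0' : (0 : ℝ) < r := by exact_mod_cast hr0
    have hK := isCompact_supportBox R m (t + 1)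
    have hev := eventually_forall_compact_dist_lt hK (U := Ici 0)
      (f := fun s x => iteratedFDerivWithin ℝ k (vorticity f G s) quadrant x)
      (hA.mono (prod_mono le_rfl (supportBox_subset R m (t + 1)))) ht hr0'
    have hlt : ∀ᶠ s in 𝓝[Ici 0] t, s ≤ t + 1 :=
      mem_nhdsWithin_of_mem_nhds (Iic_mem_nhds (by linarith))
    filter_upwards [hev, hlt, self_mem_nhdsWithin] with s hs hst hs0
    refine le_trans ?_ hr.le
    rw [← ENNReal.ofReal_coe_nnreal]
    refine derivSup_le fun x hx => ?_
    by_cases hxb : x ∈ supportBox R m (t + 1)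
    · have e : iteratedFDerivWithin ℝ k (fun x => vorticity f G s x - vorticity f G t x) quadrant x =
          iteratedFDerivWithin ℝ k (vorticity f G s) quadrant x -
            iteratedFDerivWithin ℝ k (vorticity f G t) quadrant x :=
        iteratedFDerivWithin_sub_apply (contDiffOn_vorticity hf hG hm hfk hs0 x hx)
          (contDiffOn_vorticity hf hG hm hfk ht x hx) uniqueDiffOn_quadrant hx
      rw [e]
      exact (hs x hxb).le
    · rw [iteratedFDerivWithin_eq_zero hK.isClosed (fun y hy hyb => by
        rw [vorticity_eq_zero hf hG hm hs0 hst y hy hyb,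
          vorticity_eq_zero hf hG hm ht (by linarith) y hy hyb, sub_zero]) hx hxb, norm_zero]
      exact r.2
  simpa [cNorm] using tendsto_finsetSum _ key

theorem vorticity_zero (hf : Profile f δ R B)
    (hG : IsStrain (strainDensity f δ R) (R ^ 2 + 1) G) {x : ℝ × ℝ} (hx : x ∈ quadrant) :
    vorticity f G 0 x = f x := by
  have : G 0 (x.1 * x.2) = 0 := by
    rw [hG.equation hf.isDensity le_rfl (mul_nonneg hx.1 hx.2), intervalIntegral.integral_same]
  simp [vorticity, strainMap, this]

theorem hasDerivAt_hyperbola (x : ℝ × ℝ) (σ : ℝ) :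
    HasDerivAt (fun σ : ℝ => (x.1 * Real.exp σ, x.2 * Real.exp (-σ)))
      (x.1 * Real.exp σ, -(x.2 * Real.exp (-σ))) σ := by
  have h1 : HasDerivAt (fun σ : ℝ => x.1 * Real.exp σ) (x.1 * Real.exp σ) σ :=
    (Real.hasDerivAt_exp σ).const_mul _
  have h2 : HasDerivAt (fun σ : ℝ => x.2 * Real.exp (-σ)) (-(x.2 * Real.exp (-σ))) σ := by
    have := ((hasDerivAt_id σ).neg.exp).const_mul x.2
    simpa using this
  exact h1.prodMk h2

theorem hyperbola_mem {x : ℝ × ℝ} (hx : x ∈ quadrant) (σ : ℝ) :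
    ((x.1 * Real.exp σ, x.2 * Real.exp (-σ)) : ℝ × ℝ) ∈ quadrant :=
  ⟨mul_nonneg hx.1 (Real.exp_pos _).le, mul_nonneg hx.2 (Real.exp_pos _).le⟩

theorem hasDerivAt_along_hyperbola {g : ℝ × ℝ → ℝ} (hg : DifferentiableOn ℝ g quadrant) {x : ℝ × ℝ}
    (hx : x ∈ quadrant) (σ : ℝ) :
    HasDerivAt (fun σ : ℝ => g (x.1 * Real.exp σ, x.2 * Real.exp (-σ)))
      (fderivWithin ℝ g quadrant (x.1 * Real.exp σ, x.2 * Real.exp (-σ))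
        (x.1 * Real.exp σ, -(x.2 * Real.exp (-σ)))) σ := by
  have h1 := (hg _ (hyperbola_mem hx σ)).hasFDerivWithinAt
  rw [← hasDerivWithinAt_univ]
  exact h1.comp_hasDerivWithinAt (t := quadrant) σ (hasDerivAt_hyperbola x σ).hasDerivWithinAt
    fun σ _ => hyperbola_mem hx σ

/-- With q the profile along the hyperbola through x, the value at time t is q(G(t, η)), and moving
x by σ along the hyperbola gives q(G(t, η) + σ). Hence the derivative in the direction (x₁, -x₂) is
q'(G), while the time derivative is q'(G) Ω; the velocity is -Ω (x₁, -x₂). -/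
theorem hasDerivWithinAt_vorticity (hf : Profile f δ R B)
    (hG : IsStrain (strainDensity f δ R) (R ^ 2 + 1) G) (hm : StrainBound G m)
    (hf1 : ContDiffOn ℝ (1 : ℕ) f quadrant) {t : ℝ} (ht : 0 ≤ t) {x : ℝ × ℝ} (hx : x ∈ quadrant) :
    HasDerivWithinAt (fun s => vorticity f G s x)
      (-(fderivWithin ℝ (vorticity f G t) quadrant x (velocity (vorticity f G t) x))) (Ici 0) t := by
  have hη : 0 ≤ x.1 * x.2 := mul_nonneg hx.1 hx.2
  set η := x.1 * x.2 with hηdef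
  set q : ℝ → ℝ := fun σ => f (x.1 * Real.exp σ, x.2 * Real.exp (-σ)) with hq
  have hfd : DifferentiableOn ℝ f quadrant := hf1.differentiableOn (by simp)
  have hωd : DifferentiableOn ℝ (vorticity f G t) quadrant :=
    (contDiffOn_vorticity hf hG hm hf1 ht).differentiableOn (by simp)
  have hqd := hasDerivAt_along_hyperbola hfd hx (G t η)
  set q' := fderivWithin ℝ f quadrant (x.1 * Real.exp (G t η), x.2 * Real.exp (-(G t η)))
    (x.1 * Real.exp (G t η), -(x.2 * Real.exp (-(G t η)))) with hq'
  have hω := hasDerivAt_along_hyperbola hωd hx 0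
  simp only [Real.exp_zero, mul_one, neg_zero, Prod.mk.eta] at hω
  have hcurve : (fun σ : ℝ => vorticity f G t (x.1 * Real.exp σ, x.2 * Real.exp (-σ))) =
      fun σ => q (G t η + σ) := by
    ext σ
    have hprod : x.1 * Real.exp σ * (x.2 * Real.exp (-σ)) = η := by
      have : Real.exp σ * Real.exp (-σ) = 1 := by rw [← Real.exp_add]; simp
      calc _ = x.1 * x.2 * (Real.exp σ * Real.exp (-σ)) := by ring
        _ = _ := by rw [this, mul_one]
    simp only [vorticity, strainMap, hprod, hq]
    congr 2
    · rw [mul_assoc, ← Real.exp_add, add_comm]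
    · rw [mul_assoc, ← Real.exp_add]; congr 2; ring
  rw [hcurve] at hω
  have hq2 : HasDerivAt (fun σ => q (G t η + σ)) q' 0 := by
    have h2 : HasDerivAt (fun σ : ℝ => G t η + σ) 1 0 := (hasDerivAt_id (0 : ℝ)).const_add _
    have h3 : HasDerivAt q q' (G t η + 0) := by rw [add_zero]; exact hqd
    have h4 := h3.comp (0 : ℝ) h2
    rwa [mul_one] at h4
  have huniq := hω.unique hq2
  have hvel : velocity (vorticity f G t) x =
      (-(bigOmega (vorticity f G t) η)) • ((x.1, -x.2) : ℝ × ℝ) := by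
    simp only [velocity, ← hηdef, Prod.smul_mk, smul_eq_mul]
    congr 1 <;> ring
  rw [hvel, map_smul, huniq, smul_eq_mul, neg_mul, neg_neg, mul_comm]
  have hΩ : bigOmega (vorticity f G t) η = ∫ h in η..(R ^ 2 + 1), strainDensity f δ R h (G t h) :=
    hf.bigOmega_comp_strainMap (hG.continuous_slice t) hη
  rw [hΩ]
  exact hqd.comp_hasDerivWithinAt t (hG.hasDerivWithinAt hf.isDensity ht hη)

theorem isSolutionOn_vorticity (hf : Profile f δ R B)
    (hG : IsStrain (strainDensity f δ R) (R ^ 2 + 1) G) (hm : StrainBound G m) {n : ℕ} (hn : 1 ≤ n)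
    (hfn : ContDiffOn ℝ n f quadrant) {ω₀ : ℝ × ℝ → ℝ} (hω₀ : ∀ x ∈ quadrant, f x = ω₀ x) :
    IsSolutionOn n ω₀ (Ici 0) (vorticity f G) where
  memK t ht := (profile_vorticity hf hG hm ht).memK (contDiffOn_vorticity hf hG hm hfn ht)
  continuous_cNorm t ht := tendsto_cNorm_vorticity hf hG hm hfn ht
  bounded_kNorm T := by
    obtain ⟨C, hC, hC'⟩ := expBounded_kNorm hf hG hm hfn
    refine lt_of_le_of_lt (iSup₂_le fun t ht => (hC' t ht.1).trans ?_)
      (ENNReal.ofReal_lt_top (r := C * Real.exp (C * m (max T 0))))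
    refine ENNReal.ofReal_le_ofReal ?_
    have : m t ≤ m (max T 0) := hm.mono ht.1 (mem_Ici.2 (le_max_right _ _)) (le_max_of_le_left ht.2)
    gcongr
  initial x hx := (vorticity_zero hf hG hx).trans (hω₀ x hx)
  equation t ht x hx := hasDerivWithinAt_vorticity hf hG hm
    (hfn.of_le (by exact_mod_cast hn)) ht hx

end Solution

end

/-! ### Uniqueness by characteristics. -/

noncomputable section

/-- The extension of a function on the quadrant to the plane by projection. -/
def extendQuadrant (w : ℝ × ℝ → ℝ) (x : ℝ × ℝ) : ℝ := w (max x.1 0, max x.2 0)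

theorem extendQuadrant_eq (w : ℝ × ℝ → ℝ) {x : ℝ × ℝ} (hx : x ∈ quadrant) :
    extendQuadrant w x = w x := by
  simp [extendQuadrant, max_eq_left hx.1, max_eq_left hx.2]

theorem suppD_subset_quadrant (w : ℝ × ℝ → ℝ) : suppD w ⊆ quadrant :=
  closure_minimal (fun _ hx => hx.1) isClosed_quadrant

theorem subset_suppD {w : ℝ × ℝ → ℝ} {x : ℝ × ℝ} (hx : x ∈ quadrant) (h : w x ≠ 0) : x ∈ suppD w :=
  subset_closure ⟨hx, h⟩

theorem bigOmega_congr {v w : ℝ × ℝ → ℝ} (h : ∀ x ∈ quadrant, v x = w x) (η : ℝ) :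
    bigOmega v η = bigOmega w η := by
  refine setIntegral_congr_fun ?_ fun y hy => by simp only [h y hy.1]
  exact (isClosed_quadrant.inter (isClosed_le continuous_const
    (continuous_fst.mul continuous_snd))).measurableSet

theorem MemK.exists_profile {n : ℕ} {w : ℝ × ℝ → ℝ} (hw : MemK n w) :
    ∃ δ R B, Profile (extendQuadrant w) δ R B := by
  have hwc : ContinuousOn w quadrant := hw.contDiffOn.continuousOn
  obtain ⟨d, hd0, hd⟩ := ENNReal.lt_iff_exists_nnreal_btwn.1 hw.delta_pos
  have hd0' : (0 : ℝ) < d := by exact_mod_cast hd0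
  obtain ⟨r, hr⟩ := hw.isCompact_supp.isBounded.exists_norm_le
  obtain ⟨B, hB⟩ := hw.isCompact_supp.exists_bound_of_continuousOn
    (hwc.mono (suppD_subset_quadrant w))
  -- The number d lies strictly between 0 and δ_w, which gives the strict inequality in
  -- `Profile.supp`.
  refine ⟨min d 1, max r 1, max B 0, ?_, lt_min hd0' one_pos, min_le_right _ _, le_max_right _ _,
    fun x => ?_, fun x hx hne => ?_⟩
  · exact hwc.comp_continuous (by fun_prop) fun x => ⟨le_max_right _ _, le_max_right _ _⟩
  · by_cases h : extendQuadrant w x = 0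
    · rw [h, abs_zero]; exact le_max_right _ _
    · refine (hB _ (subset_suppD (x := (max x.1 0, max x.2 0)) ?_ h)).trans (le_max_left _ _)
      exact ⟨le_max_right _ _, le_max_right _ _⟩
  · rw [extendQuadrant_eq w hx] at hne
    have hmem := subset_suppD hx hne
    have h1 := hr x hmem
    have h2 : delta w ≤ ENNReal.ofReal x.1 := iInf₂_le x hmem
    have h3 : (d : ℝ) < x.1 := by
      have := hd.trans_le h2
      rw [← ENNReal.ofReal_coe_nnreal] at this
      exact (ENNReal.ofReal_lt_ofReal_iff_of_nonneg hd0'.le).1 this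
    refine ⟨(min_le_left _ _).trans_lt h3, ?_, ?_⟩
    · exact (le_abs_self _).trans ((norm_fst_le x).trans (h1.trans (le_max_left _ _)))
    · exact (le_abs_self _).trans ((norm_snd_le x).trans (h1.trans (le_max_left _ _)))

/-- The derivative along a curve of a time-dependent function whose spatial derivative is
continuous in time, uniformly in space. -/
theorem hasDerivWithinAt_along_curve {E : Type} [NormedAddCommGroup E] [NormedSpace ℝ E] {S : Set E}
    (hS : Convex ℝ S) {I : Set ℝ} {w : ℝ → E → ℝ} {X : ℝ → E} {s₀ d : ℝ} {v : E}
    (hs₀ : s₀ ∈ I) (hX : HasDerivWithinAt X v I s₀) (hXS : MapsTo X I S)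
    (hw : ∀ s ∈ I, DifferentiableOn ℝ (w s) S)
    (hunif : ∀ ε > 0, ∀ᶠ s in 𝓝[I] s₀, ∀ x ∈ S,
      ‖fderivWithin ℝ (fun y => w s y - w s₀ y) S x‖ ≤ ε)
    (ht : HasDerivWithinAt (fun s => w s (X s₀)) d I s₀) :
    HasDerivWithinAt (fun s => w s (X s)) (d + fderivWithin ℝ (w s₀) S (X s₀) v) I s₀ := by
  have h2 : HasDerivWithinAt (fun s => w s₀ (X s)) (fderivWithin ℝ (w s₀) S (X s₀) v) I s₀ :=
    (hw s₀ hs₀ _ (hXS hs₀)).hasFDerivWithinAt.comp_hasDerivWithinAt s₀ hX hXS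
  -- The difference w s - w s₀ has a uniformly small gradient near s₀, so its increment from X s₀ to
  -- X s is o(|X s - X s₀|) = o(|s - s₀|).
  have h3 : HasDerivWithinAt
      (fun s => (w s (X s) - w s₀ (X s)) - (w s (X s₀) - w s₀ (X s₀))) 0 I s₀ := by
    rw [hasDerivWithinAt_iff_isLittleO]
    have h4 : (fun s => (w s (X s) - w s₀ (X s)) - (w s (X s₀) - w s₀ (X s₀))) =o[𝓝[I] s₀]
        fun s => X s - X s₀ := by
      rw [Asymptotics.isLittleO_iff]
      intro ε hε
      filter_upwards [hunif ε hε, self_mem_nhdsWithin] with s hs hsI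
      exact hS.norm_image_sub_le_of_norm_fderivWithin_le (f := fun y => w s y - w s₀ y)
        ((hw s hsI).sub (hw s₀ hs₀)) hs (hXS hs₀) (hXS hsI)
    have h5 := h4.trans_isBigO hX.differentiableWithinAt.isBigO_sub
    simpa using h5
  have h6 := (ht.add h2).add h3
  rw [add_zero] at h6
  have h7 := h6.sub_const (w s₀ (X s₀))
  refine h7.congr (fun s _ => ?_) ?_ <;> simp only [Pi.add_apply] <;> ring

theorem norm_iteratedFDerivWithin_le_of_cNorm {n k : ℕ} (hk : k ≤ n) {g : ℝ × ℝ → ℝ} {ε : ℝ}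
    (hε : 0 ≤ ε) (h : cNorm n g ≤ ENNReal.ofReal ε) {x : ℝ × ℝ} (hx : x ∈ quadrant) :
    ‖iteratedFDerivWithin ℝ k g quadrant x‖ ≤ ε := by
  rw [← ENNReal.ofReal_le_ofReal_iff hε, ofReal_norm]
  refine le_trans ?_ h
  refine le_trans ?_ (Finset.single_le_sum (f := fun k => derivSup k g) (fun _ _ => bot_le)
    (Finset.mem_range.2 (Nat.lt_succ_of_le hk)))
  exact le_iSup₂ (f := fun x (_ : x ∈ quadrant) => ‖iteratedFDerivWithin ℝ k g quadrant x‖ₑ) x hx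

theorem abs_le_of_cNorm {n : ℕ} {g : ℝ × ℝ → ℝ} {ε : ℝ} (hε : 0 ≤ ε)
    (h : cNorm n g ≤ ENNReal.ofReal ε) {x : ℝ × ℝ} (hx : x ∈ quadrant) : |g x| ≤ ε := by
  have := norm_iteratedFDerivWithin_le_of_cNorm (Nat.zero_le n) hε h hx
  rwa [norm_iteratedFDerivWithin_zero] at this

theorem norm_fderivWithin_le_of_cNorm {n : ℕ} (hn : 1 ≤ n) {g : ℝ × ℝ → ℝ} {ε : ℝ} (hε : 0 ≤ ε)
    (h : cNorm n g ≤ ENNReal.ofReal ε) {x : ℝ × ℝ} (hx : x ∈ quadrant) :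
    ‖fderivWithin ℝ g quadrant x‖ ≤ ε := by
  have := norm_iteratedFDerivWithin_le_of_cNorm hn hε h hx
  rwa [norm_iteratedFDerivWithin_one g (uniqueDiffOn_quadrant x hx)] at this

theorem measurableSet_omegaDomain (η : ℝ) :
    MeasurableSet {y : ℝ × ℝ | y ∈ quadrant ∧ η ≤ y.1 * y.2} :=
  (isClosed_quadrant.inter (isClosed_le continuous_const
    (continuous_fst.mul continuous_snd))).measurableSet

theorem MemK.integrableOn {n : ℕ} {w : ℝ × ℝ → ℝ} (hw : MemK n w) (η : ℝ) :
    IntegrableOn (fun y => w y / (y.1 ^ 2 + y.2 ^ 2)) {y | y ∈ quadrant ∧ η ≤ y.1 * y.2} := by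
  obtain ⟨δ, R, B, hf⟩ := hw.exists_profile
  have hδ := hf.delta_pos
  have hm := measurableSet_omegaDomain η
  have hc : ContinuousOn (fun y : ℝ × ℝ => extendQuadrant w y / (y.1 ^ 2 + y.2 ^ 2))
      (Icc δ R ×ˢ Icc 0 R) := by
    refine hf.continuous.continuousOn.div (by fun_prop) fun y hy => ?_
    have : 0 < y.1 := hδ.trans_le hy.1.1
    positivity
  have hi := hc.integrableOn_compact (isCompact_Icc.prod isCompact_Icc) (μ := volume)
  have hi2 : IntegrableOn (fun y : ℝ × ℝ => extendQuadrant w y / (y.1 ^ 2 + y.2 ^ 2))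
      {y | y ∈ quadrant ∧ η ≤ y.1 * y.2} := by
    refine IntegrableOn.of_forall_sdiff_eq_zero hi hm fun y hy => ?_
    have : extendQuadrant w y = 0 := by
      by_contra hne
      have h := hf.supp y hy.1.1 hne
      exact hy.2 ⟨⟨h.1.le, h.2.1⟩, hy.1.1.2, h.2.2⟩
    simp [this]
  exact hi2.congr_fun (fun y hy => by simp only [extendQuadrant_eq w hy.1]) hm

/-- The integrand of the difference lives on the union of the supports, where y₁ ≥ 1/A and whose
area is at most 2A. This uses the last two terms of the K_n norm. -/
theorem abs_bigOmega_sub_le {n : ℕ} {v w : ℝ × ℝ → ℝ} (hv : MemK n v) (hw : MemK n w) {A ε : ℝ}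
    (hA : 0 < A) (hε : 0 ≤ ε) (hvA : kNorm n v ≤ ENNReal.ofReal A) (hwA : kNorm n w ≤ ENNReal.ofReal A)
    (hvw : cNorm n (fun x => v x - w x) ≤ ENNReal.ofReal ε) (η : ℝ) :
    |bigOmega v η - bigOmega w η| ≤ ε * A ^ 2 * (2 * A) := by
  have hm := measurableSet_omegaDomain η
  set D := {y : ℝ × ℝ | y ∈ quadrant ∧ η ≤ y.1 * y.2} with hD
  set Z := suppD v ∪ suppD w with hZ
  have hZm : MeasurableSet Z := (isClosed_closure.union isClosed_closure).measurableSet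
  have hlow : ∀ {u : ℝ × ℝ → ℝ}, kNorm n u ≤ ENNReal.ofReal A → ∀ y ∈ suppD u, A⁻¹ ≤ y.1 := by
    intro u hu y hy
    have h1 : (delta u)⁻¹ ≤ ENNReal.ofReal A := le_trans (le_add_left le_rfl) hu
    have h2 : delta u ≤ ENNReal.ofReal y.1 := iInf₂_le y hy
    have h3 : ENNReal.ofReal A⁻¹ ≤ ENNReal.ofReal y.1 := by
      rw [ENNReal.ofReal_inv_of_pos hA]
      exact (ENNReal.inv_le_iff_inv_le.1 h1).trans h2
    exact (ENNReal.ofReal_le_ofReal_iff (suppD_subset_quadrant u hy).1).1 h3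
  have hvol : ∀ {u : ℝ × ℝ → ℝ}, kNorm n u ≤ ENNReal.ofReal A →
      volume (suppD u) ≤ ENNReal.ofReal A := fun hu =>
    le_trans (le_trans (le_add_left le_rfl) (le_add_right le_rfl)) hu
  have hZvol : volume (D ∩ Z) ≤ ENNReal.ofReal (2 * A) := by
    refine (measure_mono inter_subset_right).trans ((measure_union_le _ _).trans ?_)
    rw [two_mul, ENNReal.ofReal_add hA.le hA.le]
    exact add_le_add (hvol hvA) (hvol hwA)
  have e1 : bigOmega v η - bigOmega w η = ∫ y in D ∩ Z, (v y - w y) / (y.1 ^ 2 + y.2 ^ 2) := by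
    rw [bigOmega, bigOmega, ← integral_sub (hv.integrableOn η) (hw.integrableOn η)]
    simp_rw [← sub_div]
    refine setIntegral_eq_of_subset_of_forall_sdiff_eq_zero hm inter_subset_left fun y hy => ?_
    have h1 : v y = 0 := by
      by_contra hne
      exact hy.2 ⟨hy.1, Or.inl (subset_suppD hy.1.1 hne)⟩
    have h2 : w y = 0 := by
      by_contra hne
      exact hy.2 ⟨hy.1, Or.inr (subset_suppD hy.1.1 hne)⟩
    simp [h1, h2]
  rw [e1, ← Real.norm_eq_abs]
  refine (norm_setIntegral_le_of_norm_le_const (C := ε * A ^ 2) (hZvol.trans_lt ENNReal.ofReal_lt_top)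
    fun y hy => ?_).trans ?_
  · have hy1 : A⁻¹ ≤ y.1 := hy.2.elim (hlow hvA y) (hlow hwA y)
    have hAi : 0 < A⁻¹ := inv_pos.2 hA
    have hden : A⁻¹ ^ 2 ≤ y.1 ^ 2 + y.2 ^ 2 := by nlinarith [sq_nonneg y.2]
    rw [Real.norm_eq_abs, abs_div, abs_of_nonneg (by positivity : 0 ≤ y.1 ^ 2 + y.2 ^ 2)]
    refine (div_le_div₀ hε (abs_le_of_cNorm hε hvw hy.1.1) (by positivity) hden).trans (le_of_eq ?_)
    field_simp
  · refine mul_le_mul_of_nonneg_left ?_ (by positivity)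
    exact ENNReal.toReal_le_of_le_ofReal (by positivity) hZvol

theorem MemK.continuous_bigOmega {n : ℕ} {w : ℝ × ℝ → ℝ} (hw : MemK n w) :
    Continuous fun η => bigOmega w (max η 0) := by
  obtain ⟨δ, R, B, hf⟩ := hw.exists_profile
  have e : (fun η => bigOmega w (max η 0)) = fun η => ∫ h in (max η 0)..(R ^ 2 + 1),
      strainDensity (extendQuadrant w) δ R h 0 := by
    ext η
    rw [← bigOmega_congr (fun x hx => extendQuadrant_eq w hx)]
    have h := hf.bigOmega_comp_strainMap (γ := fun _ => 0) continuous_const (le_max_right η 0)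
    rw [← h]
    simp [strainMap]
  rw [e]
  have h1 := hf.isDensity.continuous_rate (G := fun _ _ => 0) continuous_const
  exact h1.comp (by fun_prop : Continuous fun η : ℝ => ((0 : ℝ), max η 0))

section Uniqueness

variable {n : ℕ} {ω₀ : ℝ × ℝ → ℝ} {T : ℝ} {ω : ℝ → ℝ × ℝ → ℝ}

theorem IsSolutionOn.mono {I J : Set ℝ} (h : IsSolutionOn n ω₀ I ω) (hJ : J ⊆ I) :
    IsSolutionOn n ω₀ J ω where
  memK t ht := h.memK t (hJ ht)
  continuous_cNorm t ht := (h.continuous_cNorm t (hJ ht)).mono_left (nhdsWithin_mono t hJ)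
  bounded_kNorm T := lt_of_le_of_lt (biSup_mono fun _ ht => ⟨hJ ht.1, ht.2⟩) (h.bounded_kNorm T)
  initial := h.initial
  equation t ht x hx := (h.equation t (hJ ht) x hx).mono hJ

theorem IsSolutionOn.exists_kNorm_le (h : IsSolutionOn n ω₀ (Icc 0 T) ω) :
    ∃ A : ℝ, 0 < A ∧ ∀ t ∈ Icc 0 T, kNorm n (ω t) ≤ ENNReal.ofReal A := by
  have hb := h.bounded_kNorm T
  refine ⟨(⨆ t ∈ Icc 0 T ∩ Iic T, kNorm n (ω t)).toReal + 1, by positivity, fun t ht => ?_⟩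
  have h1 : kNorm n (ω t) ≤ ⨆ t ∈ Icc 0 T ∩ Iic T, kNorm n (ω t) :=
    le_iSup₂ (f := fun t (_ : t ∈ Icc 0 T ∩ Iic T) => kNorm n (ω t)) t ⟨ht, ht.2⟩
  refine h1.trans ?_
  conv_lhs => rw [← ENNReal.ofReal_toReal hb.ne]
  exact ENNReal.ofReal_le_ofReal (by linarith)

theorem IsSolutionOn.continuous_bigOmega (hT : 0 ≤ T) (h : IsSolutionOn n ω₀ (Icc 0 T) ω) :
    Continuous fun q : ℝ × ℝ => bigOmega (ω (projIcc 0 T hT q.1)) (max q.2 0) := by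
  obtain ⟨A, hA, hA'⟩ := h.exists_kNorm_le
  have hunif : ∀ t₀ ∈ Icc 0 T, ∀ ε > 0, ∀ᶠ t in 𝓝[Icc 0 T] t₀, ∀ η,
      |bigOmega (ω t) η - bigOmega (ω t₀) η| < ε := by
    intro t₀ ht₀ ε hε
    set ε' := ε / (A ^ 2 * (2 * A) + 1) with hε'
    have hε'0 : 0 < ε' := by positivity
    have := (ENNReal.tendsto_nhds_zero.1 (h.continuous_cNorm t₀ ht₀)) (ENNReal.ofReal ε')
      (ENNReal.ofReal_pos.2 hε'0)
    filter_upwards [this, self_mem_nhdsWithin] with t ht htI η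
    refine (abs_bigOmega_sub_le (h.memK t htI) (h.memK t₀ ht₀) hA hε'0.le (hA' t htI) (hA' t₀ ht₀)
      ht η).trans_lt ?_
    rw [mul_assoc, hε', div_mul_eq_mul_div, div_lt_iff₀ (by positivity)]
    nlinarith
  rw [continuous_iff_continuousAt]
  rintro ⟨t₀, η₀⟩
  rw [ContinuousAt, Metric.tendsto_nhds]
  intro ε hε
  have hp := (projIcc 0 T hT t₀).2
  have htend : Tendsto (fun q : ℝ × ℝ => (projIcc 0 T hT q.1 : ℝ)) (𝓝 (t₀, η₀))
      (𝓝[Icc 0 T] (projIcc 0 T hT t₀ : ℝ)) := by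
    refine tendsto_nhdsWithin_iff.2 ⟨?_, Eventually.of_forall fun q => (projIcc 0 T hT q.1).2⟩
    exact (continuous_subtype_val.comp ((continuous_projIcc (h := hT)).comp
      continuous_fst)).continuousAt
  have e1 := htend.eventually (hunif _ hp (ε / 2) (half_pos hε))
  have e2 : ∀ᶠ q : ℝ × ℝ in 𝓝 (t₀, η₀), dist (bigOmega (ω (projIcc 0 T hT t₀)) (max q.2 0))
      (bigOmega (ω (projIcc 0 T hT t₀)) (max η₀ 0)) < ε / 2 := by
    have := ((h.memK _ hp).continuous_bigOmega.comp continuous_snd).continuousAt (x := (t₀, η₀))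
    exact Metric.tendsto_nhds.1 this (ε / 2) (half_pos hε)
  filter_upwards [e1, e2] with q h1 h2
  refine (dist_triangle _ (bigOmega (ω (projIcc 0 T hT t₀)) (max q.2 0)) _).trans_lt ?_
  have h1' := h1 (max q.2 0)
  rw [← Real.dist_eq] at h1'
  linarith

/-- The characteristics of any solution are explicit, because they stay on their hyperbolas, and the
solution is constant along them. -/
theorem IsSolutionOn.exists_strain (hn : 1 ≤ n) (hT : 0 ≤ T) (h : IsSolutionOn n ω₀ (Icc 0 T) ω) :
    ∃ G : ℝ → ℝ → ℝ, Continuous (Function.uncurry G) ∧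
      (∀ t ∈ Icc 0 T, ∀ η, 0 ≤ η → G t η = ∫ s in (0 : ℝ)..t, bigOmega (ω s) η) ∧
      ∀ t ∈ Icc 0 T, ∀ x ∈ quadrant, ω t x = ω₀ (strainMap (G t) x) := by
  have hc := h.continuous_bigOmega hT
  set W : ℝ → ℝ → ℝ := fun t η => bigOmega (ω (projIcc 0 T hT t)) (max η 0) with hW
  have hWeq : ∀ t ∈ Icc 0 T, ∀ η, 0 ≤ η → W t η = bigOmega (ω t) η := by
    intro t ht η hη
    simp only [hW, projIcc_of_mem hT ht, max_eq_left hη]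
  have hct : ∀ η, Continuous fun t => W t η := fun η =>
    hc.comp (by fun_prop : Continuous fun t : ℝ => (t, η))
  set G : ℝ → ℝ → ℝ := fun t η => ∫ s in (0 : ℝ)..t, W s η with hG
  have hGc : Continuous (Function.uncurry G) := by
    have h1 : Continuous (Function.uncurry fun η s => W s η) := hc.comp continuous_swap
    exact (intervalIntegral.continuous_parametric_primitive_of_continuous (a₀ := 0)
      (μ := volume) h1).comp continuous_swap
  have hGd : ∀ t η, HasDerivAt (fun t => G t η) (W t η) t := fun t η =>
    intervalIntegral.integral_hasDerivAt_right ((hct η).intervalIntegrable 0 t)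
      (hct η).aestronglyMeasurable.stronglyMeasurableAtFilter (hct η).continuousAt
  refine ⟨G, hGc, fun t ht η hη => ?_, fun t ht x hx => ?_⟩
  · refine intervalIntegral.integral_congr fun s hs => ?_
    rw [uIcc_of_le ht.1] at hs
    exact hWeq s ⟨hs.1, hs.2.trans ht.2⟩ η hη
  · set y := strainMap (G t) x with hy
    have hyq : y ∈ quadrant := strainMap_mem.2 hx
    set η := x.1 * x.2 with hη
    have hη0 : 0 ≤ η := mul_nonneg hx.1 hx.2
    -- The characteristic that starts at y and passes through x at time t.
    set X : ℝ → ℝ × ℝ := fun s => (y.1 * Real.exp (-G s η), y.2 * Real.exp (-(-G s η))) with hX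
    have hXq : ∀ s, X s ∈ quadrant := fun s => hyperbola_mem hyq _
    have hXη : ∀ s, (X s).1 * (X s).2 = η := by
      intro s
      have e : Real.exp (-G s η) * Real.exp (-(-G s η)) = 1 := by rw [← Real.exp_add]; simp
      calc (X s).1 * (X s).2 = y.1 * y.2 * (Real.exp (-G s η) * Real.exp (-(-G s η))) := by
            simp only [hX]; ring
        _ = η := by rw [e, mul_one, hy, strainMap_mul]
    have hXd : ∀ s ∈ Icc 0 T, HasDerivAt X (velocity (ω s) (X s)) s := by
      intro s hs
      have h1 := (hasDerivAt_hyperbola y (-G s η)).scomp s (hGd s η).neg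
      have hv : velocity (ω s) (X s) = (-W s η) • (((X s).1, -(X s).2) : ℝ × ℝ) := by
        simp only [velocity, hXη, hWeq s hs η hη0, Prod.smul_mk, smul_eq_mul]
        congr 1 <;> ring
      rw [hv]
      exact h1
    have hder : ∀ s ∈ Icc 0 T, HasDerivWithinAt (fun s => ω s (X s)) 0 (Icc 0 T) s := by
      intro s hs
      have h1 := hasDerivWithinAt_along_curve convex_quadrant hs (hXd s hs).hasDerivWithinAt
        (fun s _ => hXq s) (fun s hs => (h.memK s hs).contDiffOn.differentiableOn
          (by exact_mod_cast (by omega : n ≠ 0)))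
        (fun ε hε => ((ENNReal.tendsto_nhds_zero.1 (h.continuous_cNorm s hs)) (ENNReal.ofReal ε)
          (ENNReal.ofReal_pos.2 hε)).mono fun r hr z hz =>
            norm_fderivWithin_le_of_cNorm hn hε.le hr hz)
        (h.equation s hs (X s) (hXq s))
      rwa [neg_add_cancel] at h1
    have hconst : ω t (X t) = ω 0 (X 0) := by
      refine constant_of_has_deriv_right_zero (f := fun s => ω s (X s)) (a := 0) (b := T)
        (fun s hs => (hder s hs).continuousWithinAt) (fun s hs => ?_) t ht
      exact (hder s ⟨hs.1, hs.2.le⟩).mono_of_mem_nhdsWithin (Icc_mem_nhdsGE_of_mem hs)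
    have hX0 : X 0 = y := by simp [hX, hG]
    have hXt : X t = x := by
      have := strainMap_neg_strainMap (G t) x
      rw [← hy] at this
      rw [← this, strainMap, hy, strainMap_mul]
    rw [hXt, hX0, h.initial y hyq] at hconst
    exact hconst

/-- The solution is ω₀ composed with its own strain map, so its strain satisfies the closed equation
and `isStrainOn_unique` identifies it with G. Heights above R² + 1 are separate, since there both
strains vanish. -/
theorem IsSolutionOn.eq_vorticity {f : ℝ × ℝ → ℝ} {δ R B : ℝ} {G : ℝ → ℝ → ℝ}
    (hf : Profile f δ R B) (hG : IsStrain (strainDensity f δ R) (R ^ 2 + 1) G)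
    (hω₀ : ∀ x ∈ quadrant, f x = ω₀ x) (hn : 1 ≤ n) (hT : 0 ≤ T)
    (h : IsSolutionOn n ω₀ (Icc 0 T) ω) :
    ∀ t ∈ Icc 0 T, ∀ x ∈ quadrant, ω t x = vorticity f G t x := by
  have hF := hf.isDensity
  obtain ⟨G', hGc, hG', hω⟩ := h.exists_strain hn hT
  have hΩ : ∀ t ∈ Icc 0 T, ∀ η, 0 ≤ η →
      bigOmega (ω t) η = ∫ h in η..(R ^ 2 + 1), strainDensity f δ R h (G' t h) := by
    intro t ht η hη
    rw [← hf.bigOmega_comp_strainMap (γ := G' t)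
      (hGc.comp (by fun_prop : Continuous fun h : ℝ => (t, h))) hη]
    refine bigOmega_congr (fun x hx => ?_) η
    rw [hω t ht x hx, ← hω₀ _ (strainMap_mem.2 hx)]
  have heq : ∀ t ∈ Icc 0 T, ∀ η, 0 ≤ η → G' t η =
      ∫ s in (0 : ℝ)..t, ∫ h in η..(R ^ 2 + 1), strainDensity f δ R h (G' s h) := by
    intro t ht η hη
    rw [hG' t ht η hη]
    refine intervalIntegral.integral_congr fun s hs => ?_
    rw [uIcc_of_le ht.1] at hs
    exact hΩ s ⟨hs.1, hs.2.trans ht.2⟩ η hη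
  have hstrain : IsStrainOn (strainDensity f δ R) (R ^ 2 + 1) T G' :=
    ⟨hGc, fun t ht η hη => heq t ht η hη.1⟩
  intro t ht x hx
  have hη := mul_nonneg hx.1 hx.2
  have hGG : G' t (x.1 * x.2) = G t (x.1 * x.2) := by
    rcases le_total (x.1 * x.2) (R ^ 2 + 1) with hle | hle
    · exact hF.isStrainOn_unique hstrain (hG.isStrainOn T) t ht _ ⟨hη, hle⟩
    · rw [hG.eq_zero t _ hle, heq t ht _ hη]
      simp_rw [IsStrain.rate_eq_zero hF hle]
      simp
  rw [hω t ht x hx, ← hω₀ _ (strainMap_mem.2 hx), vorticity]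
  simp only [strainMap, hGG]

end Uniqueness

end

/-! ### Energy identity and the linear upper bound for nonnegative data. -/

noncomputable section

theorem sq_intervalIntegral {φ : ℝ → ℝ} (hφ : Continuous φ) (a b : ℝ) :
    (∫ h in a..b, φ h) ^ 2 = 2 * ∫ h in a..b, φ h * ∫ k in h..b, φ k := by
  have hd : ∀ h, HasDerivAt (fun h => ∫ k in h..b, φ k) (-φ h) h := fun h =>
    intervalIntegral.integral_hasDerivAt_left (hφ.intervalIntegrable _ _)
      (hφ.stronglyMeasurableAtFilter _ _) hφ.continuousAt
  have hc : Continuous fun h => ∫ k in h..b, φ k :=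
    continuous_iff_continuousAt.2 fun h => (hd h).continuousAt
  have h2 : ∀ h, HasDerivAt (fun h => -(∫ k in h..b, φ k) ^ 2) (2 * (φ h * ∫ k in h..b, φ k)) h :=
    fun h => ((hd h).pow 2).neg.congr_deriv (by push_cast; ring)
  rw [← intervalIntegral.integral_const_mul,
    intervalIntegral.integral_eq_sub_of_hasDerivAt (fun h _ => h2 h)
      ((continuous_const.mul (hφ.mul hc)).intervalIntegrable _ _)]
  simp

namespace IsDensity

variable {F : ℝ → ℝ → ℝ} {C H : ℝ}

theorem potential_le_exp (hF : IsDensity F C H) (h : ℝ) {g : ℝ} (hg : 0 ≤ g) :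
    ∫ s in (0 : ℝ)..g, F h s ≤ C * Real.exp (2 * g) := by
  have hC := hF.C_pos
  have hd : ∀ s : ℝ, HasDerivAt (fun s => C / 2 * Real.exp (2 * s)) (C * Real.exp (2 * s)) s := by
    intro s
    have h2 : HasDerivAt (fun s : ℝ => 2 * s) 2 s := by simpa using (hasDerivAt_id s).const_mul 2
    exact (h2.exp.const_mul (C / 2)).congr_deriv (by ring)
  have hi : IntervalIntegrable (fun s => C * Real.exp (2 * s)) volume 0 g :=
    (by fun_prop : Continuous fun s => C * Real.exp (2 * s)).intervalIntegrable _ _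
  have := intervalIntegral.integral_mono_on hg
    ((hF.continuous.comp (by fun_prop : Continuous fun s : ℝ => (h, s))).intervalIntegrable _ _) hi
    fun s _ => (le_abs_self _).trans (hF.abs_le_exp h s)
  rw [intervalIntegral.integral_eq_sub_of_hasDerivAt (fun s _ => hd s) hi] at this
  refine this.trans ?_
  have e1 := mul_pos hC (Real.exp_pos (2 * g))
  have e2 := mul_pos hC (Real.exp_pos (2 * 0))
  rw [← mul_sub, div_mul_eq_mul_div, div_le_iff₀ two_pos, mul_sub]
  linarith

/-- The majorant of hF has the antiderivative (C/2) arctan(h e^(2s)), which is bounded uniformly in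
g. So the potential obeys the same two bounds as F, and `integral_abs_le` applies to it. -/
theorem potential_mul_le (hF : IsDensity F C H) {h g : ℝ} (hh : 0 ≤ h) (hg : 0 ≤ g) :
    (∫ s in (0 : ℝ)..g, F h s) * h ≤ C := by
  have hC := hF.C_pos
  have hpos : ∀ s, 0 < Real.exp (-(2 * s)) + h ^ 2 * Real.exp (2 * s) := fun s => by positivity
  have hd : ∀ s : ℝ, HasDerivAt (fun s => C / 2 * Real.arctan (h * Real.exp (2 * s)))
      (C * (Real.exp (-(2 * s)) + h ^ 2 * Real.exp (2 * s))⁻¹ * h) s := by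
    intro s
    have h2 : HasDerivAt (fun s : ℝ => 2 * s) 2 s := by simpa using (hasDerivAt_id s).const_mul 2
    refine ((h2.exp.const_mul h).arctan.const_mul (C / 2)).congr_deriv ?_
    have e := Real.exp_pos (2 * s)
    rw [Real.exp_neg]
    field_simp
  have hi : IntervalIntegrable (fun s => C * (Real.exp (-(2 * s)) + h ^ 2 * Real.exp (2 * s))⁻¹ * h)
      volume 0 g := by
    refine Continuous.intervalIntegrable ?_ _ _
    exact (continuous_const.mul (Continuous.inv₀ (by fun_prop) fun s => (hpos s).ne')).mul
      continuous_const
  have hFi : IntervalIntegrable (F h) volume 0 g :=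
    (hF.continuous.comp (by fun_prop : Continuous fun s : ℝ => (h, s))).intervalIntegrable _ _
  have := intervalIntegral.integral_mono_on hg (hFi.mul_const h) hi fun s _ =>
    mul_le_mul_of_nonneg_right ((le_abs_self _).trans (hF.bound h s)) hh
  rw [intervalIntegral.integral_eq_sub_of_hasDerivAt (fun s _ => hd s) hi,
    intervalIntegral.integral_mul_const] at this
  refine this.trans ?_
  have h1 := Real.arctan_lt_pi_div_two (h * Real.exp (2 * g))
  have h2 : 0 ≤ Real.arctan (h * Real.exp (2 * 0)) := Real.arctan_nonneg.2 (by positivity)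
  have h3 := Real.pi_le_four
  have h4 := mul_le_mul_of_nonneg_left (show Real.arctan (h * Real.exp (2 * g)) ≤ 2 by linarith) hC.le
  have h5 := mul_nonneg hC.le h2
  rw [← mul_sub, div_mul_eq_mul_div, div_le_iff₀ two_pos, mul_sub]
  linarith

end IsDensity

namespace IsStrain

variable {F G : ℝ → ℝ → ℝ} {C H : ℝ}

theorem rate_antitone (hF : IsDensity F C H) (hG : IsStrain F H G)
    (hpos : ∀ h, 0 ≤ h → ∀ g, 0 ≤ F h g) (t : ℝ) {η η' : ℝ} (hη : 0 ≤ η) (hle : η ≤ η') :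
    ∫ h in η'..H, F h (G t h) ≤ ∫ h in η..H, F h (G t h) := by
  have hc := hF.continuous_section hG.continuous t
  rw [← intervalIntegral.integral_add_adjacent_intervals (hc.intervalIntegrable η η')
    (hc.intervalIntegrable η' H)]
  exact le_add_of_nonneg_left (intervalIntegral.integral_nonneg hle fun h hh =>
    hpos h (hη.trans hh.1) _)

theorem rate_nonneg (hF : IsDensity F C H) (hG : IsStrain F H G)
    (hpos : ∀ h, 0 ≤ h → ∀ g, 0 ≤ F h g) (t : ℝ) {η : ℝ} (hη : 0 ≤ η) :
    0 ≤ ∫ h in η..H, F h (G t h) := by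
  have := rate_antitone hF hG hpos t hη (le_max_left η H)
  rwa [rate_eq_zero hF (le_max_right η H)] at this

theorem nonneg (hF : IsDensity F C H) (hG : IsStrain F H G)
    (hpos : ∀ h, 0 ≤ h → ∀ g, 0 ≤ F h g) {t η : ℝ} (ht : 0 ≤ t) (hη : 0 ≤ η) : 0 ≤ G t η := by
  rw [equation hF hG ht hη]
  exact intervalIntegral.integral_nonneg ht fun s _ => rate_nonneg hF hG hpos s hη

theorem antitone (hF : IsDensity F C H) (hG : IsStrain F H G)
    (hpos : ∀ h, 0 ≤ h → ∀ g, 0 ≤ F h g) {t η η' : ℝ} (ht : 0 ≤ t) (hη : 0 ≤ η) (hle : η ≤ η') :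
    G t η' ≤ G t η := by
  rw [equation hF hG ht hη, equation hF hG ht (hη.trans hle)]
  exact intervalIntegral.integral_mono_on ht
    ((hF.continuous_rate_time hG.continuous _).intervalIntegrable _ _)
    ((hF.continuous_rate_time hG.continuous _).intervalIntegrable _ _)
    fun s _ => rate_antitone hF hG hpos s hη hle

/-- The energy identity: the potential `∫ g, F h g` evaluated along the strain grows at the rate
`Ω(0, t) ^ 2 / 2`. -/
theorem integral_sq_rate (hF : IsDensity F C H) (hG : IsStrain F H G) {t : ℝ} (ht : 0 ≤ t) :
    ∫ s in (0 : ℝ)..t, (∫ h in (0 : ℝ)..H, F h (G s h)) ^ 2 =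
      2 * ∫ h in (0 : ℝ)..H, ∫ g in (0 : ℝ)..G t h, F h g := by
  have hcF : Continuous fun q : ℝ × ℝ => F q.2 (G q.1 q.2) :=
    hF.continuous.comp (continuous_snd.prodMk hG.continuous)
  have hcr := hF.continuous_rate hG.continuous
  simp_rw [fun s => sq_intervalIntegral (hF.continuous_section hG.continuous s) 0 H]
  rw [intervalIntegral.integral_const_mul]
  congr 1
  have hint : Continuous (fun q : ℝ × ℝ => F q.2 (G q.1 q.2) * ∫ k in q.2..H, F k (G q.1 k)) :=
    hcF.mul hcr
  rw [intervalIntegral_intervalIntegral_swap (F := fun s h => F h (G s h) * ∫ k in h..H, F k (G s k))]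
  · refine intervalIntegral.integral_congr fun h hh => ?_
    rw [uIcc_of_le hF.H_pos.le] at hh
    -- For fixed h the inner integral is the strain rate at h, so F(h, G) ∂G/∂s integrates by the
    -- substitution g = G(s, h).
    have hsub := intervalIntegral.integral_comp_mul_deriv'' (a := 0) (b := t)
      (f := fun s => G s h) (f' := fun s => ∫ k in h..H, F k (G s k)) (g := F h)
      (hG.continuous.comp (by fun_prop : Continuous fun s : ℝ => (s, h))).continuousOn
      (fun s hs => by
        rw [min_eq_left ht] at hs
        exact (hasDerivWithinAt hF hG hs.1.le hh.1).mono fun x hx => hs.1.le.trans (le_of_lt hx))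
      (hF.continuous_rate_time hG.continuous h).continuousOn
      (hF.continuous.comp (by fun_prop : Continuous fun s : ℝ => (h, s))).continuousOn
    have h0 : G 0 h = 0 := by rw [equation hF hG le_rfl hh.1]; simp
    simpa only [Function.comp, h0] using hsub
  · exact (hint.continuousOn.integrableOn_compact (isCompact_uIcc.prod isCompact_uIcc)).mono_set
      (prod_mono uIoc_subset_uIcc uIoc_subset_uIcc)

/-- By the energy identity, the time integral of Ω(0, ·)² is at most 2(CH + 2C G(t, 0)). Young's
inequality for G(t, 0) = ∫ Ω(0, ·) then leaves a fraction of G(t, 0) on the right that can be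
absorbed. -/
theorem le_linear (hF : IsDensity F C H) (hG : IsStrain F H G)
    (hpos : ∀ h, 0 ≤ h → ∀ g, 0 ≤ F h g) {t : ℝ} (ht : 0 ≤ t) : G t 0 ≤ H / 2 + 4 * C * t := by
  have hC := hF.C_pos
  have hH := hF.H_pos
  have ha := nonneg hF hG hpos ht le_rfl
  have hcP : Continuous fun h => ∫ g in (0 : ℝ)..G t h, F h g :=
    intervalIntegral.continuous_parametric_intervalIntegral_of_continuous hF.continuous
      (hG.continuous_slice t)
  have hP0 : ∀ h ∈ Icc 0 H, 0 ≤ ∫ g in (0 : ℝ)..G t h, F h g := fun h hh =>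
    intervalIntegral.integral_nonneg (nonneg hF hG hpos ht hh.1) fun g _ => hpos h hh.1 g
  have h1 := IsDensity.integral_abs_le hC hH hcP ha
    (fun h hh => by
      rw [abs_of_nonneg (hP0 h hh)]
      refine (hF.potential_le_exp h (nonneg hF hG hpos ht hh.1)).trans ?_
      have := antitone hF hG hpos ht le_rfl hh.1
      gcongr)
    (fun h hh => by
      rw [abs_of_nonneg (hP0 h hh)]
      exact hF.potential_mul_le hh.1 (nonneg hF hG hpos ht hh.1))
    (left_mem_Icc.2 hH.le)
  have h2 := (le_abs_self _).trans h1
  have hcr := hF.continuous_rate_time hG.continuous 0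
  -- The constant 8C makes the energy term contribute exactly G(t, 0)/2.
  have h3 : G t 0 ≤ ∫ s in (0 : ℝ)..t, ((8 * C)⁻¹ * (∫ h in (0 : ℝ)..H, F h (G s h)) ^ 2 + 2 * C) := by
    rw [equation hF hG ht le_rfl]
    refine intervalIntegral.integral_mono_on ht (hcr.intervalIntegrable _ _)
      (((continuous_const.mul (hcr.pow 2)).add continuous_const).intervalIntegrable _ _) fun s _ => ?_
    rw [inv_mul_eq_div, ← sub_le_iff_le_add, le_div_iff₀ (by positivity)]
    nlinarith [sq_nonneg ((∫ h in (0 : ℝ)..H, F h (G s h)) - 4 * C)]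
  have hi : IntervalIntegrable
      (fun s => (8 * C)⁻¹ * (∫ h in (0 : ℝ)..H, F h (G s h)) ^ 2) volume 0 t :=
    (continuous_const.mul (hcr.pow 2)).intervalIntegrable _ _
  rw [intervalIntegral.integral_add hi (by simp), intervalIntegral.integral_const_mul, integral_sq_rate hF hG ht,
    intervalIntegral.integral_const, smul_eq_mul] at h3
  have h4 : (8 * C)⁻¹ * (2 * ∫ h in (0 : ℝ)..H, ∫ g in (0 : ℝ)..G t h, F h g) ≤
      (8 * C)⁻¹ * (2 * (C * H + 2 * C * G t 0)) := by gcongr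
  have h5 : (8 * C)⁻¹ * (2 * (C * H + 2 * C * G t 0)) = H / 4 + G t 0 / 2 := by
    field_simp; ring
  linarith

theorem strainBound (hF : IsDensity F C H) (hG : IsStrain F H G)
    (hpos : ∀ h, 0 ≤ h → ∀ g, 0 ≤ F h g) : StrainBound G fun t => H + (4 * C + 1) * t where
  mono := by
    have := hF.C_pos
    intro a _ b _ hab
    dsimp only
    gcongr
  le_self t ht := by
    have := hF.C_pos
    have := hF.H_pos
    nlinarith
  abs_le t η ht hη := by
    have := hF.H_pos
    rw [abs_of_nonneg (nonneg hF hG hpos ht hη)]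
    linarith [antitone hF hG hpos ht le_rfl hη, le_linear hF hG hpos ht]

end IsStrain

end

/-! ### Linear lower bound for the strain and growth of derivatives. -/

noncomputable section

namespace IsStrain

variable {F G : ℝ → ℝ → ℝ} {C H c₀ : ℝ}

/-- Let b be the least height in [0, 1] with h e^(2G) ≥ 1. On (b/2, b) minimality and monotonicity
of G force 1/2 ≤ h e^(2G) < 1, so the two terms of the denominator are comparable to h and F ≥
c₀/(4b). An interval of length b/2 thus contributes c₀/8, whatever b is. -/
theorem le_rate (hF : IsDensity F C H) (hG : IsStrain F H G)
    (hpos : ∀ h, 0 ≤ h → ∀ g, 0 ≤ F h g) (hH : 1 ≤ H) (hc₀ : 0 ≤ c₀)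
    (hlow : ∀ h ∈ Icc (0 : ℝ) 1, ∀ g,
      c₀ * (Real.exp (-(2 * g)) + h ^ 2 * Real.exp (2 * g))⁻¹ ≤ F h g)
    {t : ℝ} (ht : 0 ≤ t) : c₀ / 8 ≤ ∫ h in (0 : ℝ)..H, F h (G t h) := by
  have hcont : Continuous fun h => h * Real.exp (2 * G t h) :=
    continuous_id.mul (Real.continuous_exp.comp (continuous_const.mul (hG.continuous_slice t)))
  have hS : IsCompact (Icc (0 : ℝ) 1 ∩ {h | 1 ≤ h * Real.exp (2 * G t h)}) :=
    isCompact_Icc.inter_right (isClosed_le continuous_const hcont)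
  -- The height 1 qualifies because G is nonnegative.
  obtain ⟨b, ⟨hb01, hb⟩, hmin⟩ := hS.exists_isLeast ⟨1, ⟨zero_le_one, le_rfl⟩, by
    have := nonneg hF hG hpos ht zero_le_one
    rw [mem_ofPred_eq, one_mul]
    exact Real.one_le_exp (by linarith)⟩
  rw [mem_ofPred_eq] at hb
  have hb0 : 0 < b := by
    rcases hb01.1.lt_or_eq with h | h
    · exact h
    · rw [← h, zero_mul] at hb
      linarith
  have hc := hF.continuous_section hG.continuous t
  have h1 : ∫ _ in (b / 2)..b, c₀ / (4 * b) ≤ ∫ h in (b / 2)..b, F h (G t h) := by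
    refine intervalIntegral.integral_mono_on_of_le_Ioo (by linarith) (by simp)
      (hc.intervalIntegrable _ _) fun h hh => ?_
    have hh0 : 0 < h := lt_trans (by linarith) hh.1
    have hh1 : h ≤ 1 := hh.2.le.trans hb01.2
    have hlt : h * Real.exp (2 * G t h) < 1 := by
      by_contra hcon
      exact absurd (hmin ⟨⟨hh0.le, hh1⟩, not_lt.1 hcon⟩) (not_le.2 hh.2)
    have hle : 1 ≤ 2 * (h * Real.exp (2 * G t h)) := by
      have e1 : Real.exp (2 * G t b) ≤ Real.exp (2 * G t h) :=
        Real.exp_le_exp.2 (by linarith [antitone hF hG hpos ht hh0.le hh.2.le])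
      calc 1 ≤ b * Real.exp (2 * G t b) := hb
        _ ≤ (2 * h) * Real.exp (2 * G t h) := by
          have := hh.1
          gcongr
          linarith
        _ = _ := by ring
    refine le_trans ?_ (hlow h ⟨hh0.le, hh1⟩ _)
    rw [div_eq_mul_inv]
    refine mul_le_mul_of_nonneg_left ?_ hc₀
    refine inv_anti₀ (by positivity) ?_
    have e := Real.exp_pos (2 * G t h)
    have e2 : Real.exp (-(2 * G t h)) ≤ 2 * h := by
      rw [Real.exp_neg, inv_le_iff_one_le_mul₀ e]
      linarith
    have e3 : h ^ 2 * Real.exp (2 * G t h) ≤ h := by nlinarith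
    linarith [hh.2]
  have h2 : ∫ _ in (b / 2)..b, c₀ / (4 * b) = c₀ / 8 := by
    rw [intervalIntegral.integral_const, smul_eq_mul]
    field_simp
    ring
  rw [← h2]
  refine h1.trans (intervalIntegral.integral_mono_interval (by linarith) (by linarith)
    (hb01.2.trans hH) ?_ (hc.intervalIntegrable _ _))
  filter_upwards [ae_restrict_mem measurableSet_Ioc] with h hh
  exact hpos h hh.1.le _

theorem linear_le (hF : IsDensity F C H) (hG : IsStrain F H G)
    (hpos : ∀ h, 0 ≤ h → ∀ g, 0 ≤ F h g) (hH : 1 ≤ H) (hc₀ : 0 ≤ c₀)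
    (hlow : ∀ h ∈ Icc (0 : ℝ) 1, ∀ g,
      c₀ * (Real.exp (-(2 * g)) + h ^ 2 * Real.exp (2 * g))⁻¹ ≤ F h g)
    {t : ℝ} (ht : 0 ≤ t) : c₀ / 8 * t ≤ G t 0 := by
  rw [equation hF hG ht le_rfl]
  calc c₀ / 8 * t = ∫ _ in (0 : ℝ)..t, c₀ / 8 := by
        rw [intervalIntegral.integral_const, smul_eq_mul]; ring
    _ ≤ _ := intervalIntegral.integral_mono_on ht (by simp)
        ((hF.continuous_rate_time hG.continuous 0).intervalIntegrable _ _)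
        fun s hs => le_rate hF hG hpos hH hc₀ hlow hs.1

end IsStrain

/-- Restriction to the axis is composition with the isometric inclusion s ↦ (s, 0), which does not
increase the norms of derivatives. -/
theorem enorm_iteratedDeriv_le_derivSup {w : ℝ × ℝ → ℝ} {ψ : ℝ → ℝ} {l : ℕ}
    (hw : ContDiffOn ℝ l w quadrant) (hψ : ContDiff ℝ l ψ) (h : ∀ s, 0 ≤ s → w (s, 0) = ψ s)
    {s : ℝ} (hs : 0 ≤ s) : ‖iteratedDeriv l ψ s‖ₑ ≤ derivSup l w := by
  have hpre : ContinuousLinearMap.inl ℝ ℝ ℝ ⁻¹' quadrant = Ici 0 := by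
    ext r
    simp [quadrant]
  have hmem : ((s, 0) : ℝ × ℝ) ∈ quadrant := ⟨hs, le_rfl⟩
  have h1 := (ContinuousLinearMap.inl ℝ ℝ ℝ).iteratedFDerivWithin_comp_right hw
    uniqueDiffOn_quadrant (hpre ▸ uniqueDiffOn_Ici 0) (x := s) hmem le_rfl
  have heq : EqOn (w ∘ ContinuousLinearMap.inl ℝ ℝ ℝ) ψ (Ici 0) := fun r hr => h r hr
  rw [hpre, iteratedFDerivWithin_congr heq hs,
    iteratedFDerivWithin_eq_iteratedFDeriv (uniqueDiffOn_Ici 0) hψ.contDiffAt hs] at h1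
  have h2 : ‖iteratedDeriv l ψ s‖ ≤ ‖iteratedFDerivWithin ℝ l w quadrant (s, 0)‖ := by
    rw [← norm_iteratedFDeriv_eq_norm_iteratedDeriv, h1]
    refine (ContinuousMultilinearMap.norm_compContinuousLinearMap_le _ _).trans (le_of_eq ?_)
    simp [ContinuousLinearMap.norm_inl]
  exact (enorm_le_iff_norm_le.2 h2).trans
    (le_iSup₂ (f := fun x _ => ‖iteratedFDerivWithin ℝ l w quadrant x‖ₑ) _ hmem)

/-- No derivative of a nontrivial smooth function supported in `[a, ∞)` vanishes on `(0, ∞)`. -/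
theorem exists_iteratedDeriv_ne_zero {φ : ℝ → ℝ} (hφ : ∀ l : ℕ, ContDiff ℝ l φ) {a b : ℝ}
    (ha : 0 < a) (hzero : ∀ x < a, φ x = 0) (hb : φ b ≠ 0) (l : ℕ) :
    ∃ z, 0 < z ∧ iteratedDeriv l φ z ≠ 0 := by
  have hz : ∀ k : ℕ, ∀ x < a, iteratedDeriv k φ x = 0 := by
    intro k x hx
    have : φ =ᶠ[𝓝 x] fun _ => 0 := by
      filter_upwards [Iio_mem_nhds hx] with y hy
      exact hzero y hy
    rw [this.iteratedDeriv_eq]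
    simp
  have hpos : ∀ k : ℕ, ∀ x, iteratedDeriv k φ x ≠ 0 → 0 < x := fun k x hx =>
    ha.trans_le (not_lt.1 fun h => hx (hz k x h))
  induction l with
  | zero => exact ⟨b, hpos 0 b (by simpa using hb), by simpa using hb⟩
  | succ l ih =>
    obtain ⟨z, -, hne⟩ := ih
    by_contra hcon
    -- If the next derivative vanished on (0, ∞) it would vanish everywhere, and the current one
    -- would be a constant that is 0 to the left of a.
    have hd : ∀ x, deriv (iteratedDeriv l φ) x = 0 := by
      intro x
      rw [← iteratedDeriv_succ]
      by_contra hx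
      exact hcon ⟨x, hpos _ x hx, hx⟩
    refine hne ?_
    rw [is_const_of_deriv_eq_zero ((hφ (l + 1)).differentiable_iteratedDeriv' l) hd z 0]
    exact hz l 0 ha

/-- A bump function equal to `1` on `[1, 2]`, supported in `[1/2, 5/2]`. -/
def radialBump : ContDiffBump (3 / 2 : ℝ) := ⟨1 / 2, 1, by norm_num, by norm_num⟩

/-- A bump function equal to `1` on `[-1, 1]`, supported in `[-2, 2]`. -/
def axialBump : ContDiffBump (0 : ℝ) := ⟨1, 2, by norm_num, by norm_num⟩

/-- A smooth nonnegative vorticity that does not vanish on the axis `x₂ = 0`. -/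
def bumpVorticity (x : ℝ × ℝ) : ℝ := radialBump x.1 * axialBump x.2

theorem contDiff_bumpVorticity (n : ℕ) : ContDiff ℝ n bumpVorticity :=
  (radialBump.contDiff.comp contDiff_fst).mul (axialBump.contDiff.comp contDiff_snd)

theorem radialBump_ne_zero {s : ℝ} (h : radialBump s ≠ 0) : 1 / 2 < s ∧ s < 5 / 2 := by
  have : dist s (3 / 2) < 1 := not_le.1 fun hle => h (radialBump.zero_of_le_dist hle)
  rw [Real.dist_eq, abs_lt] at this
  constructor <;> linarith

theorem axialBump_ne_zero {s : ℝ} (h : axialBump s ≠ 0) : s < 2 := by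
  have : dist s 0 < 2 := not_le.1 fun hle => h (axialBump.zero_of_le_dist hle)
  rw [Real.dist_eq, abs_lt] at this
  linarith

theorem radialBump_eq_one {s : ℝ} (h : s ∈ Icc (1 : ℝ) 2) : radialBump s = 1 := by
  refine radialBump.one_of_mem_closedBall ?_
  rw [Metric.mem_closedBall, Real.dist_eq, abs_le]
  change -(1 / 2) ≤ s - 3 / 2 ∧ s - 3 / 2 ≤ 1 / 2
  constructor <;> linarith [h.1, h.2]

theorem axialBump_eq_one {s : ℝ} (h : s ∈ Icc (0 : ℝ) 1) : axialBump s = 1 := by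
  refine axialBump.one_of_mem_closedBall ?_
  rw [Metric.mem_closedBall, Real.dist_eq, abs_le]
  change -1 ≤ s - 0 ∧ s - 0 ≤ 1
  constructor <;> linarith [h.1, h.2]

theorem bumpVorticity_nonneg (x : ℝ × ℝ) : 0 ≤ bumpVorticity x :=
  mul_nonneg radialBump.nonneg axialBump.nonneg

theorem profile_bumpVorticity : Profile bumpVorticity (1 / 2) (5 / 2) 1 where
  continuous := (contDiff_bumpVorticity 0).continuous
  delta_pos := by norm_num
  delta_le_one := by norm_num
  one_le_radius := by norm_num
  bound x := by
    rw [abs_of_nonneg (bumpVorticity_nonneg x)]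
    exact mul_le_one₀ radialBump.le_one axialBump.nonneg axialBump.le_one
  supp x _ hne := by
    have h1 := radialBump_ne_zero (left_ne_zero_of_mul hne)
    have h2 := axialBump_ne_zero (right_ne_zero_of_mul hne)
    exact ⟨h1.1, h1.2.le, by linarith⟩

/-- Only 1 ≤ z ≤ 2 is kept: there h/z ≤ 1, so the vorticity equals 1, and z⁴ ≤ 16 gives the
constant. -/
theorem le_strainDensity_bumpVorticity {h : ℝ} (hh : h ∈ Icc (0 : ℝ) 1) (g : ℝ) :
    1 / 16 * (Real.exp (-(2 * g)) + h ^ 2 * Real.exp (2 * g))⁻¹ ≤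
      strainDensity bumpVorticity (1 / 2) (5 / 2) h g := by
  have hP := profile_bumpVorticity
  have hi := hP.intervalIntegrable_kernel h g
  rw [hP.strainDensity_eq]
  have h1 : ∫ _ in (1 : ℝ)..2, 1 / 16 * (Real.exp (-(2 * g)) + h ^ 2 * Real.exp (2 * g))⁻¹ ≤
      ∫ z in (1 : ℝ)..2, kernel bumpVorticity (max z (1 / 2)) h g := by
    refine intervalIntegral.integral_mono_on one_le_two (by simp) (hi.mono_set ?_) fun z hz => ?_
    · rw [uIcc_of_le one_le_two, uIcc_of_le (by norm_num)]
      exact Icc_subset_Icc (by norm_num) (by norm_num)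
    · rw [max_eq_left (by linarith [hz.1])]
      have hz0 : 0 < z := zero_lt_one.trans_le hz.1
      have hone : bumpVorticity (z, h / z) = 1 := by
        rw [bumpVorticity, radialBump_eq_one hz, axialBump_eq_one, mul_one]
        exact ⟨div_nonneg hh.1 hz0.le, (div_le_one hz0).2 (hh.2.trans hz.1)⟩
      rw [kernel, hone, one_mul, one_div, ← mul_inv]
      refine le_trans ?_ (le_mul_of_one_le_left
        (inv_nonneg.2 (Profile.denom_pos hz0 h g).le) hz.1)
      refine inv_anti₀ (Profile.denom_pos hz0 h g) ?_
      have e1 : z ^ 4 ≤ 16 := (pow_le_pow_left₀ hz0.le hz.2 4).trans (by norm_num)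
      have e2 := mul_le_mul_of_nonneg_right e1 (Real.exp_pos (-(2 * g))).le
      have e3 : 0 ≤ h ^ 2 * Real.exp (2 * g) := by positivity
      linarith
  rw [intervalIntegral.integral_const, smul_eq_mul, show (2 : ℝ) - 1 = 1 by norm_num, one_mul] at h1
  refine h1.trans (intervalIntegral.integral_mono_interval (by norm_num) one_le_two (by norm_num)
    ?_ hi)
  refine Eventually.of_forall fun z => ?_
  have hz0 : 0 < max z (1 / 2 : ℝ) := lt_max_of_lt_right (by norm_num)
  exact mul_nonneg (bumpVorticity_nonneg _)
    (mul_nonneg hz0.le (inv_nonneg.2 (Profile.denom_pos hz0 h g).le))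

/-- On the axis x₂ = 0 the solution is φ(e^(G(t,0)) s) with φ the radial bump, so at s = e^(-G(t,0))
z its l-th derivative is e^(l G(t,0)) φ^(l)(z), with z chosen once so that φ^(l)(z) ≠ 0. -/
theorem exists_exp_le_derivSup_bumpVorticity {G : ℝ → ℝ → ℝ} {c₁ : ℝ} (hc₁ : 0 < c₁)
    (hG : ∀ t, 0 ≤ t → c₁ * t ≤ G t 0) {l : ℕ} (hl : 1 ≤ l)
    (hw : ∀ t, 0 ≤ t → ContDiffOn ℝ l (vorticity bumpVorticity G t) quadrant) :
    ∃ c : ℝ, 0 < c ∧ ∀ t : ℝ, 0 ≤ t →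
      ENNReal.ofReal (c * Real.exp (c * t)) ≤ derivSup l (vorticity bumpVorticity G t) := by
  obtain ⟨z, hz, hne⟩ := exists_iteratedDeriv_ne_zero (φ := radialBump) (a := 1 / 2) (b := 1)
    (fun _ => radialBump.contDiff) (by norm_num)
    (fun x hx => by
      by_contra hne
      exact absurd (radialBump_ne_zero hne).1 (not_lt.2 hx.le))
    (by rw [radialBump_eq_one ⟨le_rfl, one_le_two⟩]; exact one_ne_zero) l
  set d := |iteratedDeriv l radialBump z| with hd
  have hd0 : 0 < d := abs_pos.2 hne
  refine ⟨min d c₁, lt_min hd0 hc₁, fun t ht => ?_⟩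
  set e := Real.exp (G t 0) with he
  have he0 : 0 < e := Real.exp_pos _
  have haxis : ∀ s, 0 ≤ s → vorticity bumpVorticity G t (s, 0) = radialBump (e * s) := by
    intro s _
    simp only [vorticity, strainMap, bumpVorticity, mul_zero, zero_mul]
    rw [axialBump_eq_one ⟨le_rfl, zero_le_one⟩, mul_one, mul_comm]
  have hψ : ContDiff ℝ l fun s => radialBump (e * s) :=
    radialBump.contDiff.comp (contDiff_const.mul contDiff_id)
  have key := enorm_iteratedDeriv_le_derivSup (hw t ht) hψ haxis (s := e⁻¹ * z) (by positivity)
  simp only [iteratedDeriv_comp_const_mul radialBump.contDiff] at key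
  rw [mul_inv_cancel_left₀ he0.ne',
    ← ofReal_norm, norm_mul, norm_pow, Real.norm_eq_abs, Real.norm_eq_abs, abs_of_pos he0] at key
  refine le_trans (ENNReal.ofReal_le_ofReal ?_) key
  have h1 : Real.exp (min d c₁ * t) ≤ e :=
    Real.exp_le_exp.2 ((mul_le_mul_of_nonneg_right (min_le_right _ _) ht).trans (hG t ht))
  have h2 : 1 ≤ e := Real.one_le_exp ((mul_nonneg hc₁.le ht).trans (hG t ht))
  rw [mul_comm (e ^ l)]
  exact mul_le_mul (min_le_left _ _) (h1.trans (le_self_pow₀ h2 (by omega))) (Real.exp_pos _).le hd0.le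

theorem ExpBounded.exists_exp_bound {a b : ℝ} (hb : 0 ≤ b) {φ : ℝ → ℝ≥0∞}
    (h : ExpBounded (fun t => a + b * t) φ) :
    ∃ C : ℝ, 0 < C ∧ ∀ t, 0 ≤ t → φ t ≤ ENNReal.ofReal (C * Real.exp (C * t)) := by
  obtain ⟨C, hC, h⟩ := h
  refine ⟨C * Real.exp (C * a) + C * b + 1, by positivity, fun t ht =>
    (h t ht).trans (ENNReal.ofReal_le_ofReal ?_)⟩
  rw [mul_add, Real.exp_add, ← mul_assoc]
  have h1 : 0 ≤ C * Real.exp (C * a) := by positivity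
  have h2 : 0 ≤ C * b := by positivity
  refine mul_le_mul (by linarith) (Real.exp_le_exp.2 ?_) (Real.exp_pos _).le (by positivity)
  rw [← mul_assoc]
  exact mul_le_mul_of_nonneg_right (by linarith) ht

end

end HyperbolicEuler

theorem theorem3 :
    -- global existence and uniqueness, and the exponential upper bound for nonnegative data
    (∀ n : ℕ, 1 ≤ n → ∀ ω₀ : ℝ × ℝ → ℝ, MemK n ω₀ →
      ∃ ω : ℝ → ℝ × ℝ → ℝ,
        IsSolutionOn n ω₀ (Ici 0) ω ∧
        ContinuousOn (fun t => volume (suppD (ω t))) (Ici 0) ∧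
        ContinuousOn (fun t => (delta (ω t))⁻¹) (Ici 0) ∧
        (∀ I : Set ℝ, (I = Ici 0 ∨ ∃ T : ℝ, 0 < T ∧ I = Icc 0 T) →
          ∀ ω' : ℝ → ℝ × ℝ → ℝ, IsSolutionOn n ω₀ I ω' →
            ∀ t ∈ I, ∀ x ∈ quadrant, ω' t x = ω t x) ∧
        ((∀ x ∈ quadrant, 0 ≤ ω₀ x) →
          ∃ C : ℝ, 0 < C ∧ ∀ t : ℝ, 0 ≤ t →
            kNorm n (ω t) ≤ ENNReal.ofReal (C * Real.exp (C * t)))) ∧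
    -- data for which the derivatives of every order do grow exponentially
    (∃ ω₀ : ℝ × ℝ → ℝ, (∀ n : ℕ, 1 ≤ n → MemK n ω₀) ∧ (∀ x ∈ quadrant, 0 ≤ ω₀ x) ∧
      ∃ ω : ℝ → ℝ × ℝ → ℝ, (∀ n : ℕ, 1 ≤ n → IsSolutionOn n ω₀ (Ici 0) ω) ∧
        ∀ l : ℕ, 1 ≤ l → ∃ c : ℝ, 0 < c ∧ ∀ t : ℝ, 0 ≤ t →
          ENNReal.ofReal (c * Real.exp (c * t)) ≤ derivSup l (ω t)) := by
  refine ⟨fun n hn ω₀ hω₀ => ?_, ?_⟩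
  · obtain ⟨δ, R, B, hf⟩ := hω₀.exists_profile
    have heq : ∀ x ∈ quadrant, extendQuadrant ω₀ x = ω₀ x := fun x hx => extendQuadrant_eq ω₀ hx
    have hfn : ContDiffOn ℝ n (extendQuadrant ω₀) quadrant := hω₀.contDiffOn.congr heq
    have hF := hf.isDensity
    have hC := hF.C_pos
    have hH := hF.H_pos
    obtain ⟨G, hG, hGb⟩ := hF.exists_isStrain
    -- Without a sign the strain is only known to be exponentially bounded, so the norm bound is
    -- double exponential. This suffices for boundedness on bounded time intervals; the summand t
    -- gives t ≤ m(t).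
    have hm : StrainBound G fun t => t + (R ^ 2 + 1) *
        Real.exp (2 * (B * R ^ 2 / δ ^ 4 + 1) * t) :=
      { mono := fun a _ b _ hab => by
          dsimp only
          gcongr
        le_self := fun t _ => le_add_of_nonneg_right (by positivity)
        abs_le := fun t η ht _ => (hGb t η ht).trans (le_add_of_nonneg_left ht) }
    refine ⟨vorticity (extendQuadrant ω₀) G, isSolutionOn_vorticity hf hG hm hn hfn heq, ?_,
      (continuous_delta_vorticity hf hG).continuousOn, ?_, fun hpos => ?_⟩
    · simp_rw [volume_suppD_vorticity hf hG]
      exact continuousOn_const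
    · intro I hI ω' hω' t ht x hx
      have hsub : 0 ≤ t ∧ Icc 0 t ⊆ I := by
        rcases hI with rfl | ⟨T, -, rfl⟩
        · exact ⟨ht, Icc_subset_Ici_self⟩
        · exact ⟨ht.1, Icc_subset_Icc_right ht.2⟩
      exact (hω'.mono hsub.2).eq_vorticity hf hG heq hn hsub.1 t (right_mem_Icc.2 hsub.1) x hx
    -- For nonnegative data the linear bound on the strain replaces `hm`.
    · have hm' := IsStrain.strainBound hF hG fun h hh g =>
        hf.strainDensity_nonneg (fun x hx => by rw [heq x hx]; exact hpos x hx) hh g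
      exact (expBounded_kNorm hf hG hm' hfn).exists_exp_bound (by positivity)
  · have hf := profile_bumpVorticity
    have hF := hf.isDensity
    obtain ⟨G, hG, -⟩ := hF.exists_isStrain
    have hpos : ∀ h, 0 ≤ h → ∀ g, 0 ≤ strainDensity bumpVorticity (1 / 2) (5 / 2) h g :=
      fun h hh g => hf.strainDensity_nonneg (fun x _ => bumpVorticity_nonneg x) hh g
    have hm := IsStrain.strainBound hF hG hpos
    have hfn : ∀ n : ℕ, ContDiffOn ℝ n bumpVorticity quadrant := fun n =>
      (contDiff_bumpVorticity n).contDiffOn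
    refine ⟨bumpVorticity, fun n _ => hf.memK (hfn n), fun x _ => bumpVorticity_nonneg x,
      vorticity bumpVorticity G,
      fun n hn => isSolutionOn_vorticity hf hG hm hn (hfn n) fun x _ => rfl, fun l hl => ?_⟩
    -- This is the rate c₀/8 of `IsStrain.linear_le` with c₀ = 1/16.
    exact exists_exp_le_derivSup_bumpVorticity (c₁ := 1 / 16 / 8) (by norm_num)
      (fun t ht => IsStrain.linear_le hF hG hpos (by norm_num) (by norm_num)
        (fun h hh g => le_strainDensity_bumpVorticity hh g) ht) hl
      fun t ht => contDiffOn_vorticity hf hG hm (hfn l) ht
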